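/- Let $d\ge 1$, $\alpha\in(0,2)$, $\beta\in(0,1)$, $T>0$. Let $\Omega\subset\mathbb R^d$ be bounded and open and satisfy the exterior cone condition: for each $x\in\partial\Omega$ there is a finite right circular open cone with vertex $x$ contained in $\Omega^c$. Let $X^\beta$ be the standard $\beta$-stable subordinator, i.e. the Lévy process with non-decreasing paths and $\mathbf E[e^{-kX^\beta(s)}]=e^{-sk^\beta}$ ($k>0$), and let $X^\alpha$ be the rotationally symmetric $\alpha$-stable Lévy process in $\mathbb R^d$, $\mathbf E[e^{ik\cdot X^\alpha(s)}]=e^{-s|k|^\alpha}$ (both started at $0$, with càdlàg paths). Put $\tau_0(t)=\inf\{s>0:t-X^\beta(s)\le 0\}$ and $\tau_\Omega(x)=\inf\{s>0:x+X^\alpha(s)\notin\Omega\}$. All function spaces carry the supremum norm. Let $C_0([0,T])=\{f\in C([0,T]):f(0)=0\}$; $C_\infty((-\infty,T])$ be the continuous functions vanishing at infinity; $C_{\partial\Omega}(\Omega)=\{f\in C(\overline\Omega):f=0\text{ on }\partial\Omega\}$; $C_{\partial\Omega}([0,T]\times\Omega)=\{f\in C([0,T]\times\overline\Omega): f=0\text{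 on }[0,T]\times\partial\Omega\}$; $C_{0,\partial\Omega}([0,T]\times\Omega)$ be its subspace $\{f(0,\cdot)=0\}$; and $C_{\infty,\partial\Omega}((-\infty,T]\times\Omega)$ be the continuous functions on the locally compact space $(-\infty,T]\times\Omega$ vanishing at infinity. A *sub-Feller semigroup* on such a space is a strongly continuous contraction semigroup of linear operators preserving non-negative functions. The generator $(\mathcal L,\mathrm{Dom}(\mathcal L))$ of $P$ is $\mathcal Lf=\lim_{s\downarrow0}s^{-1}(P_sf-f)$ on the set of $f$ for which this limit exists in the space. A set $C\subset\mathrm{Dom}(\mathcal L)$ is an *invariant core* if $\mathcal L$ is the closure of its restriction to $C$ and $P_sC\subset C$ for every $s>0$. Define - $P^{\beta,\infty}_sf(t)=\mathbf E[f(t-X^\beta(s))]$ on $C_\infty((-\infty,T])$; - $P^\beta_sf(t)=\mathbf E[f((t-X^\beta(s))\mathbf 1_{\{s<\tau_0(t)\}})]$ on $C([0,T])$ (absorption at $0$); - $P^{\beta,\mathrm{kill}}_sf(t)=\mathbf E[f(t-X^\beta(s))\mathbf 1_{\{s<\tau_0(t)\}}]$ on $C_0([0,T])$; - $P^\Omega_sf(x)=\mathbf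 E[f(x+X^\alpha(s))\mathbf 1_{\{s<\tau_\Omega(x)\}}]$ on $C_{\partial\Omega}(\Omega)$; with generators $\mathcal L^\infty_\beta,\mathcal L_\beta,\mathcal L^{\mathrm{kill}}_\beta,\mathcal L_\Omega$, and let $\mathcal C^\infty_\beta,\mathcal C_\beta,\mathcal C^{\mathrm{kill}}_\beta,\mathcal C_\Omega$ be arbitrary invariant cores for them. For sets $F,G$ of functions let $\mathrm{Span}\{F\cdot G\}$ be the linear span of the functions $(t,x)\mapsto p(t)q(x)$, $p\in F$, $q\in G$. Below, time operators act on the $t$-variable and $P^\Omega,\mathcal L_\Omega$ on the $x$-variable. Then: (i) $P^{\beta,\Omega}=\{P^\beta_sP^\Omega_s\}_{s\ge0}$ is a sub-Feller semigroup on $C_{\partial\Omega}([0,T]\times\Omega)$, and its generator $\mathcal L_{\beta,\Omega}$ is the closure of $(\mathcal L_\beta+\mathcal L_\Omega,\mathrm{Span}\{\mathcal C_\beta\cdot\mathcal C_\Omega\})$ in that space. (ii) $P^{\beta,\Omega,\mathrm{kill}}=\{P^{\beta,\mathrm{kill}}_sP^\Omega_s\}_{s\ge0}$ is a sub-Feller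 semigroup on $C_{0,\partial\Omega}([0,T]\times\Omega)$, and its generator $\mathcal L^{\mathrm{kill}}_{\beta,\Omega}$ is the closure of $(\mathcal L^{\mathrm{kill}}_\beta+\mathcal L_\Omega,\mathrm{Span}\{\mathcal C^{\mathrm{kill}}_\beta\cdot\mathcal C_\Omega\})$ in that space. (iii) $P^{\beta,\Omega,\infty}=\{P^{\beta,\infty}_sP^\Omega_s\}_{s\ge0}$ is a sub-Feller semigroup on $C_{\infty,\partial\Omega}((-\infty,T]\times\Omega)$, and its generator is the closure of $(\mathcal L^\infty_\beta+\mathcal L_\Omega,\mathrm{Span}\{\mathcal C^\infty_\beta\cdot\mathcal C_\Omega\})$ in that space. (iv) $P^{\beta,\Omega}_s=P^{\beta,\Omega,\mathrm{kill}}_s$ on $C_{0,\partial\Omega}([0,T]\times\Omega)$ for all $s\ge0$; $\mathcal L_{\beta,\Omega}=\mathcal L^{\mathrm{kill}}_{\beta,\Omega}$ on $\mathrm{Dom}(\mathcal L^{\mathrm{kill}}_{\beta,\Omega})$; and $\mathrm{Dom}(\mathcal L^{\mathrm{kill}}_{\beta,\Omega})=\mathrm{Dom}(\mathcal L_{\beta,\Omega})\cap\{f:f(0,\cdot)=0\}$.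 -/

import Mathlib

open MeasureTheory ProbabilityTheory Filter Topology Set
open scoped NNReal ENNReal BoundedContinuousFunction RealInnerProductSpace

namespace SpaceTimeStable

noncomputable section

/-! ## Banach spaces of continuous functions

All spaces carry the supremum norm: they are subspaces of the Banach space `X →ᵇ ℝ` of bounded
continuous functions. For compact `X` the space `X →ᵇ ℝ` is `C(X)`. -/

/-- The bounded continuous functions on `X` that vanish at every point of `Z`. -/
def vanishingOn {X : Type*} [TopologicalSpace X] (Z : Set X) : Submodule ℝ (X →ᵇ ℝ) where
  carrier := {f | ∀ x ∈ Z, f x = 0}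
  add_mem' := by
    intro f g hf hg x hx
    simp [hf x hx, hg x hx]
  zero_mem' := by
    intro x _
    simp
  smul_mem' := by
    intro c f hf x hx
    simp [hf x hx]

/-- The continuous functions on `X` that vanish at infinity. -/
def vanishingAtInfinity (X : Type*) [TopologicalSpace X] : Submodule ℝ (X →ᵇ ℝ) where
  carrier := {f | Tendsto f (cocompact X) (𝓝 0)}
  add_mem' := by
    intro f g hf hg
    have h := Tendsto.add hf hg
    rw [add_zero] at h
    exact h
  zero_mem' := by
    exact (tendsto_const_nhds : Tendsto (fun _ : X => (0 : ℝ)) (cocompact X) (𝓝 0))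
  smul_mem' := by
    intro c f hf
    have h := Tendsto.const_mul c hf
    rw [mul_zero] at h
    exact h

/-- `C([0,T])`. -/
def spaceC (T : ℝ) : Submodule ℝ (Icc (0 : ℝ) T →ᵇ ℝ) := ⊤

/-- `C₀([0,T])`, the functions in `C([0,T])` with `f(0) = 0`. -/
def spaceC0 (T : ℝ) : Submodule ℝ (Icc (0 : ℝ) T →ᵇ ℝ) := vanishingOn {t | (t : ℝ) = 0}

/-- `C_∞((-∞,T])`. -/
def spaceCInfty (T : ℝ) : Submodule ℝ (Iic T →ᵇ ℝ) := vanishingAtInfinity (Iic T)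

/-- `C_{∂Ω}(Ω)`, the continuous functions on the closure of `Ω` that vanish on `∂Ω`. -/
def spaceCBdry {d : ℕ} (Ω : Set (EuclideanSpace ℝ (Fin d))) :
    Submodule ℝ (closure Ω →ᵇ ℝ) :=
  vanishingOn {x | (x : EuclideanSpace ℝ (Fin d)) ∈ frontier Ω}

/-- `C_{∂Ω}([0,T] × Ω)`, the continuous functions on `[0,T] × closure Ω` that vanish on
`[0,T] × ∂Ω`. -/
def spaceCTBdry {d : ℕ} (T : ℝ) (Ω : Set (EuclideanSpace ℝ (Fin d))) :
    Submodule ℝ ((Icc (0 : ℝ) T × closure Ω) →ᵇ ℝ) :=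
  vanishingOn {z | (z.2 : EuclideanSpace ℝ (Fin d)) ∈ frontier Ω}

/-- `C_{0,∂Ω}([0,T] × Ω)`, the functions in `C_{∂Ω}([0,T] × Ω)` that also vanish at `t = 0`. -/
def spaceC0TBdry {d : ℕ} (T : ℝ) (Ω : Set (EuclideanSpace ℝ (Fin d))) :
    Submodule ℝ ((Icc (0 : ℝ) T × closure Ω) →ᵇ ℝ) :=
  spaceCTBdry T Ω ⊓ vanishingOn {z | (z.1 : ℝ) = 0}

/-- `C_{∞,∂Ω}((-∞,T] × Ω)`, the continuous functions on `(-∞,T] × Ω` that vanish at infinity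
(hence, `Ω` being open, also along `∂Ω`). -/
def spaceCInftyBdry {d : ℕ} (T : ℝ) (Ω : Set (EuclideanSpace ℝ (Fin d))) :
    Submodule ℝ ((Iic T × Ω) →ᵇ ℝ) :=
  vanishingAtInfinity (Iic T × Ω)

/-! ## Semigroups, generators and cores

A family of operators is given by its action on functions `X → ℝ`. That it maps a given Banach
space of continuous functions into itself is part of `IsSubFeller`. Operators in a Banach space of
functions, such as generators, are given by their graphs. -/

/-- `P` is a sub-Feller semigroup on `S`: a strongly continuous contraction semigroup of linear
operators on `S` that preserves non-negative functions. -/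
structure IsSubFeller {X : Type*} [TopologicalSpace X] (S : Submodule ℝ (X →ᵇ ℝ))
    (P : ℝ≥0 → (X → ℝ) → X → ℝ) : Prop where
  mapsTo : ∀ s, ∀ f ∈ S, ∃ g ∈ S, ⇑g = P s f
  map_add : ∀ s, ∀ f ∈ S, ∀ g ∈ S, P s ⇑(f + g) = P s f + P s g
  map_smul : ∀ s, ∀ c : ℝ, ∀ f ∈ S, P s ⇑(c • f) = c • P s f
  zero : ∀ f ∈ S, P 0 f = f
  add : ∀ s r, ∀ f ∈ S, P (s + r) f = P s (P r f)
  contraction : ∀ s, ∀ f ∈ S, ∀ x, |P s f x| ≤ ‖f‖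
  nonneg : ∀ s, ∀ f ∈ S, (∀ x, 0 ≤ f x) → ∀ x, 0 ≤ P s f x
  strongCont : ∀ f ∈ S, TendstoUniformly (fun s => P s f) f (𝓝[>] 0)

/-- The graph of the generator of `P` on `S`: the pairs `(f, g)` in `S × S` such that
`(P_h f - f) / h → g` in the supremum norm as `h ↓ 0`. -/
def generator {X : Type*} [TopologicalSpace X] (S : Submodule ℝ (X →ᵇ ℝ))
    (P : ℝ≥0 → (X → ℝ) → X → ℝ) : Set ((X →ᵇ ℝ) × (X →ᵇ ℝ)) :=
  {p | p.1 ∈ S ∧ p.2 ∈ S ∧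
    TendstoUniformly (fun (h : ℝ≥0) x => (h : ℝ)⁻¹ * (P h p.1 x - p.1 x)) p.2 (𝓝[>] 0)}

/-- The domain of the operator with graph `G`. -/
def domain {B : Type*} (G : Set (B × B)) : Set B := {f | ∃ g, (f, g) ∈ G}

/-- `C` is an invariant core for the generator of `P` on `S`: `C` lies in the domain, the generator
is the closure of its restriction to `C`, and `P_s C ⊆ C` for all `s > 0`. -/
structure IsInvariantCore {X : Type*} [TopologicalSpace X] (S : Submodule ℝ (X →ᵇ ℝ))
    (P : ℝ≥0 → (X → ℝ) → X → ℝ) (C : Set (X →ᵇ ℝ)) : Prop where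
  subset_domain : C ⊆ domain (generator S P)
  closure_eq : closure {p | p ∈ generator S P ∧ p.1 ∈ C} = generator S P
  invariant : ∀ s : ℝ≥0, 0 < s → ∀ f ∈ C, ∃ g ∈ C, ⇑g = P s f

/-! ## Stable processes -/

/-- Paths that are right-continuous with left limits. -/
def IsCadlagPath {E : Type*} [TopologicalSpace E] (x : ℝ≥0 → E) : Prop :=
  ∀ s, ContinuousWithinAt x (Ici s) s ∧ ∃ l, Tendsto x (𝓝[<] s) (𝓝 l)

/-- A Lévy process (started at `0`). -/
structure IsLevyProcess {𝓦 E : Type*} [MeasurableSpace 𝓦] [NormedAddCommGroup E]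
    [MeasurableSpace E] (X : ℝ≥0 → 𝓦 → E) (μ : Measure 𝓦) : Prop where
  measurable : ∀ s, Measurable (X s)
  zero : ∀ᵐ ω ∂μ, X 0 ω = 0
  indep : HasIndepIncrements X μ
  stationary : ∀ s h, μ.map (fun ω => X (s + h) ω - X s ω) = μ.map (X h)
  cadlag : ∀ᵐ ω ∂μ, IsCadlagPath fun s => X s ω

/-- The standard `β`-stable subordinator: a Lévy process with non-decreasing paths and Laplace
transform `E[exp (-k X_s)] = exp (-s k^β)`. -/
structure IsStableSubordinator {𝓦 : Type*} [MeasurableSpace 𝓦] (β : ℝ) (X : ℝ≥0 → 𝓦 → ℝ)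
    (μ : Measure 𝓦) : Prop extends IsLevyProcess X μ where
  monotone : ∀ᵐ ω ∂μ, Monotone fun s => X s ω
  laplace : ∀ s : ℝ≥0, ∀ k : ℝ, 0 < k →
    ∫ ω, Real.exp (-(k * X s ω)) ∂μ = Real.exp (-(s * k ^ β))

/-- The rotationally symmetric `α`-stable Lévy process in `ℝᵈ`, with characteristic function
`E[exp (i k · X_s)] = exp (-s |k|^α)`. -/
structure IsRotSymStable {𝓦 : Type*} [MeasurableSpace 𝓦] {d : ℕ} (α : ℝ)
    (X : ℝ≥0 → 𝓦 → EuclideanSpace ℝ (Fin d)) (μ : Measure 𝓦) : Prop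
    extends IsLevyProcess X μ where
  charFun_eq : ∀ s : ℝ≥0, ∀ k : EuclideanSpace ℝ (Fin d),
    charFun (μ.map (X s)) k = (Real.exp (-(s * ‖k‖ ^ α)) : ℂ)

/-- The first exit time `inf {s > 0 : x + X_s ∉ U}` of the process started at `x`, with value `∞`
if there is no such `s`. -/
def exitTime {𝓦 E : Type*} [Add E] (X : ℝ≥0 → 𝓦 → E) (U : Set E) (x : E) (ω : 𝓦) : ℝ≥0∞ :=
  ⨅ (s : ℝ≥0) (_ : 0 < s ∧ x + X s ω ∉ U), (s : ℝ≥0∞)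

/-- The first passage time `τ₀(t) = inf {s > 0 : t - X_s ≤ 0}`, which is the first exit time from
`(0,∞)` of the inverted process `t - X`. -/
def passageTime {𝓦 : Type*} (X : ℝ≥0 → 𝓦 → ℝ) (t : ℝ) (ω : 𝓦) : ℝ≥0∞ :=
  ⨅ (s : ℝ≥0) (_ : 0 < s ∧ t - X s ω ≤ 0), (s : ℝ≥0∞)

/-- The extension by `0` to `E` of a function on a subset `A` of `E`. -/
def zeroExt {E : Type*} {A : Set E} (f : A → ℝ) : E → ℝ :=
  Function.extend Subtype.val f 0

/-- `P^{β,∞}`, the semigroup of the inverted subordinator: `P_s f(t) = E[f(t - X_s)]`. -/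
def freeTime {𝓦 : Type*} [MeasurableSpace 𝓦] (X : ℝ≥0 → 𝓦 → ℝ) (μ : Measure 𝓦) (T : ℝ)
    (s : ℝ≥0) (f : Iic T → ℝ) (t : Iic T) : ℝ :=
  ∫ ω, zeroExt f (t - X s ω) ∂μ

open Classical in
/-- The inverted subordinator started at `t` and absorbed at `0` on its first passage. -/
def absorbedPath {𝓦 : Type*} (X : ℝ≥0 → 𝓦 → ℝ) (t : ℝ) (s : ℝ≥0) (ω : 𝓦) : ℝ :=
  if (s : ℝ≥0∞) < passageTime X t ω then t - X s ω else 0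

/-- `P^β`, the semigroup of the inverted subordinator absorbed at `0`. -/
def absorbedTime {𝓦 : Type*} [MeasurableSpace 𝓦] (X : ℝ≥0 → 𝓦 → ℝ) (μ : Measure 𝓦) (T : ℝ)
    (s : ℝ≥0) (f : Icc (0 : ℝ) T → ℝ) (t : Icc (0 : ℝ) T) : ℝ :=
  ∫ ω, zeroExt f (absorbedPath X t s ω) ∂μ

/-- `P^{β,kill}`, the semigroup of the inverted subordinator killed on its first passage:
`P_s f(t) = E[f(t - X_s); s < τ₀(t)]`. -/
def killedTime {𝓦 : Type*} [MeasurableSpace 𝓦] (X : ℝ≥0 → 𝓦 → ℝ) (μ : Measure 𝓦) (T : ℝ)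
    (s : ℝ≥0) (f : Icc (0 : ℝ) T → ℝ) (t : Icc (0 : ℝ) T) : ℝ :=
  ∫ ω, {ω | (s : ℝ≥0∞) < passageTime X t ω}.indicator (fun ω => zeroExt f (t - X s ω)) ω ∂μ

/-- `P^Ω`, the semigroup of the process `x + X` killed on exiting `Ω`:
`P_s f(x) = E[f(x + X_s); s < τ_Ω(x)]`, acting on functions on a set `A` that contains `Ω`
(below, `A` is `Ω` or its closure). -/
def killedSpace {𝓦 : Type*} [MeasurableSpace 𝓦] {d : ℕ}
    (X : ℝ≥0 → 𝓦 → EuclideanSpace ℝ (Fin d)) (μ : Measure 𝓦)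
    (Ω A : Set (EuclideanSpace ℝ (Fin d))) (s : ℝ≥0) (f : A → ℝ) (x : A) : ℝ :=
  ∫ ω, {ω | (s : ℝ≥0∞) < exitTime X Ω x ω}.indicator (fun ω => zeroExt f (x + X s ω)) ω ∂μ

/-! ## Products in space-time -/

/-- The operators `P_s Q_s` on functions of `(t, x)`, where `P_s` acts on the variable `t` and `Q_s`
acts on the variable `x`. -/
def productSemigroup {I A : Type*} (P : ℝ≥0 → (I → ℝ) → I → ℝ) (Q : ℝ≥0 → (A → ℝ) → A → ℝ)
    (s : ℝ≥0) (f : I × A → ℝ) (z : I × A) : ℝ :=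
  P s (fun t => Q s (fun x => f (t, x)) z.2) z.1

/-- `Span {C · D}`, the linear span of the functions `(t, x) ↦ p t * q x` with `p ∈ C`, `q ∈ D`.
The functions in `D` live on `Y` and are read on `A` through `ι : A → Y` (the identity of the
closure of `Ω`, or the inclusion of `Ω` in its closure). -/
def productSpan {I A Y : Type*} [TopologicalSpace I] [TopologicalSpace A] [TopologicalSpace Y]
    (ι : A → Y) (C : Set (I →ᵇ ℝ)) (D : Set (Y →ᵇ ℝ)) : Submodule ℝ ((I × A) →ᵇ ℝ) :=
  Submodule.span ℝ {f | ∃ p ∈ C, ∃ q ∈ D, ∀ t x, f (t, x) = p t * q (ι x)}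

/-- The graph of the operator `L + M` with domain `V`, where `L` (with graph `GP`) acts on the
variable `t` and `M` (with graph `GQ`) acts on the variable `x`: a pair `(f, g)` belongs to it iff
`f ∈ V` and `g = a + b`, where `a (·, x) = L (f (·, x))` for every `x` and
`b (t, ·) = M (f (t, ·))` for every `t`. -/
def sumOperator {I A Y : Type*} [TopologicalSpace I] [TopologicalSpace A] [TopologicalSpace Y]
    (ι : A → Y) (GP : Set ((I →ᵇ ℝ) × (I →ᵇ ℝ))) (GQ : Set ((Y →ᵇ ℝ) × (Y →ᵇ ℝ)))
    (V : Submodule ℝ ((I × A) →ᵇ ℝ)) : Set (((I × A) →ᵇ ℝ) × ((I × A) →ᵇ ℝ)) :=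
  {p | p.1 ∈ V ∧ ∃ a b : I × A → ℝ,
    (∀ x, ∃ q ∈ GP, (∀ t, q.1 t = p.1 (t, x)) ∧ ∀ t, q.2 t = a (t, x)) ∧
    (∀ t, ∃ q ∈ GQ, (∀ x, q.1 (ι x) = p.1 (t, x)) ∧ ∀ x, q.2 (ι x) = b (t, x)) ∧
    ∀ z, p.2 z = a z + b z}

/-! ## Regular sets -/

/-- The finite right circular open cone with vertex `x`, axis direction the unit vector `e`,
half-angle `θ` and height `h`. -/
def finiteCone {d : ℕ} (x e : EuclideanSpace ℝ (Fin d)) (θ h : ℝ) :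
    Set (EuclideanSpace ℝ (Fin d)) :=
  {y | ‖y - x‖ * Real.cos θ < ⟪y - x, e⟫ ∧ ⟪y - x, e⟫ < h}

/-- A regular set: bounded, open, with the exterior cone condition at every boundary point. -/
structure IsRegularSet {d : ℕ} (Ω : Set (EuclideanSpace ℝ (Fin d))) : Prop where
  isBounded : Bornology.IsBounded Ω
  isOpen : IsOpen Ω
  exteriorCone : ∀ x ∈ frontier Ω, ∃ e : EuclideanSpace ℝ (Fin d), ‖e‖ = 1 ∧
    ∃ θ ∈ Ioo 0 (Real.pi / 2), ∃ h > 0, finiteCone x e θ h ⊆ Ωᶜ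

end

end SpaceTimeStable

namespace SpaceTimeStable

set_option linter.unusedSectionVars false

/-! ## Contraction semigroups on a Banach space -/

section ContractionSemigroup

variable {E : Type*} [NormedAddCommGroup E] [NormedSpace ℝ E]

/-! The theorem splits into an abstract statement about products of semigroups and a proof that each
factor is sub-Feller.

Abstract part. Let `S` be the closed span of the products `p ⊗ q` with `p ∈ S₁`, `q ∈ S₂`
(`IsTensor`). A semigroup on either factor acts on `S` through one variable. The two actions
commute, as can be seen on products, so `P_s Q_s` is again a strongly continuous contraction
semigroup (`exists_productSemigroup`). The product rule puts `p ⊗ q` in the domain, with value `Lp ⊗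
q + p ⊗ Mq` (`pure_mem_infGenerator`). If `C` and `D` are invariant cores, the span of `C · D` is
dense, consists of domain elements and is invariant under the product semigroup. A dense invariant
subspace of the domain is a core (`closure_infGenerator_of_invariant`): a functional annihilating
the range of `1 - L` on it would grow like `e^t` along bounded orbits, hence vanishes, so that range
is dense, and dissipativity converts this into density of the graph. This gives the generator
statements of (i), (ii) and (iii) at once (`generator_product`). The three function spaces are such
tensor products by a partition of unity in time (`mem_closure_productSpan`).

Time factor. Paths of the subordinator increase, so surviving until `s` means `X_s < t`, and
absorption at `0` is the retraction of `t - X_s` onto `[0,T]`. The retraction is compatible with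
successive left translations, so the Markov property at a fixed time suffices
(`isSubFeller_retract`).

Space factor. The characteristic function `exp (-s|k|^α)` is integrable, so for positive `s` the law
of `Y_s` is absolutely continuous and the free process is strong Feller. Scaling and independence of
increments show that the process visits every cone at its starting point immediately
(`measure_avoid_cone_eq_zero`), so the exterior cone condition makes each boundary point regular.
The exit time is then replaced by a countable dense set of times: a path that is in `Ω` at all those
times is almost surely in `Ω` at every time, because touching the boundary would force it out of the
closure at once (`ae_forall_mem_of_mem_stay`). Hence the killed semigroup satisfies the semigroup
law by the Markov property at fixed times alone. Continuity inside `Ω` comes from the strong Feller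
property, and vanishing at the boundary from regularity.

Part (iv). On functions vanishing at `t = 0`, killing and absorbing agree. If such a function lies
in the absorbed domain, its difference quotients vanish at `t = 0`, hence so does its image under
the generator. -/

/-- A strongly continuous contraction semigroup of continuous linear operators. -/
structure IsContractionSemigroup (U : ℝ≥0 → E →L[ℝ] E) : Prop where
  zero : ∀ x, U 0 x = x
  add : ∀ s r x, U (s + r) x = U s (U r x)
  norm_le : ∀ s x, ‖U s x‖ ≤ ‖x‖
  strongCont : ∀ x, Tendsto (fun s => U s x) (𝓝[>] 0) (𝓝 x)

/-- The graph of the infinitesimal generator of a family of operators. -/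
def infGenerator (U : ℝ≥0 → E →L[ℝ] E) : Set (E × E) :=
  {p | Tendsto (fun h : ℝ≥0 => (h : ℝ)⁻¹ • (U h p.1 - p.1)) (𝓝[>] 0) (𝓝 p.2)}

theorem tendsto_toNNReal_nhdsGT_zero :
    Tendsto Real.toNNReal (𝓝[>] 0) (𝓝[>] (0 : ℝ≥0)) := by
  refine tendsto_nhdsWithin_iff.2 ⟨?_, ?_⟩
  · have := (continuous_real_toNNReal.tendsto 0)
    rw [Real.toNNReal_zero] at this
    exact this.mono_left nhdsWithin_le_nhds
  · filter_upwards [self_mem_nhdsWithin] with h hh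
    exact Real.toNNReal_pos.2 hh

theorem tendsto_coe_nhdsGT_zero :
    Tendsto (fun h : ℝ≥0 => (h : ℝ)) (𝓝[>] 0) (𝓝[>] (0 : ℝ)) := by
  refine tendsto_nhdsWithin_iff.2 ⟨?_, ?_⟩
  · exact (NNReal.continuous_coe.tendsto 0).mono_left nhdsWithin_le_nhds
  · filter_upwards [self_mem_nhdsWithin] with h hh
    exact NNReal.coe_pos.2 hh

theorem infGenerator_add {U : ℝ≥0 → E →L[ℝ] E} {p q : E × E} (hp : p ∈ infGenerator U)
    (hq : q ∈ infGenerator U) : p + q ∈ infGenerator U := by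
  refine (Tendsto.add hp hq).congr fun h => ?_
  simp only [Prod.fst_add, map_add, ← smul_add]
  congr 1
  abel

theorem infGenerator_smul {U : ℝ≥0 → E →L[ℝ] E} {p : E × E} (c : ℝ) (hp : p ∈ infGenerator U) :
    c • p ∈ infGenerator U := by
  refine (Tendsto.const_smul hp c).congr fun h => ?_
  simp only [Prod.smul_fst, map_smul, ← smul_sub]
  rw [smul_comm]

namespace IsContractionSemigroup

variable {U : ℝ≥0 → E →L[ℝ] E} (hU : IsContractionSemigroup U)
include hU

theorem comm (s r : ℝ≥0) (x : E) : U s (U r x) = U r (U s x) := by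
  rw [← hU.add, add_comm, hU.add]

theorem norm_sub_le (x : E) {a b : ℝ≥0} (hab : a ≤ b) :
    ‖U b x - U a x‖ ≤ ‖U (b - a) x - x‖ := by
  obtain ⟨c, rfl⟩ := le_iff_exists_add.1 hab
  rw [hU.add, ← map_sub, add_tsub_cancel_left]
  exact hU.norm_le _ _

theorem continuous_orbit (x : E) : Continuous fun s : ℝ => U s.toNNReal x := by
  have h0 : Tendsto (fun s => ‖U s x - x‖) (𝓝 0) (𝓝 0) := by
    have h1 : ContinuousWithinAt (fun s => U s x) (Ici 0) 0 :=
      continuousWithinAt_Ioi_iff_Ici.1 (by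
        rw [ContinuousWithinAt, hU.zero]
        exact hU.strongCont x)
    rw [Set.eq_univ_of_forall (s := Ici (0 : ℝ≥0)) fun t => mem_Ici.2 zero_le, continuousWithinAt_univ]
      at h1
    have : Tendsto (fun s => U s x) (𝓝 0) (𝓝 x) := by
      simpa [ContinuousAt, hU.zero] using h1
    simpa using (this.sub_const x).norm
  have : Continuous fun s : ℝ≥0 => U s x := by
    rw [continuous_iff_continuousAt]
    intro a
    rw [ContinuousAt, tendsto_iff_norm_sub_tendsto_zero]
    -- Subtraction in `ℝ≥0` is truncated, so this sum is the distance `|b - a|`.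
    have h1 : Tendsto (fun b : ℝ≥0 => (b - a) + (a - b)) (𝓝 a) (𝓝 0) := by
      have : Continuous fun b : ℝ≥0 => (b - a) + (a - b) := by fun_prop
      simpa using this.tendsto a
    refine squeeze_zero (fun _ => norm_nonneg _) (fun b => ?_) (h0.comp h1)
    rcases le_total a b with h | h
    · simpa [tsub_eq_zero_of_le h] using hU.norm_sub_le x h
    · rw [norm_sub_rev]
      simpa [tsub_eq_zero_of_le h] using hU.norm_sub_le x h
  exact this.comp continuous_real_toNNReal

theorem intervalIntegrable_orbit (x : E) (a b : ℝ) :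
    IntervalIntegrable (fun s : ℝ => U s.toNNReal x) volume a b :=
  (hU.continuous_orbit x).intervalIntegrable _ _

theorem infGenerator_apply {f g : E} (h : (f, g) ∈ infGenerator U) (s : ℝ≥0) :
    (U s f, U s g) ∈ infGenerator U := by
  have := ((U s).continuous.tendsto g).comp h
  refine this.congr fun r => ?_
  simp only [Function.comp_apply, map_smul, map_sub]
  rw [hU.comm r s]

theorem hasDerivWithinAt_orbit {f g : E} (h : (f, g) ∈ infGenerator U) {s : ℝ} (hs : 0 ≤ s) :
    HasDerivWithinAt (fun s : ℝ => U s.toNNReal f) (U s.toNNReal g) (Ioi s) s := by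
  rw [hasDerivWithinAt_iff_tendsto_slope' (by simp)]
  have h1 := (hU.infGenerator_apply h s.toNNReal : Tendsto _ _ _).comp
    tendsto_toNNReal_nhdsGT_zero
  have h2 : Tendsto (fun t : ℝ => t - s) (𝓝[>] s) (𝓝[>] 0) := by
    refine tendsto_nhdsWithin_iff.2 ⟨?_, ?_⟩
    · have : Continuous fun t : ℝ => t - s := by fun_prop
      simpa using (this.tendsto s).mono_left nhdsWithin_le_nhds
    · filter_upwards [self_mem_nhdsWithin] with t ht
      exact sub_pos.2 (mem_Ioi.1 ht)
  refine (h1.comp h2).congr' ?_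
  filter_upwards [self_mem_nhdsWithin] with t ht
  have ht' : 0 ≤ t - s := (sub_pos.2 (mem_Ioi.1 ht)).le
  simp only [Function.comp_apply, slope, vsub_eq_sub]
  rw [← hU.add, ← Real.toNNReal_add ht' hs, sub_add_cancel, Real.coe_toNNReal _ ht']

variable [CompleteSpace E]

/-- Integrating the right derivative of the orbit gives one direction; the derivative of the
integral at `0` gives the other. The integral form is a condition preserved by limits, unlike the
difference quotients. -/
theorem mem_infGenerator_iff {f g : E} :
    (f, g) ∈ infGenerator U ↔
      ∀ t : ℝ, 0 ≤ t → U t.toNNReal f - f = ∫ s in (0 : ℝ)..t, U s.toNNReal g := by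
  constructor
  · intro h t ht
    rw [intervalIntegral.integral_eq_sub_of_hasDeriv_right_of_le ht
      (hU.continuous_orbit f).continuousOn
      (fun s hs => hU.hasDerivWithinAt_orbit h hs.1.le) (hU.intervalIntegrable_orbit g _ _)]
    simp [hU.zero]
  · intro h
    have h1 : HasDerivWithinAt (fun t => ∫ s in (0 : ℝ)..t, U s.toNNReal g) g (Ioi 0) 0 := by
      have := (intervalIntegral.integral_hasDerivAt_right (hU.intervalIntegrable_orbit g 0 0)
        ((hU.continuous_orbit g).stronglyMeasurableAtFilter _ _)
        (hU.continuous_orbit g).continuousAt).hasDerivWithinAt (s := Ioi 0)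
      simpa [hU.zero] using this
    rw [hasDerivWithinAt_iff_tendsto_slope' (by simp)] at h1
    refine (h1.comp tendsto_coe_nhdsGT_zero).congr fun t => ?_
    simp [slope, ← h t t.2]

theorem isClosed_infGenerator : IsClosed (infGenerator U) := by
  have : infGenerator U = ⋂ (t : ℝ) (_ : 0 ≤ t),
      {p : E × E | U t.toNNReal p.1 - p.1 = ∫ s in (0 : ℝ)..t, U s.toNNReal p.2} := by
    ext ⟨f, g⟩
    simp [hU.mem_infGenerator_iff]
  rw [this]
  refine isClosed_iInter fun t => isClosed_iInter fun ht => isClosed_eq (by fun_prop) ?_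
  have : LipschitzWith t.toNNReal fun g => ∫ s in (0 : ℝ)..t, U s.toNNReal g := by
    refine LipschitzWith.of_dist_le_mul fun x y => ?_
    rw [dist_eq_norm, dist_eq_norm, ← intervalIntegral.integral_sub
      (hU.intervalIntegrable_orbit _ _ _) (hU.intervalIntegrable_orbit _ _ _)]
    have := intervalIntegral.norm_integral_le_of_norm_le_const (a := (0 : ℝ)) (b := t)
      (f := fun s : ℝ => U s.toNNReal x - U s.toNNReal y) (C := ‖x - y‖)
      (fun s _ => by rw [← map_sub]; exact hU.norm_le _ _)
    rw [Real.coe_toNNReal _ ht]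
    rw [sub_zero, abs_of_nonneg ht] at this
    linarith
  exact this.continuous.comp continuous_snd

/-- In the integral criterion both sides are differences of integrals of one orbit: `∫_h^{t+h} -
∫_0^t` against `∫_t^{t+h} - ∫_0^h`. They agree because each pairing completes to `∫_0^{t+h}`. -/
theorem integral_orbit_mem_infGenerator (f : E) {t : ℝ} (ht : 0 ≤ t) :
    (∫ s in (0 : ℝ)..t, U s.toNNReal f, U t.toNNReal f - f) ∈ infGenerator U := by
  rw [hU.mem_infGenerator_iff]
  intro h hh
  have key : ∀ a : ℝ, 0 ≤ a → ∀ b : ℝ, 0 ≤ b →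
      U a.toNNReal (∫ s in (0 : ℝ)..b, U s.toNNReal f) = ∫ s in a..(a + b), U s.toNNReal f := by
    intro a ha b hb
    rw [← ContinuousLinearMap.intervalIntegral_comp_comm _ (hU.intervalIntegrable_orbit f _ _)]
    have := intervalIntegral.integral_comp_add_left (a := (0 : ℝ)) (b := b)
      (fun s : ℝ => U s.toNNReal f) a
    rw [add_zero] at this
    rw [← this]
    refine intervalIntegral.integral_congr fun s hs => ?_
    rw [uIcc_of_le hb] at hs
    rw [Real.toNNReal_add ha hs.1, hU.add]
  have h2 : ∫ s in (0 : ℝ)..h, U s.toNNReal (U t.toNNReal f) = ∫ s in t..(t + h), U s.toNNReal f := by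
    rw [← key t ht h hh, ← ContinuousLinearMap.intervalIntegral_comp_comm _
      (hU.intervalIntegrable_orbit f _ _)]
    simp_rw [hU.comm t.toNNReal]
  simp only [map_sub]
  rw [intervalIntegral.integral_sub (hU.intervalIntegrable_orbit _ _ _)
    (hU.intervalIntegrable_orbit _ _ _), h2, key h hh t ht]
  have e1 := intervalIntegral.integral_add_adjacent_intervals (hU.intervalIntegrable_orbit f 0 t)
    (hU.intervalIntegrable_orbit f t (t + h))
  have e2 := intervalIntegral.integral_add_adjacent_intervals (hU.intervalIntegrable_orbit f 0 h)
    (hU.intervalIntegrable_orbit f h (h + t))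
  rw [add_comm h t] at e2 ⊢
  rw [sub_eq_sub_iff_add_eq_add, add_comm (∫ s in h..(t + h), U s.toNNReal f), e2,
      add_comm (∫ s in t..(t + h), U s.toNNReal f), e1]

/-- The averages `t⁻¹ ∫_0^t U_s f ds` lie in the domain and tend to `f`. -/
theorem dense_domain_infGenerator : Dense {f | ∃ g, (f, g) ∈ infGenerator U} := by
  intro f
  have h1 : HasDerivWithinAt (fun t => ∫ s in (0 : ℝ)..t, U s.toNNReal f) f (Ioi 0) 0 := by
    have := (intervalIntegral.integral_hasDerivAt_right (hU.intervalIntegrable_orbit f 0 0)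
      ((hU.continuous_orbit f).stronglyMeasurableAtFilter _ _)
      (hU.continuous_orbit f).continuousAt).hasDerivWithinAt (s := Ioi 0)
    simpa [hU.zero] using this
  rw [hasDerivWithinAt_iff_tendsto_slope' (by simp)] at h1
  refine mem_closure_of_tendsto h1 ?_
  filter_upwards [self_mem_nhdsWithin] with t ht
  refine ⟨(t - 0)⁻¹ • (U t.toNNReal f - f), ?_⟩
  have := infGenerator_smul (t - 0)⁻¹ (hU.integral_orbit_mem_infGenerator f (le_of_lt ht))
  simpa [slope] using this

-- Dissipativity: `f - h⁻¹ (U_h f - f) = (1 + h⁻¹) f - h⁻¹ U_h f` has norm at least `‖f‖` by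
-- contractivity; then `h ↓ 0`.
omit [CompleteSpace E] in
theorem norm_le_norm_sub {f g : E} (h : (f, g) ∈ infGenerator U) : ‖f‖ ≤ ‖f - g‖ := by
  have h1 : Tendsto (fun h : ℝ≥0 => ‖f - (h : ℝ)⁻¹ • (U h f - f)‖) (𝓝[>] 0) (𝓝 ‖f - g‖) :=
    (Tendsto.const_sub f h).norm
  refine ge_of_tendsto h1 ?_
  filter_upwards [self_mem_nhdsWithin] with r hr
  have hr' : (0 : ℝ) < (r : ℝ)⁻¹ := inv_pos.2 (NNReal.coe_pos.2 hr)
  have e : f - (r : ℝ)⁻¹ • (U r f - f) = (1 + (r : ℝ)⁻¹) • f - (r : ℝ)⁻¹ • U r f := by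
    rw [add_smul, one_smul, smul_sub]; abel
  rw [e]
  have h2 := norm_sub_norm_le ((1 + (r : ℝ)⁻¹) • f) ((r : ℝ)⁻¹ • U r f)
  rw [norm_smul, norm_smul, Real.norm_of_nonneg hr'.le,
    Real.norm_of_nonneg (by positivity)] at h2
  have h3 := mul_le_mul_of_nonneg_left (hU.norm_le r f) hr'.le
  linarith

-- Invariance gives `d/dt φ (U_t f) = φ (L U_t f) = φ (U_t f)`, so `e^{-t} φ (U_t f)` is constant.
-- It is also at most `e^{-t} ‖φ‖ ‖f‖`, which tends to `0`. Right derivatives are enough for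
-- constancy.
omit [CompleteSpace E] in
theorem eq_zero_of_dual_eq {D : Submodule ℝ E} (hinv : ∀ s : ℝ≥0, 0 < s → ∀ f ∈ D, U s f ∈ D)
    (hdom : ∀ f ∈ D, ∃ g, (f, g) ∈ infGenerator U) {φ : E →L[ℝ] ℝ}
    (hφ : ∀ f ∈ D, ∀ g, (f, g) ∈ infGenerator U → φ g = φ f) : ∀ f ∈ D, φ f = 0 := by
  intro f hf
  obtain ⟨g, hg⟩ := hdom f hf
  have hconst : ∀ t : ℝ, 0 ≤ t → Real.exp (-t) * φ (U t.toNNReal f) = φ f := by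
    intro t ht
    have := constant_of_has_deriv_right_zero
      (f := fun t : ℝ => Real.exp (-t) * φ (U t.toNNReal f)) (a := 0) (b := t) ?_ ?_ t
      ⟨ht, le_rfl⟩
    · simpa [hU.zero] using this
    · have := φ.continuous.comp (hU.continuous_orbit f)
      exact ((Real.continuous_exp.comp continuous_neg).mul this).continuousOn
    · intro s hs
      have hmem : U s.toNNReal f ∈ D := by
        rcases eq_or_lt_of_le hs.1 with h0 | h0
        · rw [← h0, Real.toNNReal_zero, hU.zero]; exact hf
        · exact hinv _ (Real.toNNReal_pos.2 h0) f hf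
      have h1 := (φ.hasFDerivAt.comp_hasDerivWithinAt s (hU.hasDerivWithinAt_orbit hg hs.1))
      have h2 : HasDerivWithinAt (fun s : ℝ => Real.exp (-s)) (-Real.exp (-s)) (Ioi s) s := by
        simpa using ((hasDerivAt_neg s).exp).hasDerivWithinAt
      have h3 := h2.mul h1
      rw [hφ _ hmem _ (hU.infGenerator_apply hg _)] at h3
      have e : -Real.exp (-s) * (⇑φ ∘ fun s : ℝ => U s.toNNReal f) s +
          Real.exp (-s) * φ (U s.toNNReal f) = 0 := by
        simp
      rw [e] at h3
      exact hasDerivWithinAt_Ioi_iff_Ici.1 h3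
  have hlim : Tendsto (fun t : ℝ => Real.exp (-t) * (‖φ‖ * ‖f‖)) atTop (𝓝 0) := by
    simpa using (Real.tendsto_exp_neg_atTop_nhds_zero).mul_const (‖φ‖ * ‖f‖)
  have : ‖φ f‖ ≤ 0 := by
    refine ge_of_tendsto hlim ?_
    filter_upwards [eventually_ge_atTop 0] with t ht
    rw [← hconst t ht, norm_mul, Real.norm_of_nonneg (Real.exp_pos _).le]
    refine mul_le_mul_of_nonneg_left ?_ (Real.exp_pos _).le
    exact (φ.le_opNorm _).trans (mul_le_mul_of_nonneg_left (hU.norm_le _ _) (norm_nonneg _))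
  exact norm_le_zero_iff.1 this

/-- A dense subspace of the domain that is invariant under the semigroup is a core. -/
theorem closure_infGenerator_of_invariant {D : Submodule ℝ E} (hD : Dense (D : Set E))
    (hinv : ∀ s : ℝ≥0, 0 < s → ∀ f ∈ D, U s f ∈ D)
    (hdom : ∀ f ∈ D, ∃ g, (f, g) ∈ infGenerator U) :
    closure {p | p ∈ infGenerator U ∧ p.1 ∈ D} = infGenerator U := by
  refine Subset.antisymm (closure_minimal (fun p hp => hp.1) hU.isClosed_infGenerator) ?_
  -- The range of `1 - L` restricted to `D`. Once it is dense, dissipativity gives the graph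
  -- approximation.
  let R : Submodule ℝ E :=
    { carrier := {v | ∃ p ∈ infGenerator U, p.1 ∈ D ∧ v = p.1 - p.2}
      add_mem' := by
        rintro _ _ ⟨p, hp, hp1, rfl⟩ ⟨q, hq, hq1, rfl⟩
        exact ⟨p + q, infGenerator_add hp hq, D.add_mem hp1 hq1, by simp; abel⟩
      zero_mem' := ⟨0, by simp [infGenerator], D.zero_mem, by simp⟩
      smul_mem' := by
        rintro c _ ⟨p, hp, hp1, rfl⟩
        exact ⟨c • p, infGenerator_smul c hp, D.smul_mem c hp1, by simp [smul_sub]⟩ }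
  have hR : Dense (R : Set E) := by
    intro v
    by_contra hv
    obtain ⟨φ, u, hφ1, hφ2⟩ := geometric_hahn_banach_point_closed
      R.topologicalClosure.convex
      R.isClosed_topologicalClosure (x := v) hv
    have hφR : ∀ w ∈ R, φ w = 0 := by
      intro w hw
      by_contra hne
      -- A functional bounded below by `u` on a subspace vanishes there: this multiple of `w` would
      -- take the value `u - 1`.
      have := hφ2 (((u - 1) / φ w) • w) (R.le_topologicalClosure (R.smul_mem _ hw))
      rw [map_smul, smul_eq_mul, div_mul_cancel₀ _ hne] at this
      linarith
    have hφD := hU.eq_zero_of_dual_eq hinv hdom (φ := φ) (fun f hf g hg => by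
      have := hφR (f - g) ⟨(f, g), hg, hf, rfl⟩
      rw [map_sub] at this
      linarith)
    have hφ0 : ∀ w, φ w = 0 := by
      intro w
      have hcl : IsClosed {w | φ w = 0} := isClosed_eq φ.continuous continuous_const
      exact closure_minimal (fun f hf => hφD f hf) hcl (hD w)
    have h0 := hφ2 0 (R.topologicalClosure.zero_mem)
    rw [hφ0] at hφ1 h0
    linarith
  rintro ⟨f, g⟩ hfg
  rw [Metric.mem_closure_iff]
  intro ε hε
  obtain ⟨w, ⟨p, hp, hpD, rfl⟩, hw⟩ := Metric.mem_closure_iff.1 (hR (f - g)) (ε / 2) (half_pos hε)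
  refine ⟨p, ⟨hp, hpD⟩, ?_⟩
  -- Dissipativity of the difference bounds `‖f - p.1‖` by the distance of `f - g` to the range; the
  -- error in `g` is the sum of these two errors, each below `ε / 2`.
  have h1 : (f - p.1, g - p.2) ∈ infGenerator U := by
    have := infGenerator_add hfg (infGenerator_smul (-1) hp)
    convert! this using 1
    ext <;> simp [sub_eq_add_neg]
  have h2 := hU.norm_le_norm_sub h1
  have h3 : f - p.1 - (g - p.2) = f - g - (p.1 - p.2) := by abel
  rw [dist_eq_norm] at hw
  rw [h3] at h2
  rw [Prod.dist_eq, dist_eq_norm, dist_eq_norm, max_lt_iff]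
  simp only
  refine ⟨by linarith, ?_⟩
  have h4 : g - p.2 = (f - p.1) - (f - g - (p.1 - p.2)) := by abel
  rw [h4]
  have := _root_.norm_sub_le (f - p.1) (f - g - (p.1 - p.2))
  linarith

end IsContractionSemigroup

end ContractionSemigroup

/-! ### Semigroups determined on a set with dense span. -/

section ContractionSemigroup

variable {E : Type*} [NormedAddCommGroup E] [NormedSpace ℝ E]

theorem eqOn_of_dense_span {U V : E →L[ℝ] E} {G : Set E}
    (hG : ∀ x, x ∈ closure (Submodule.span ℝ G : Set E)) (h : ∀ x ∈ G, U x = V x) (x : E) :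
    U x = V x := by
  have := ContinuousLinearMap.ext_on (f := U) (g := V) (s := G) (fun x => hG x) h
  rw [this]

theorem tendsto_of_dense_span {U : ℝ≥0 → E →L[ℝ] E} (hn : ∀ s x, ‖U s x‖ ≤ ‖x‖) {G : Set E}
    (hG : ∀ x, x ∈ closure (Submodule.span ℝ G : Set E)) {l : Filter ℝ≥0}
    (h : ∀ x ∈ G, Tendsto (fun s => U s x) l (𝓝 x)) (x : E) :
    Tendsto (fun s => U s x) l (𝓝 x) := by
  have hspan : ∀ x ∈ Submodule.span ℝ G, Tendsto (fun s => U s x) l (𝓝 x) := by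
    intro x hx
    induction hx using Submodule.span_induction with
    | mem x hx => exact h x hx
    | zero => simpa using tendsto_const_nhds
    | add x y _ _ hx hy => simpa using hx.add hy
    | smul a x _ hx => simpa using hx.const_smul a
  rw [Metric.tendsto_nhds]
  intro ε hε
  obtain ⟨y, hy, hxy⟩ := Metric.mem_closure_iff.1 (hG x) (ε / 3) (by positivity)
  filter_upwards [Metric.tendsto_nhds.1 (hspan y hy) (ε / 3) (by positivity)] with s hs
  have h1 : dist (U s x) (U s y) ≤ dist x y := by
    rw [dist_eq_norm, dist_eq_norm, ← map_sub]
    exact hn _ _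
  have h2 := dist_triangle4 (U s x) (U s y) y x
  rw [dist_comm y x] at h2
  linarith

/-- Uniform contractivity carries the semigroup laws and strong continuity from `G` to its closed
span. On the tensor product, only the elements `p ⊗ q` have an explicit image. -/
theorem IsContractionSemigroup.of_dense_span {U : ℝ≥0 → E →L[ℝ] E}
    (hn : ∀ s x, ‖U s x‖ ≤ ‖x‖) {G : Set E}
    (hG : ∀ x, x ∈ closure (Submodule.span ℝ G : Set E)) (h0 : ∀ x ∈ G, U 0 x = x)
    (ha : ∀ s r, ∀ x ∈ G, U (s + r) x = U s (U r x))
    (hc : ∀ x ∈ G, Tendsto (fun s => U s x) (𝓝[>] 0) (𝓝 x)) : IsContractionSemigroup U where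
  zero x := eqOn_of_dense_span (V := ContinuousLinearMap.id ℝ E) hG h0 x
  add s r x := eqOn_of_dense_span (V := (U s).comp (U r)) hG (ha s r) x
  norm_le := hn
  strongCont := tendsto_of_dense_span hn hG hc

theorem IsContractionSemigroup.comp {U V : ℝ≥0 → E →L[ℝ] E} (hU : IsContractionSemigroup U)
    (hV : IsContractionSemigroup V) (hUV : ∀ s r x, U s (V r x) = V r (U s x)) :
    IsContractionSemigroup fun s => (U s).comp (V s) where
  zero x := by simp [hU.zero, hV.zero]
  add s r x := by simp [hU.add, hV.add, hUV r s]
  norm_le s x := (hU.norm_le _ _).trans (hV.norm_le _ _)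
  strongCont x := by
    rw [tendsto_iff_norm_sub_tendsto_zero]
    have h1 := tendsto_iff_norm_sub_tendsto_zero.1 (hU.strongCont x)
    have h2 := tendsto_iff_norm_sub_tendsto_zero.1 (hV.strongCont x)
    have h3 := h2.add h1
    rw [add_zero] at h3
    refine squeeze_zero (fun _ => norm_nonneg _) (fun s => ?_) h3
    have e : (U s).comp (V s) x - x = U s (V s x - x) + (U s x - x) := by simp
    rw [e]
    exact (norm_add_le _ _).trans (add_le_add_left (hU.norm_le _ _) _)

end ContractionSemigroup

/-! ### From actions on functions to operators on a closed subspace. -/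

/-- The continuous linear operators on a normed space. -/
abbrev EndCLM (E : Type*) [NormedAddCommGroup E] [NormedSpace ℝ E] := E →L[ℝ] E

section SubFeller

variable {X : Type*} [TopologicalSpace X] {S : Submodule ℝ (X →ᵇ ℝ)}
  {P : ℝ≥0 → (X → ℝ) → X → ℝ}

theorem exists_clm_of_norm_le {E : Type*} [NormedAddCommGroup E] [NormedSpace ℝ E] {b : E → E}
    (hadd : ∀ x y, b (x + y) = b x + b y) (hsmul : ∀ (c : ℝ) x, b (c • x) = c • b x)
    (hb : ∀ x, ‖b x‖ ≤ ‖x‖) : ∃ B : EndCLM E, ∀ x, B x = b x :=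
  ⟨LinearMap.mkContinuous ⟨⟨b, hadd⟩, hsmul⟩ 1 fun x => by rw [one_mul]; exact hb x, fun _ => rfl⟩

theorem exists_clm_of_bound {Φ : S → X → ℝ} (hmaps : ∀ f, ∃ g ∈ S, ⇑g = Φ f)
    (hadd : ∀ f g, Φ (f + g) = Φ f + Φ g) (hsmul : ∀ (c : ℝ) f, Φ (c • f) = c • Φ f)
    (hbound : ∀ f x, |Φ f x| ≤ ‖f‖) :
    ∃ B : EndCLM S, (∀ f, ⇑(B f : X →ᵇ ℝ) = Φ f) ∧ ∀ f, ‖B f‖ ≤ ‖f‖ := by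
  choose g hg hgΦ using hmaps
  have hb : ∀ f, ‖(⟨g f, hg f⟩ : S)‖ ≤ ‖f‖ := fun f => by
    have h : ∀ x, ‖(g f) x‖ ≤ ‖f‖ := fun x => by
      rw [hgΦ, Real.norm_eq_abs]
      exact hbound f x
    exact (BoundedContinuousFunction.norm_le (norm_nonneg f)).2 h
  have h1 : ∀ f f' : S, (⟨g (f + f'), hg (f + f')⟩ : S) = ⟨g f, hg f⟩ + ⟨g f', hg f'⟩ :=
    fun f f' => Subtype.ext (DFunLike.coe_injective (by
      rw [hgΦ, hadd, ← hgΦ, ← hgΦ]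
      rfl))
  have h2 : ∀ (c : ℝ) (f : S), (⟨g (c • f), hg (c • f)⟩ : S) = c • ⟨g f, hg f⟩ :=
    fun c f => Subtype.ext (DFunLike.coe_injective (by
      rw [hgΦ, hsmul, ← hgΦ]
      rfl))
  obtain ⟨B, hB⟩ := exists_clm_of_norm_le (E := S) h1 h2 hb
  refine ⟨B, fun f => ?_, fun f => ?_⟩
  · rw [hB]
    exact hgΦ f
  · rw [hB]
    exact hb f

namespace IsSubFeller

theorem exists_clm (hP : IsSubFeller S P) (s : ℝ≥0) :
    ∃ B : EndCLM S, (∀ f : S, ⇑(B f : X →ᵇ ℝ) = P s f) ∧ ∀ f, ‖B f‖ ≤ ‖f‖ :=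
  exists_clm_of_bound (Φ := fun f => P s f) (fun f => hP.mapsTo s f f.2)
    (fun f g => hP.map_add s f f.2 g g.2) (fun c f => hP.map_smul s c f f.2)
    (fun f x => hP.contraction s f f.2 x)

/-- The operators of a sub-Feller semigroup as continuous linear operators. -/
noncomputable def op (hP : IsSubFeller S P) (s : ℝ≥0) : EndCLM S :=
  (hP.exists_clm s).choose

theorem coe_op (hP : IsSubFeller S P) (s : ℝ≥0) (f : S) : ⇑(hP.op s f : X →ᵇ ℝ) = P s f :=
  (hP.exists_clm s).choose_spec.1 f

theorem tendsto_iff {F : ℝ≥0 → S} {f : S} {l : Filter ℝ≥0} :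
    Tendsto F l (𝓝 f) ↔ TendstoUniformly (fun s => ⇑(F s : X →ᵇ ℝ)) (f : X →ᵇ ℝ) l := by
  rw [tendsto_subtype_rng, BoundedContinuousFunction.tendsto_iff_tendstoUniformly]

theorem isContractionSemigroup (hP : IsSubFeller S P) : IsContractionSemigroup hP.op where
  zero f := by
    ext x
    rw [hP.coe_op, hP.zero f f.2]
  add s r f := by
    ext x
    rw [hP.coe_op, hP.coe_op, hP.add s r f f.2, hP.coe_op]
  norm_le s f := (hP.exists_clm s).choose_spec.2 f
  strongCont f := by
    rw [tendsto_iff]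
    simp_rw [hP.coe_op]
    exact hP.strongCont f f.2

theorem of_isContractionSemigroup {U : ℝ≥0 → EndCLM S} (hU : IsContractionSemigroup U)
    (hUP : ∀ s, ∀ f : S, ⇑(U s f : X →ᵇ ℝ) = P s f)
    (hpos : ∀ s, ∀ f ∈ S, (∀ x, 0 ≤ f x) → ∀ x, 0 ≤ P s f x) : IsSubFeller S P where
  mapsTo s f hf := ⟨U s ⟨f, hf⟩, (U s ⟨f, hf⟩).2, hUP s ⟨f, hf⟩⟩
  map_add s f hf g hg := by
    have h1 := hUP s (⟨f, hf⟩ + ⟨g, hg⟩ : S)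
    have h2 := _root_.map_add (U s) ⟨f, hf⟩ ⟨g, hg⟩
    rw [h2] at h1
    have h3 := hUP s ⟨f, hf⟩
    have h4 := hUP s ⟨g, hg⟩
    rw [← h3, ← h4]
    exact h1.symm
  map_smul s c f hf := by
    have h1 := hUP s (c • ⟨f, hf⟩ : S)
    have h2 := _root_.map_smul (U s) c ⟨f, hf⟩
    rw [h2] at h1
    have h3 := hUP s ⟨f, hf⟩
    rw [← h3]
    exact h1.symm
  zero f hf := by rw [← hUP 0 ⟨f, hf⟩, hU.zero]
  add s r f hf := by
    have h1 := hUP (s + r) ⟨f, hf⟩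
    rw [hU.add, hUP, hUP r] at h1
    exact h1.symm
  contraction s f hf x := by
    have h1 := (U s ⟨f, hf⟩ : X →ᵇ ℝ).norm_coe_le_norm x
    rw [hUP s ⟨f, hf⟩] at h1
    exact h1.trans (hU.norm_le s ⟨f, hf⟩)
  nonneg := hpos
  strongCont f hf := by
    have := tendsto_iff.1 (hU.strongCont ⟨f, hf⟩)
    simp_rw [hUP] at this
    exact this

theorem mem_generator_iff (hP : IsSubFeller S P) {f g : S} :
    ((f : X →ᵇ ℝ), (g : X →ᵇ ℝ)) ∈ generator S P ↔ (f, g) ∈ infGenerator hP.op := by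
  simp only [generator, infGenerator, mem_ofPred_eq, SetLike.coe_mem, true_and]
  rw [tendsto_iff]
  have : ∀ h : ℝ≥0, ⇑(((h : ℝ)⁻¹ • (hP.op h f - f) : S) : X →ᵇ ℝ) =
      fun x => (h : ℝ)⁻¹ * (P h f x - (f : X →ᵇ ℝ) x) := by
    intro h
    ext x
    simp [← hP.coe_op]
  simp_rw [this]

theorem mem_generator_iff' (hP : IsSubFeller S P) {p : (X →ᵇ ℝ) × (X →ᵇ ℝ)} :
    p ∈ generator S P ↔ ∃ (hf : p.1 ∈ S) (hg : p.2 ∈ S),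
      ((⟨p.1, hf⟩, ⟨p.2, hg⟩) : S × S) ∈ infGenerator hP.op := by
  constructor
  · rintro h
    exact ⟨h.1, h.2.1, hP.mem_generator_iff.1 h⟩
  · rintro ⟨hf, hg, h⟩
    exact hP.mem_generator_iff.2 h

theorem generator_eq_image (hP : IsSubFeller S P) :
    generator S P = (fun p : S × S => ((p.1 : X →ᵇ ℝ), (p.2 : X →ᵇ ℝ))) '' infGenerator hP.op := by
  ext p
  rw [hP.mem_generator_iff']
  constructor
  · rintro ⟨hf, hg, h⟩
    exact ⟨_, h, rfl⟩
  · rintro ⟨⟨f, g⟩, h, rfl⟩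
    exact ⟨f.2, g.2, h⟩

theorem generator_add (hP : IsSubFeller S P) {p q : (X →ᵇ ℝ) × (X →ᵇ ℝ)}
    (hp : p ∈ generator S P) (hq : q ∈ generator S P) : p + q ∈ generator S P := by
  obtain ⟨h1, h2, h3⟩ := hP.mem_generator_iff'.1 hp
  obtain ⟨k1, k2, k3⟩ := hP.mem_generator_iff'.1 hq
  have := infGenerator_add h3 k3
  exact hP.mem_generator_iff.2 this

theorem generator_smul (hP : IsSubFeller S P) (c : ℝ) {p : (X →ᵇ ℝ) × (X →ᵇ ℝ)}
    (hp : p ∈ generator S P) : c • p ∈ generator S P := by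
  obtain ⟨h1, h2, h3⟩ := hP.mem_generator_iff'.1 hp
  have := infGenerator_smul c h3
  exact hP.mem_generator_iff.2 this

theorem generator_zero (hP : IsSubFeller S P) : (0 : (X →ᵇ ℝ) × (X →ᵇ ℝ)) ∈ generator S P := by
  rw [hP.mem_generator_iff']
  refine ⟨S.zero_mem, S.zero_mem, ?_⟩
  have : ((⟨(0 : (X →ᵇ ℝ) × (X →ᵇ ℝ)).1, S.zero_mem⟩,
    ⟨(0 : (X →ᵇ ℝ) × (X →ᵇ ℝ)).2, S.zero_mem⟩) : S × S) = (0, 0) := rfl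
  rw [this]
  simp [infGenerator]

theorem generator_unique {f g g' : X →ᵇ ℝ} (h : (f, g) ∈ generator S P)
    (h' : (f, g') ∈ generator S P) : g = g' := by
  ext x
  exact tendsto_nhds_unique (h.2.2.tendsto_at x) (h'.2.2.tendsto_at x)

theorem isClosedEmbedding_coe_prod (hS : IsClosed (S : Set (X →ᵇ ℝ))) :
    IsClosedEmbedding fun p : S × S => ((p.1 : X →ᵇ ℝ), (p.2 : X →ᵇ ℝ)) := by
  have : IsClosedEmbedding ((↑) : S → X →ᵇ ℝ) := hS.isClosedEmbedding_subtypeVal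
  exact this.prodMap this

theorem closure_generator_of_invariant (hP : IsSubFeller S P) (hS : IsClosed (S : Set (X →ᵇ ℝ)))
    {D : Submodule ℝ (X →ᵇ ℝ)} (hdom : ∀ f ∈ D, f ∈ domain (generator S P))
    (hinv : ∀ s : ℝ≥0, 0 < s → ∀ f ∈ D, ∃ g ∈ D, ⇑g = P s f)
    (hD : (S : Set (X →ᵇ ℝ)) ⊆ closure D) :
    closure {p | p ∈ generator S P ∧ p.1 ∈ D} = generator S P := by
  have : CompleteSpace S := hS.completeSpace_coe
  have hDS : D ≤ S := fun f hf => (hdom f hf).choose_spec.1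
  have h := hP.isContractionSemigroup.closure_infGenerator_of_invariant
    (D := D.comap S.subtype) ?_ ?_ ?_
  · rw [hP.generator_eq_image]
    nth_rewrite 2 [← h]
    rw [← (isClosedEmbedding_coe_prod hS).closure_image_eq]
    congr 1
    ext p
    constructor
    · rintro ⟨⟨q, hq, rfl⟩, h2⟩
      exact ⟨q, ⟨hq, h2⟩, rfl⟩
    · rintro ⟨q, ⟨hq, h2⟩, rfl⟩
      exact ⟨⟨q, hq, rfl⟩, h2⟩
  · intro f
    rw [Metric.mem_closure_iff]
    intro ε hε
    obtain ⟨g, hg, hfg⟩ := Metric.mem_closure_iff.1 (hD f.2) ε hε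
    exact ⟨⟨g, hDS hg⟩, hg, hfg⟩
  · intro s hs f hf
    obtain ⟨g, hg, hgP⟩ := hinv s hs f hf
    have : (hP.op s f : X →ᵇ ℝ) = g := by
      apply DFunLike.coe_injective
      rw [hP.coe_op, hgP]
    rw [Submodule.mem_comap, Submodule.subtype_apply, this]
    exact hg
  · intro f hf
    obtain ⟨g, hg⟩ := hdom f hf
    obtain ⟨h1, h2, h3⟩ := hP.mem_generator_iff'.1 hg
    exact ⟨_, h3⟩

theorem subset_closure_domain (hP : IsSubFeller S P) (hS : IsClosed (S : Set (X →ᵇ ℝ))) :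
    (S : Set (X →ᵇ ℝ)) ⊆ closure (domain (generator S P)) := by
  have : CompleteSpace S := hS.completeSpace_coe
  intro f hf
  rw [Metric.mem_closure_iff]
  intro ε hε
  obtain ⟨g, ⟨k, hg⟩, hfg⟩ := Metric.mem_closure_iff.1
    (hP.isContractionSemigroup.dense_domain_infGenerator ⟨f, hf⟩) ε hε
  exact ⟨g, ⟨k, hP.mem_generator_iff.2 hg⟩, hfg⟩

/-- The domain is dense, and projecting the closure of the restricted graph to its first coordinate
lands in the closure of `C`. -/
theorem subset_closure_core (hP : IsSubFeller S P) (hS : IsClosed (S : Set (X →ᵇ ℝ)))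
    {C : Set (X →ᵇ ℝ)} (hC : IsInvariantCore S P C) : (S : Set (X →ᵇ ℝ)) ⊆ closure C := by
  refine (hP.subset_closure_domain hS).trans (closure_minimal ?_ isClosed_closure)
  rintro f ⟨g, hg⟩
  rw [← hC.closure_eq] at hg
  have := map_mem_closure continuous_fst hg (t := C) (fun p hp => hp.2)
  exact this

end IsSubFeller

/-- `k` is not assumed continuous: it is a uniform limit of elements of `S`, which makes it
continuous, bounded and, `S` being closed, an element of `S`. -/
theorem exists_mem_of_forall_approx (hS : IsClosed (S : Set (X →ᵇ ℝ))) {k : X → ℝ}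
    (h : ∀ ε > 0, ∃ g ∈ S, ∀ x, |k x - g x| ≤ ε) : ∃ g ∈ S, ⇑g = k := by
  choose! g hg hk using h
  let F : ℕ → X →ᵇ ℝ := fun n => g (1 / ((n : ℝ) + 1))
  have hF : TendstoUniformly (fun n => ⇑(F n)) k atTop := by
    rw [Metric.tendstoUniformly_iff]
    intro ε hε
    filter_upwards [(tendsto_one_div_add_atTop_nhds_zero_nat (𝕜 := ℝ)).eventually_lt_const hε]
      with n hn x
    exact (hk _ (by positivity) x).trans_lt hn
  have hkc : Continuous k := hF.continuous (Frequently.of_forall fun n => (F n).continuous)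
  have hkb : ∀ x, ‖k x‖ ≤ ‖F 0‖ + 1 := by
    intro x
    have h1 := hk (1 / (((0 : ℕ) : ℝ) + 1)) (by positivity) x
    have h2 := (F 0).norm_coe_le_norm x
    rw [Real.norm_eq_abs] at *
    have h3 := abs_sub_abs_le_abs_sub (k x) (F 0 x)
    norm_num at h1
    simp only [F] at *
    norm_num at *
    linarith
  let K : X →ᵇ ℝ := BoundedContinuousFunction.ofNormedAddCommGroup k hkc _ hkb
  refine ⟨K, ?_, rfl⟩
  have : Tendsto F atTop (𝓝 K) :=
    BoundedContinuousFunction.tendsto_iff_tendstoUniformly.2 hF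
  exact hS.mem_of_tendsto this (Eventually.of_forall fun n => hg _ (by positivity))

/-- The image of a general `f` is only a pointwise formula whose continuity is unclear. The bound by
`‖f‖` makes it a uniform limit of the formula on the span of `G`, where membership in `S` is known.
-/
theorem exists_clm_of_dense (hS : IsClosed (S : Set (X →ᵇ ℝ))) {Φ : S → X → ℝ} {G : Set S}
    (hG : ∀ x, x ∈ closure (Submodule.span ℝ G : Set S)) (hmaps : ∀ f ∈ G, ∃ g ∈ S, ⇑g = Φ f)
    (hadd : ∀ f g, Φ (f + g) = Φ f + Φ g) (hsmul : ∀ (c : ℝ) f, Φ (c • f) = c • Φ f)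
    (hbound : ∀ f x, |Φ f x| ≤ ‖f‖) :
    ∃ B : EndCLM S, (∀ f, ⇑(B f : X →ᵇ ℝ) = Φ f) ∧ ∀ f, ‖B f‖ ≤ ‖f‖ := by
  refine exists_clm_of_bound (fun f => ?_) hadd hsmul hbound
  have hspan : ∀ f ∈ Submodule.span ℝ G, ∃ g ∈ S, ⇑g = Φ f := by
    intro f hf
    induction hf using Submodule.span_induction with
    | mem x hx => exact hmaps x hx
    | zero =>
      refine ⟨0, S.zero_mem, ?_⟩
      have := hsmul 0 0
      rw [zero_smul, zero_smul] at this
      rw [this]; rfl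
    | add x y _ _ hx hy =>
      obtain ⟨g, hg, hgx⟩ := hx
      obtain ⟨k, hk, hky⟩ := hy
      exact ⟨g + k, S.add_mem hg hk, by rw [hadd, ← hgx, ← hky]; rfl⟩
    | smul a x _ hx =>
      obtain ⟨g, hg, hgx⟩ := hx
      exact ⟨a • g, S.smul_mem a hg, by rw [hsmul, ← hgx]; rfl⟩
  refine exists_mem_of_forall_approx hS fun ε hε => ?_
  obtain ⟨f', hf', hff'⟩ := Metric.mem_closure_iff.1 (hG f) ε hε
  obtain ⟨g, hg, hgf⟩ := hspan f' hf'
  refine ⟨g, hg, fun x => ?_⟩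
  have h1 : Φ f = Φ (f - f') + Φ f' := by
    rw [← hadd]
    congr 1
    ext x
    simp
  rw [h1, hgf, Pi.add_apply, add_sub_cancel_right]
  have h2 : dist f f' = ‖f - f'‖ := dist_eq_norm (E := S) f f'
  rw [h2] at hff'
  exact (hbound _ _).trans hff'.le

end SubFeller

/-! ### Products of semigroups on closed tensor products. -/

section Tensor

variable {I A Y : Type*} [TopologicalSpace I] [TopologicalSpace A] [TopologicalSpace Y]

/-- The function `(t, x) ↦ p t * q (ι x)`. -/
noncomputable def tmul (ι : C(A, Y)) (p : I →ᵇ ℝ) (q : Y →ᵇ ℝ) : (I × A) →ᵇ ℝ :=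
  BoundedContinuousFunction.compContinuous p ⟨Prod.fst, continuous_fst⟩ *
    BoundedContinuousFunction.compContinuous q (ι.comp ⟨Prod.snd, continuous_snd⟩)

@[simp]
theorem tmul_apply (ι : C(A, Y)) (p : I →ᵇ ℝ) (q : Y →ᵇ ℝ) (z : I × A) :
    tmul ι p q z = p z.1 * q (ι z.2) := rfl

theorem continuous_tmul (ι : C(A, Y)) :
    Continuous fun z : (I →ᵇ ℝ) × (Y →ᵇ ℝ) => tmul ι z.1 z.2 :=
  ((BoundedContinuousFunction.continuous_compContinuous _).comp continuous_fst).mul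
    ((BoundedContinuousFunction.continuous_compContinuous _).comp continuous_snd)

theorem productSpan_eq (ι : C(A, Y)) (C : Set (I →ᵇ ℝ)) (D : Set (Y →ᵇ ℝ)) :
    productSpan ι C D = Submodule.span ℝ {f | ∃ p ∈ C, ∃ q ∈ D, f = tmul ι p q} := by
  unfold productSpan
  congr 1
  ext f
  refine exists_congr fun p => and_congr_right fun _ => exists_congr fun q =>
    and_congr_right fun _ => ?_
  constructor
  · intro h
    ext ⟨t, x⟩
    exact h t x
  · rintro rfl t x
    rfl

/-- `S` is the closed tensor product of `S₁` and `S₂`, as a space of functions on `I × A`, where the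
functions in `S₂` are read on `A` through `ι`. -/
structure IsTensor (ι : C(A, Y)) (S₁ : Submodule ℝ (I →ᵇ ℝ)) (S₂ : Submodule ℝ (Y →ᵇ ℝ))
    (S : Submodule ℝ ((I × A) →ᵇ ℝ)) : Prop where
  isClosed₁ : IsClosed (S₁ : Set (I →ᵇ ℝ))
  isClosed₂ : IsClosed (S₂ : Set (Y →ᵇ ℝ))
  isClosed : IsClosed (S : Set ((I × A) →ᵇ ℝ))
  slice_time : ∀ f ∈ S, ∀ x, ∃ p ∈ S₁, ∀ t, p t = f (t, x)
  slice_space : ∀ f ∈ S, ∀ t, ∃ q ∈ S₂, ∀ x, q (ι x) = f (t, x)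
  tmul_mem : ∀ p ∈ S₁, ∀ q ∈ S₂, tmul ι p q ∈ S
  dense : (S : Set ((I × A) →ᵇ ℝ)) ⊆ closure (productSpan ι (S₁ : Set (I →ᵇ ℝ)) S₂)
  eq_zero : ∀ q ∈ S₂, ∀ y ∉ range ι, q y = 0

namespace IsTensor

variable {ι : C(A, Y)} {S₁ : Submodule ℝ (I →ᵇ ℝ)} {S₂ : Submodule ℝ (Y →ᵇ ℝ)}
  {S : Submodule ℝ ((I × A) →ᵇ ℝ)}

/-- Off the range of `ι` the functions in `S₂` vanish. This lets functions on `Ω` and on its closure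
be handled together. -/
theorem ext_space (H : IsTensor ι S₁ S₂ S) {q q' : Y →ᵇ ℝ} (hq : q ∈ S₂) (hq' : q' ∈ S₂)
    (h : ∀ x, q (ι x) = q' (ι x)) : q = q' := by
  ext y
  by_cases hy : y ∈ range ι
  · obtain ⟨x, rfl⟩ := hy
    exact h x
  · rw [H.eq_zero q hq y hy, H.eq_zero q' hq' y hy]

theorem exists_timeSlice (H : IsTensor ι S₁ S₂ S) (f : S) (x : A) :
    ∃ p : S₁, (∀ t, (p : I →ᵇ ℝ) t = (f : (I × A) →ᵇ ℝ) (t, x)) := by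
  obtain ⟨p, hp, h⟩ := H.slice_time f f.2 x
  exact ⟨⟨p, hp⟩, h⟩

theorem exists_spaceSlice (H : IsTensor ι S₁ S₂ S) (f : S) (t : I) :
    ∃ q : S₂, (∀ x, (q : Y →ᵇ ℝ) (ι x) = (f : (I × A) →ᵇ ℝ) (t, x)) := by
  obtain ⟨p, hp, h⟩ := H.slice_space f f.2 t
  exact ⟨⟨p, hp⟩, h⟩

/-- The function `f (·, x)`. -/
noncomputable def timeSlice (H : IsTensor ι S₁ S₂ S) (f : S) (x : A) : S₁ :=
  (H.exists_timeSlice f x).choose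

/-- The function `f (t, ·)`. -/
noncomputable def spaceSlice (H : IsTensor ι S₁ S₂ S) (f : S) (t : I) : S₂ :=
  (H.exists_spaceSlice f t).choose

theorem timeSlice_apply (H : IsTensor ι S₁ S₂ S) (f : S) (x : A) (t : I) :
    (H.timeSlice f x : I →ᵇ ℝ) t = (f : (I × A) →ᵇ ℝ) (t, x) :=
  (H.exists_timeSlice f x).choose_spec t

theorem spaceSlice_apply (H : IsTensor ι S₁ S₂ S) (f : S) (t : I) (x : A) :
    (H.spaceSlice f t : Y →ᵇ ℝ) (ι x) = (f : (I × A) →ᵇ ℝ) (t, x) :=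
  (H.exists_spaceSlice f t).choose_spec x

theorem coe_timeSlice (H : IsTensor ι S₁ S₂ S) (f : S) (x : A) :
    ⇑(H.timeSlice f x : I →ᵇ ℝ) = fun t => (f : (I × A) →ᵇ ℝ) (t, x) :=
  funext (H.timeSlice_apply f x)

theorem spaceSlice_comp (H : IsTensor ι S₁ S₂ S) (f : S) (t : I) :
    ⇑(H.spaceSlice f t : Y →ᵇ ℝ) ∘ ι = fun x => (f : (I × A) →ᵇ ℝ) (t, x) :=
  funext (H.spaceSlice_apply f t)

theorem timeSlice_add (H : IsTensor ι S₁ S₂ S) (f g : S) (x : A) :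
    H.timeSlice (f + g) x = H.timeSlice f x + H.timeSlice g x := by
  ext t
  simp [timeSlice_apply]

theorem timeSlice_smul (H : IsTensor ι S₁ S₂ S) (c : ℝ) (f : S) (x : A) :
    H.timeSlice (c • f) x = c • H.timeSlice f x := by
  ext t
  simp [timeSlice_apply]

theorem spaceSlice_add (H : IsTensor ι S₁ S₂ S) (f g : S) (t : I) :
    H.spaceSlice (f + g) t = H.spaceSlice f t + H.spaceSlice g t :=
  Subtype.ext (H.ext_space (Subtype.prop _) (Subtype.prop _) fun x => by simp [spaceSlice_apply])

theorem spaceSlice_smul (H : IsTensor ι S₁ S₂ S) (c : ℝ) (f : S) (t : I) :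
    H.spaceSlice (c • f) t = c • H.spaceSlice f t :=
  Subtype.ext (H.ext_space (Subtype.prop _) (Subtype.prop _) fun x => by simp [spaceSlice_apply])

theorem norm_timeSlice_le (H : IsTensor ι S₁ S₂ S) (f : S) (x : A) : ‖H.timeSlice f x‖ ≤ ‖f‖ := by
  have h : ∀ t, ‖(H.timeSlice f x : I →ᵇ ℝ) t‖ ≤ ‖f‖ := fun t => by
    rw [timeSlice_apply]
    exact (f : (I × A) →ᵇ ℝ).norm_coe_le_norm _
  exact (BoundedContinuousFunction.norm_le (norm_nonneg f)).2 h

theorem norm_spaceSlice_le (H : IsTensor ι S₁ S₂ S) (f : S) (t : I) :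
    ‖H.spaceSlice f t‖ ≤ ‖f‖ := by
  have h : ∀ y, ‖(H.spaceSlice f t : Y →ᵇ ℝ) y‖ ≤ ‖f‖ := fun y => by
    by_cases hy : y ∈ range ι
    · obtain ⟨x, rfl⟩ := hy
      rw [spaceSlice_apply]
      exact (f : (I × A) →ᵇ ℝ).norm_coe_le_norm _
    · rw [H.eq_zero _ (Subtype.prop _) y hy, norm_zero]
      exact norm_nonneg f
  exact (BoundedContinuousFunction.norm_le (norm_nonneg f)).2 h

/-- The elements `p ⊗ q` of the tensor product. -/
noncomputable def pure (H : IsTensor ι S₁ S₂ S) (p : S₁) (q : S₂) : S :=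
  ⟨tmul ι p q, H.tmul_mem p p.2 q q.2⟩

theorem coe_pure (H : IsTensor ι S₁ S₂ S) (p : S₁) (q : S₂) :
    (H.pure p q : (I × A) →ᵇ ℝ) = tmul ι p q := rfl

theorem tendsto_pure (H : IsTensor ι S₁ S₂ S) {l : Filter ℝ≥0} {F : ℝ≥0 → S₁} {G : ℝ≥0 → S₂}
    {p : S₁} {q : S₂} (hF : Tendsto F l (𝓝 p)) (hG : Tendsto G l (𝓝 q)) :
    Tendsto (fun s => H.pure (F s) (G s)) l (𝓝 (H.pure p q)) := by
  rw [tendsto_subtype_rng] at hF hG ⊢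
  exact ((continuous_tmul ι).tendsto ((p : I →ᵇ ℝ), (q : Y →ᵇ ℝ))).comp (hF.prodMk_nhds hG)

theorem timeSlice_pure (H : IsTensor ι S₁ S₂ S) (p : S₁) (q : S₂) (x : A) :
    H.timeSlice (H.pure p q) x = (q : Y →ᵇ ℝ) (ι x) • p := by
  ext t
  simp [timeSlice_apply, coe_pure, mul_comm]

theorem spaceSlice_pure (H : IsTensor ι S₁ S₂ S) (p : S₁) (q : S₂) (t : I) :
    H.spaceSlice (H.pure p q) t = (p : I →ᵇ ℝ) t • q :=
  Subtype.ext (H.ext_space (Subtype.prop _) (Subtype.prop _) fun x => by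
    simp [spaceSlice_apply, coe_pure])

theorem mem_closure_span_pure (H : IsTensor ι S₁ S₂ S) (f : S) :
    f ∈ closure (Submodule.span ℝ {f : S | ∃ p q, f = H.pure p q} : Set S) := by
  have h : ∀ g ∈ productSpan ι (S₁ : Set (I →ᵇ ℝ)) (S₂ : Set (Y →ᵇ ℝ)), ∃ hg : g ∈ S,
      (⟨g, hg⟩ : S) ∈ Submodule.span ℝ {f : S | ∃ p q, f = H.pure p q} := by
    intro g hg
    rw [productSpan_eq] at hg
    induction hg using Submodule.span_induction with
    | mem g hg =>
      obtain ⟨p, hp, q, hq, rfl⟩ := hg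
      exact ⟨H.tmul_mem p hp q hq, Submodule.subset_span ⟨⟨p, hp⟩, ⟨q, hq⟩, rfl⟩⟩
    | zero => exact ⟨S.zero_mem, Submodule.zero_mem _⟩
    | add g g' _ _ hg hg' =>
      obtain ⟨h1, h2⟩ := hg
      obtain ⟨k1, k2⟩ := hg'
      exact ⟨S.add_mem h1 k1, Submodule.add_mem _ h2 k2⟩
    | smul c g _ hg =>
      obtain ⟨h1, h2⟩ := hg
      exact ⟨S.smul_mem c h1, Submodule.smul_mem _ c h2⟩
  rw [Metric.mem_closure_iff]
  intro ε hε
  obtain ⟨g, hg, hfg⟩ := Metric.mem_closure_iff.1 (H.dense f.2) ε hε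
  exact ⟨⟨g, (h g hg).1⟩, (h g hg).2, hfg⟩

/-- The action of a sub-Feller semigroup on the time variable. -/
theorem exists_timeSemigroup (H : IsTensor ι S₁ S₂ S) {P : ℝ≥0 → (I → ℝ) → I → ℝ}
    (hP : IsSubFeller S₁ P) :
    ∃ U : ℝ≥0 → EndCLM S, IsContractionSemigroup U ∧
      (∀ s f z, (U s f : (I × A) →ᵇ ℝ) z = P s (fun t => (f : (I × A) →ᵇ ℝ) (t, z.2)) z.1) ∧
      ∀ s p q, U s (H.pure p q) = H.pure (hP.op s p) q := by
  have key : ∀ s, ∃ B : EndCLM S,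
      (∀ f, ⇑(B f : (I × A) →ᵇ ℝ) = fun z => (hP.op s (H.timeSlice f z.2) : I →ᵇ ℝ) z.1) ∧
      ∀ f, ‖B f‖ ≤ ‖f‖ := by
    intro s
    refine exists_clm_of_dense H.isClosed H.mem_closure_span_pure ?_ ?_ ?_ ?_
    · rintro _ ⟨p, q, rfl⟩
      refine ⟨H.pure (hP.op s p) q, Subtype.prop _, ?_⟩
      ext z
      simp [H.timeSlice_pure, coe_pure, mul_comm]
    · intro f g
      ext z
      simp [H.timeSlice_add]
    · intro c f
      ext z
      simp [H.timeSlice_smul]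
    · intro f z
      exact ((hP.op s (H.timeSlice f z.2) : I →ᵇ ℝ).norm_coe_le_norm z.1).trans
        ((hP.isContractionSemigroup.norm_le s _).trans (H.norm_timeSlice_le f z.2))
  choose U hU hUn using key
  have hUp : ∀ s p q, U s (H.pure p q) = H.pure (hP.op s p) q := by
    intro s p q
    ext z
    simp only [hU, H.timeSlice_pure]
    simp [coe_pure, mul_comm]
  refine ⟨U, ?_, fun s f z => ?_, hUp⟩
  · refine IsContractionSemigroup.of_dense_span hUn H.mem_closure_span_pure ?_ ?_ ?_
    · rintro _ ⟨p, q, rfl⟩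
      rw [hUp, hP.isContractionSemigroup.zero]
    · rintro s r _ ⟨p, q, rfl⟩
      rw [hUp, hUp, hUp, hP.isContractionSemigroup.add]
    · rintro _ ⟨p, q, rfl⟩
      exact (H.tendsto_pure (hP.isContractionSemigroup.strongCont p)
        (tendsto_const_nhds (x := q))).congr fun s => (hUp s p q).symm
  · rw [hU]
    simp only
    rw [hP.coe_op, H.coe_timeSlice]

/-- The action of a sub-Feller semigroup on the space variable. -/
theorem exists_spaceSemigroup (H : IsTensor ι S₁ S₂ S) {Q : ℝ≥0 → (Y → ℝ) → Y → ℝ}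
    {Q' : ℝ≥0 → (A → ℝ) → A → ℝ} (hQ : IsSubFeller S₂ Q)
    (hQ' : ∀ s, ∀ g ∈ S₂, Q' s (g ∘ ι) = Q s g ∘ ι) :
    ∃ U : ℝ≥0 → EndCLM S, IsContractionSemigroup U ∧
      (∀ s f z, (U s f : (I × A) →ᵇ ℝ) z = Q' s (fun x => (f : (I × A) →ᵇ ℝ) (z.1, x)) z.2) ∧
      ∀ s p q, U s (H.pure p q) = H.pure p (hQ.op s q) := by
  have key : ∀ s, ∃ B : EndCLM S,
      (∀ f, ⇑(B f : (I × A) →ᵇ ℝ) = fun z => (hQ.op s (H.spaceSlice f z.1) : Y →ᵇ ℝ) (ι z.2)) ∧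
      ∀ f, ‖B f‖ ≤ ‖f‖ := by
    intro s
    refine exists_clm_of_dense H.isClosed H.mem_closure_span_pure ?_ ?_ ?_ ?_
    · rintro _ ⟨p, q, rfl⟩
      refine ⟨H.pure p (hQ.op s q), Subtype.prop _, ?_⟩
      ext z
      simp [H.spaceSlice_pure, coe_pure]
    · intro f g
      ext z
      simp [H.spaceSlice_add]
    · intro c f
      ext z
      simp [H.spaceSlice_smul]
    · intro f z
      exact ((hQ.op s (H.spaceSlice f z.1) : Y →ᵇ ℝ).norm_coe_le_norm (ι z.2)).trans
        ((hQ.isContractionSemigroup.norm_le s _).trans (H.norm_spaceSlice_le f z.1))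
  choose U hU hUn using key
  have hUp : ∀ s p q, U s (H.pure p q) = H.pure p (hQ.op s q) := by
    intro s p q
    ext z
    simp only [hU, H.spaceSlice_pure]
    simp [coe_pure]
  refine ⟨U, ?_, fun s f z => ?_, hUp⟩
  · refine IsContractionSemigroup.of_dense_span hUn H.mem_closure_span_pure ?_ ?_ ?_
    · rintro _ ⟨p, q, rfl⟩
      rw [hUp, hQ.isContractionSemigroup.zero]
    · rintro s r _ ⟨p, q, rfl⟩
      rw [hUp, hUp, hUp, hQ.isContractionSemigroup.add]
    · rintro _ ⟨p, q, rfl⟩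
      exact (H.tendsto_pure (tendsto_const_nhds (x := p))
        (hQ.isContractionSemigroup.strongCont q)).congr fun s => (hUp s p q).symm
  · rw [hU]
    simp only
    rw [hQ.coe_op, ← H.spaceSlice_comp, hQ' s _ (Subtype.prop _)]
    rfl

/-- The time and space actions commute on every `p ⊗ q`, hence on `S` by density, so their product
is a semigroup. Positivity is inherited slice by slice from the two factors. -/
theorem exists_productSemigroup (H : IsTensor ι S₁ S₂ S) {P : ℝ≥0 → (I → ℝ) → I → ℝ}
    {Q : ℝ≥0 → (Y → ℝ) → Y → ℝ} {Q' : ℝ≥0 → (A → ℝ) → A → ℝ} (hP : IsSubFeller S₁ P)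
    (hQ : IsSubFeller S₂ Q) (hQ' : ∀ s, ∀ g ∈ S₂, Q' s (g ∘ ι) = Q s g ∘ ι) :
    ∃ hR : IsSubFeller S (productSemigroup P Q'),
      ∀ s p q, hR.op s (H.pure p q) = H.pure (hP.op s p) (hQ.op s q) := by
  obtain ⟨U, hU, hUf, hUp⟩ := H.exists_timeSemigroup hP
  obtain ⟨V, hV, hVf, hVp⟩ := H.exists_spaceSemigroup hQ hQ'
  have hUV : ∀ s r f, U s (V r f) = V r (U s f) := fun s r f =>
    eqOn_of_dense_span (U := (U s).comp (V r)) (V := (V r).comp (U s)) H.mem_closure_span_pure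
      (by
        rintro _ ⟨p, q, rfl⟩
        simp [hUp, hVp]) f
  have hW : ∀ s, ∀ f : S, ⇑((U s).comp (V s) f : (I × A) →ᵇ ℝ) = productSemigroup P Q' s
      (f : (I × A) →ᵇ ℝ) := by
    intro s f
    ext z
    rw [ContinuousLinearMap.comp_apply, hUf]
    simp only [hVf]
    rfl
  have hposV : ∀ s, ∀ f : S, (∀ z, 0 ≤ (f : (I × A) →ᵇ ℝ) z) →
      ∀ z, 0 ≤ (V s f : (I × A) →ᵇ ℝ) z := by
    intro s f hf z
    rw [hVf, ← H.spaceSlice_comp, hQ' s _ (Subtype.prop _)]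
    refine hQ.nonneg s _ (Subtype.prop _) (fun y => ?_) _
    by_cases hy : y ∈ range ι
    · obtain ⟨x, rfl⟩ := hy
      rw [H.spaceSlice_apply]
      exact hf _
    · rw [H.eq_zero _ (Subtype.prop _) y hy]
  have hposU : ∀ s, ∀ f : S, (∀ z, 0 ≤ (f : (I × A) →ᵇ ℝ) z) →
      ∀ z, 0 ≤ (U s f : (I × A) →ᵇ ℝ) z := by
    intro s f hf z
    rw [hUf, ← H.coe_timeSlice]
    refine hP.nonneg s _ (Subtype.prop _) (fun y => ?_) _
    rw [H.timeSlice_apply]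
    exact hf _
  have hR : IsSubFeller S (productSemigroup P Q') :=
    IsSubFeller.of_isContractionSemigroup (hU.comp hV hUV) hW fun s f hf hpos z => by
      rw [← hW s ⟨f, hf⟩]
      exact hposU s _ (hposV s ⟨f, hf⟩ hpos) z
  refine ⟨hR, fun s p q => ?_⟩
  have : hR.op s (H.pure p q) = (U s).comp (V s) (H.pure p q) :=
    Subtype.ext (DFunLike.coe_injective ((hR.coe_op _ _).trans (hW _ _).symm))
  rw [this, ContinuousLinearMap.comp_apply, hVp, hUp]

theorem isSubFeller_product (H : IsTensor ι S₁ S₂ S) {P : ℝ≥0 → (I → ℝ) → I → ℝ}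
    {Q : ℝ≥0 → (Y → ℝ) → Y → ℝ} {Q' : ℝ≥0 → (A → ℝ) → A → ℝ} (hP : IsSubFeller S₁ P)
    (hQ : IsSubFeller S₂ Q) (hQ' : ∀ s, ∀ g ∈ S₂, Q' s (g ∘ ι) = Q s g ∘ ι) :
    IsSubFeller S (productSemigroup P Q') :=
  (H.exists_productSemigroup hP hQ hQ').1

/-- Product rule: `U_h p ⊗ V_h q - p ⊗ q = (U_h p - p) ⊗ V_h q + p ⊗ (V_h q - q)`, where strong
continuity handles the factor `V_h q`. -/
theorem pure_mem_infGenerator (H : IsTensor ι S₁ S₂ S) {U : ℝ≥0 → EndCLM S₁}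
    {V : ℝ≥0 → EndCLM S₂} {W : ℝ≥0 → EndCLM S} (hV : IsContractionSemigroup V)
    (hW : ∀ s p q, W s (H.pure p q) = H.pure (U s p) (V s q)) {p p' : S₁} {q q' : S₂}
    (hp : (p, p') ∈ infGenerator U) (hq : (q, q') ∈ infGenerator V) :
    (H.pure p q, H.pure p' q + H.pure p q') ∈ infGenerator W := by
  have h1 := tendsto_subtype_rng.1 (H.tendsto_pure hp (hV.strongCont q))
  have h2 := tendsto_subtype_rng.1 (H.tendsto_pure (tendsto_const_nhds (x := p)) hq)
  refine tendsto_subtype_rng.2 ((h1.add h2).congr fun h => ?_)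
  rw [hW]
  ext z
  simp [coe_pure]
  ring

/-- The span of `C · D` is a dense invariant subspace of the domain, so it is a core; on it the
generator is the sum operator. -/
theorem generator_product (H : IsTensor ι S₁ S₂ S) {P : ℝ≥0 → (I → ℝ) → I → ℝ}
    {Q : ℝ≥0 → (Y → ℝ) → Y → ℝ} {Q' : ℝ≥0 → (A → ℝ) → A → ℝ} (hP : IsSubFeller S₁ P)
    (hQ : IsSubFeller S₂ Q) (hQ' : ∀ s, ∀ g ∈ S₂, Q' s (g ∘ ι) = Q s g ∘ ι)
    {C : Set (I →ᵇ ℝ)} {D : Set (Y →ᵇ ℝ)} (hC : IsInvariantCore S₁ P C)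
    (hD : IsInvariantCore S₂ Q D) :
    generator S (productSemigroup P Q') =
      closure (sumOperator ι (generator S₁ P) (generator S₂ Q) (productSpan ι C D)) := by
  obtain ⟨hR, hRp⟩ := H.exists_productSemigroup hP hQ hQ'
  have hCS : C ⊆ S₁ := fun p hp => (hC.subset_domain hp).choose_spec.1
  have hDS : D ⊆ S₂ := fun p hp => (hD.subset_domain hp).choose_spec.1
  -- The two partial images `a` and `b` are carried along the induction over the span, so that their
  -- sum can be identified with the generator of the product.
  have claim : ∀ f ∈ productSpan ι C D, ∃ a b : I × A → ℝ, ∃ g : (I × A) →ᵇ ℝ,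
      (∀ x, ∃ q ∈ generator S₁ P, (∀ t, q.1 t = f (t, x)) ∧ ∀ t, q.2 t = a (t, x)) ∧
      (∀ t, ∃ q ∈ generator S₂ Q, (∀ x, q.1 (ι x) = f (t, x)) ∧ ∀ x, q.2 (ι x) = b (t, x)) ∧
      (∀ z, g z = a z + b z) ∧ (f, g) ∈ generator S (productSemigroup P Q') := by
    intro f hf
    rw [productSpan_eq] at hf
    induction hf using Submodule.span_induction with
    | mem f hf =>
      obtain ⟨p, hp, q, hq, rfl⟩ := hf
      obtain ⟨p', hp'⟩ := hC.subset_domain hp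
      obtain ⟨q', hq'⟩ := hD.subset_domain hq
      refine ⟨tmul ι p' q, tmul ι p q', tmul ι p' q + tmul ι p q', fun x => ?_, fun t => ?_,
        fun z => rfl, ?_⟩
      · exact ⟨_, hP.generator_smul (q (ι x)) hp', fun t => mul_comm _ _, fun t => mul_comm _ _⟩
      · exact ⟨_, hQ.generator_smul (p t) hq', fun t => rfl, fun t => rfl⟩
      · obtain ⟨h1, h2, h3⟩ := hP.mem_generator_iff'.1 hp'
        obtain ⟨k1, k2, k3⟩ := hQ.mem_generator_iff'.1 hq'
        have := H.pure_mem_infGenerator hQ.isContractionSemigroup hRp h3 k3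
        exact hR.mem_generator_iff.2 this
    | zero =>
      exact ⟨0, 0, 0, fun x => ⟨0, hP.generator_zero, fun _ => rfl, fun _ => rfl⟩,
        fun x => ⟨0, hQ.generator_zero, fun _ => rfl, fun _ => rfl⟩, fun z => by simp,
        hR.generator_zero⟩
    | add f₁ f₂ _ _ h₁ h₂ =>
      obtain ⟨a₁, b₁, g₁, ha₁, hb₁, hg₁, hG₁⟩ := h₁
      obtain ⟨a₂, b₂, g₂, ha₂, hb₂, hg₂, hG₂⟩ := h₂
      refine ⟨a₁ + a₂, b₁ + b₂, g₁ + g₂, fun x => ?_, fun t => ?_, fun z => ?_,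
        hR.generator_add hG₁ hG₂⟩
      · obtain ⟨q₁, h1, h2, h3⟩ := ha₁ x
        obtain ⟨q₂, k1, k2, k3⟩ := ha₂ x
        exact ⟨_, hP.generator_add h1 k1, fun t => by simp [h2, k2], fun t => by simp [h3, k3]⟩
      · obtain ⟨q₁, h1, h2, h3⟩ := hb₁ t
        obtain ⟨q₂, k1, k2, k3⟩ := hb₂ t
        exact ⟨_, hQ.generator_add h1 k1, fun t => by simp [h2, k2], fun t => by simp [h3, k3]⟩
      · simp only [BoundedContinuousFunction.coe_add, Pi.add_apply, hg₁, hg₂]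
        ring
    | smul c f₁ _ h₁ =>
      obtain ⟨a₁, b₁, g₁, ha₁, hb₁, hg₁, hG₁⟩ := h₁
      refine ⟨c • a₁, c • b₁, c • g₁, fun x => ?_, fun t => ?_, fun z => ?_,
        hR.generator_smul c hG₁⟩
      · obtain ⟨q₁, h1, h2, h3⟩ := ha₁ x
        exact ⟨_, hP.generator_smul c h1, fun t => by simp [h2], fun t => by simp [h3]⟩
      · obtain ⟨q₁, h1, h2, h3⟩ := hb₁ t
        exact ⟨_, hQ.generator_smul c h1, fun t => by simp [h2], fun t => by simp [h3]⟩
      · simp only [BoundedContinuousFunction.coe_smul, Pi.smul_apply, hg₁, smul_eq_mul]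
        ring
  -- The decomposition `a + b` is forced by `f`: slices are determined by their values and the
  -- generators are single-valued.
  have hsum : sumOperator ι (generator S₁ P) (generator S₂ Q) (productSpan ι C D) =
      {p | p ∈ generator S (productSemigroup P Q') ∧ p.1 ∈ productSpan ι C D} := by
    ext ⟨f, g⟩
    constructor
    · rintro ⟨hf, a, b, ha, hb, hg⟩
      obtain ⟨a', b', g', ha', hb', hg', hG⟩ := claim f hf
      refine ⟨?_, hf⟩
      have : g = g' := by
        ext ⟨t, x⟩
        rw [hg, hg']
        obtain ⟨⟨u, v⟩, h1, h2, h3⟩ := ha x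
        obtain ⟨⟨u', v'⟩, k1, k2, k3⟩ := ha' x
        obtain ⟨⟨w, y⟩, l1, l2, l3⟩ := hb t
        obtain ⟨⟨w', y'⟩, m1, m2, m3⟩ := hb' t
        have e1 : u = u' := by
          ext t
          exact (h2 t).trans (k2 t).symm
        subst e1
        have e2 : w = w' := H.ext_space l1.1 m1.1 fun x => (l2 x).trans (m2 x).symm
        subst e2
        rw [← h3, ← k3, ← l3, ← m3]
        simp only
        rw [IsSubFeller.generator_unique h1 k1, IsSubFeller.generator_unique l1 m1]
      rw [this]
      exact hG
    · rintro ⟨hG, hf⟩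
      obtain ⟨a', b', g', ha', hb', hg', hG'⟩ := claim f hf
      obtain rfl : g = g' := IsSubFeller.generator_unique hG hG'
      exact ⟨hf, a', b', ha', hb', hg'⟩
  rw [hsum]
  refine (hR.closure_generator_of_invariant H.isClosed ?_ ?_ ?_).symm
  · intro f hf
    obtain ⟨_, _, g, _, _, _, hG⟩ := claim f hf
    exact ⟨g, hG⟩
  · intro s hs f hf
    rw [productSpan_eq] at hf ⊢
    induction hf using Submodule.span_induction with
    | mem f hf =>
      obtain ⟨p, hp, q, hq, rfl⟩ := hf
      obtain ⟨p', hp', hpp'⟩ := hC.invariant s hs p hp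
      obtain ⟨q', hq', hqq'⟩ := hD.invariant s hs q hq
      refine ⟨tmul ι p' q', Submodule.subset_span ⟨p', hp', q', hq', rfl⟩, ?_⟩
      have h1 : (hP.op s ⟨p, hCS hp⟩ : I →ᵇ ℝ) = p' :=
        DFunLike.coe_injective ((hP.coe_op _ _).trans hpp'.symm)
      have h2 : (hQ.op s ⟨q, hDS hq⟩ : Y →ᵇ ℝ) = q' :=
        DFunLike.coe_injective ((hQ.coe_op _ _).trans hqq'.symm)
      have h3 := hR.coe_op s (H.pure ⟨p, hCS hp⟩ ⟨q, hDS hq⟩)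
      rw [hRp, coe_pure, coe_pure, h1, h2] at h3
      exact h3
    | zero =>
      refine ⟨0, Submodule.zero_mem _, ?_⟩
      have := hR.coe_op s 0
      rw [map_zero] at this
      exact this
    | add f₁ f₂ hf₁ hf₂ h₁ h₂ =>
      obtain ⟨g₁, hg₁, e₁⟩ := h₁
      obtain ⟨g₂, hg₂, e₂⟩ := h₂
      have hS : ∀ f ∈ Submodule.span ℝ {f | ∃ p ∈ C, ∃ q ∈ D, f = tmul ι p q}, f ∈ S := by
        intro f hf
        rw [← productSpan_eq] at hf
        obtain ⟨_, _, g, _, _, _, hG⟩ := claim f hf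
        exact hG.1
      refine ⟨g₁ + g₂, Submodule.add_mem _ hg₁ hg₂, ?_⟩
      rw [hR.map_add s _ (hS _ hf₁) _ (hS _ hf₂), ← e₁, ← e₂]
      rfl
    | smul c f₁ hf₁ h₁ =>
      obtain ⟨g₁, hg₁, e₁⟩ := h₁
      have hS : f₁ ∈ S := by
        rw [← productSpan_eq] at hf₁
        obtain ⟨_, _, g, _, _, _, hG⟩ := claim f₁ hf₁
        exact hG.1
      refine ⟨c • g₁, Submodule.smul_mem _ c hg₁, ?_⟩
      rw [hR.map_smul s c _ hS, ← e₁]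
      rfl
  -- Cores are dense in their factors and `tmul` is jointly continuous, so products from the cores
  -- approximate all products.
  · refine H.dense.trans (closure_minimal ?_ isClosed_closure)
    rw [← Submodule.topologicalClosure_coe, SetLike.coe_subset_coe,
      productSpan_eq ι (S₁ : Set (I →ᵇ ℝ)) S₂, Submodule.span_le]
    rintro _ ⟨p, hp, q, hq, rfl⟩
    have h1 := hP.subset_closure_core H.isClosed₁ hC hp
    have h2 := hQ.subset_closure_core H.isClosed₂ hD hq
    have h3 : (p, q) ∈ closure (C ×ˢ D) := by
      rw [closure_prod_eq]
      exact ⟨h1, h2⟩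
    have h4 : MapsTo (fun z : (I →ᵇ ℝ) × (Y →ᵇ ℝ) => tmul ι z.1 z.2) (C ×ˢ D)
        (productSpan ι C D) := by
      rintro ⟨p, q⟩ ⟨hp, hq⟩
      simp only [productSpan_eq]
      exact Submodule.subset_span ⟨p, hp, q, hq, rfl⟩
    have h5 := map_mem_closure (continuous_tmul ι) h3 h4
    exact h5

end IsTensor

end Tensor

/-! ### Approximation by sums of products. -/

section Density

variable {I A Y : Type*} [TopologicalSpace I] [TopologicalSpace A] [TopologicalSpace Y]

/-- A partition of unity on `K`, subordinate to sets on which `F` varies by less than `ε`, freezes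
`F` at finitely many points. One `ε` pays for the oscillation of `F`, the other for the part of `F`
outside `K`, where the weights may sum to less than `1`. -/
theorem exists_sum_smul_approx {B : Type*} [NormedAddCommGroup B] [NormedSpace ℝ B]
    [LocallyCompactSpace I] [T2Space I] {V : Set I} (hV : IsOpen V) {F : I → B}
    (hF : Continuous F) {ε : ℝ} (hε : 0 < ε) {K : Set I} (hK : IsCompact K) (hKV : K ⊆ V)
    (hKF : ∀ t ∉ K, ‖F t‖ ≤ ε) :
    ∃ (s : Finset I) (φ : s → C(I, ℝ)), (∀ i, HasCompactSupport (φ i)) ∧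
      (∀ i, tsupport (φ i) ⊆ V) ∧ ∀ t, ‖F t - ∑ i, φ i t • F i‖ ≤ 2 * ε := by
  classical
  let U : I → Set I := fun s => V ∩ {t | ‖F t - F s‖ < ε}
  have hU : ∀ s, IsOpen (U s) := fun s =>
    hV.inter (isOpen_lt (by fun_prop) continuous_const)
  obtain ⟨s, hs⟩ := hK.elim_finite_subcover U hU fun t ht => mem_iUnion.2
    ⟨t, hKV ht, by simpa using hε⟩
  obtain ⟨φ, hφU, hφc⟩ := PartitionOfUnity.exists_isSubordinate_of_locallyFinite_t2space hK
    (fun i : s => U i) (fun i => hU i) (locallyFinite_of_finite _) (by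
      rw [iUnion_subtype]
      exact hs)
  refine ⟨s, fun i => φ i, hφc, fun i => (hφU i).trans inter_subset_left, fun t => ?_⟩
  have h1 : ∑ i, φ i t ≤ 1 := by
    have := φ.sum_le_one t
    rwa [finsum_eq_sum_of_fintype] at this
  have h0 : ∀ i, 0 ≤ φ i t := fun i => φ.nonneg i t
  have e : F t - ∑ i, φ i t • F i =
      (1 - ∑ i, φ i t) • F t + ∑ i, φ i t • (F t - F i) := by
    simp only [smul_sub, Finset.sum_sub_distrib, sub_smul, one_smul, Finset.sum_smul]
    abel
  have h2 : ‖(1 - ∑ i, φ i t) • F t‖ ≤ ε := by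
    by_cases ht : t ∈ K
    · have := φ.sum_eq_one ht
      rw [finsum_eq_sum_of_fintype] at this
      rw [this]
      simpa using hε.le
    · rw [norm_smul, Real.norm_of_nonneg (by linarith)]
      have := hKF t ht
      have h3 : 0 ≤ ∑ i, φ i t := Finset.sum_nonneg fun i _ => h0 i
      nlinarith [norm_nonneg (F t)]
  have h3 : ‖∑ i, φ i t • (F t - F i)‖ ≤ ε := by
    calc ‖∑ i, φ i t • (F t - F i)‖ ≤ ∑ i, φ i t * ε := by
          refine norm_sum_le_of_le _ fun i _ => ?_
          rw [norm_smul, Real.norm_of_nonneg (h0 i)]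
          by_cases hi : φ i t = 0
          · simp [hi]
          · have : t ∈ U i := hφU i (subset_tsupport _ hi)
            exact mul_le_mul_of_nonneg_left (le_of_lt this.2) (h0 i)
      _ = (∑ i, φ i t) * ε := by rw [Finset.sum_mul]
      _ ≤ 1 * ε := by gcongr
      _ = ε := one_mul ε
  rw [e]
  exact (norm_add_le _ _).trans (by linarith)

/-- The slices of a continuous function on a product, as bounded continuous functions. -/
noncomputable def slices [CompactSpace Y] (f : C(I × Y, ℝ)) (t : I) : Y →ᵇ ℝ :=
  BoundedContinuousFunction.mkOfCompact (f.curry t)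

@[simp]
theorem slices_apply [CompactSpace Y] (f : C(I × Y, ℝ)) (t : I) (y : Y) :
    slices f t y = f (t, y) := rfl

theorem continuous_slices [CompactSpace Y] (f : C(I × Y, ℝ)) : Continuous (slices f) :=
  (ContinuousMap.isometryEquivBoundedOfCompact Y ℝ).continuous.comp f.curry.continuous

/-- Read `g` as the continuous map `t ↦ g (t, ·)` into bounded functions of `y`; the partition of
unity then yields sums `φ_i (t) g (t_i, ·)`. The open set `V` keeps the time factors in `S₁`, for
example away from `t = 0`. -/
theorem mem_closure_productSpan [LocallyCompactSpace I] [T2Space I] [CompactSpace Y]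
    {S₁ : Submodule ℝ (I →ᵇ ℝ)} {S₂ : Submodule ℝ (Y →ᵇ ℝ)} (ι : C(A, Y)) {V : Set I}
    (hV : IsOpen V) (hS₁ : ∀ p : I →ᵇ ℝ, HasCompactSupport p → tsupport p ⊆ V → p ∈ S₁)
    (g : C(I × Y, ℝ)) (hg : ∀ t, slices g t ∈ S₂)
    (hK : ∀ ε > 0, ∃ K, IsCompact K ∧ K ⊆ V ∧ ∀ t ∉ K, ∀ y, |g (t, y)| ≤ ε)
    {f : (I × A) →ᵇ ℝ} (hf : ∀ t x, f (t, x) = g (t, ι x)) :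
    f ∈ closure (productSpan ι (S₁ : Set (I →ᵇ ℝ)) S₂ : Set ((I × A) →ᵇ ℝ)) := by
  rw [Metric.mem_closure_iff]
  intro ε hε
  obtain ⟨K, hKc, hKV, hKg⟩ := hK (ε / 3) (by positivity)
  obtain ⟨s, φ, hφc, hφV, hφ⟩ := exists_sum_smul_approx hV (continuous_slices g)
    (ε := ε / 3) (by positivity) hKc hKV fun t ht =>
      (BoundedContinuousFunction.norm_le (by positivity)).2 fun y => hKg t ht y
  have hb : ∀ i, ∃ p ∈ S₁, ∀ t, p t = φ i t := by
    intro i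
    obtain ⟨C, hC⟩ := (hφc i).exists_bound_of_continuous (φ i).continuous
    exact ⟨BoundedContinuousFunction.ofNormedAddCommGroup (φ i) (φ i).continuous C hC,
      hS₁ _ (hφc i) (hφV i), fun _ => rfl⟩
  choose p hp hpφ using hb
  refine ⟨∑ i, tmul ι (p i) (slices g i), ?_, ?_⟩
  · rw [productSpan_eq]
    exact Submodule.sum_mem _ fun i _ =>
      Submodule.subset_span ⟨p i, hp i, slices g i, hg i, rfl⟩
  · refine lt_of_le_of_lt ((BoundedContinuousFunction.dist_le (C := 2 * (ε / 3))
      (by positivity)).2 fun z => ?_) (by linarith)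
    have h1 := (slices g z.1 - ∑ i, φ i z.1 • slices g i).norm_coe_le_norm (ι z.2)
    have h2 := h1.trans (hφ z.1)
    rw [Real.dist_eq]
    rw [Real.norm_eq_abs] at h2
    have e1 : (slices g z.1 - ∑ i, φ i z.1 • slices g i) (ι z.2) =
        f z - (∑ i, tmul ι (p i) (slices g i)) z := by
      rw [BoundedContinuousFunction.sub_apply, BoundedContinuousFunction.sum_apply,
        BoundedContinuousFunction.sum_apply, slices_apply, ← hf]
      simp [hpφ]
    rwa [e1] at h2

theorem isClosed_vanishingOn {X : Type*} [TopologicalSpace X] (Z : Set X) :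
    IsClosed (vanishingOn Z : Set (X →ᵇ ℝ)) := by
  have : (vanishingOn Z : Set (X →ᵇ ℝ)) = ⋂ x ∈ Z, {f | f x = 0} := by
    ext f
    simp only [mem_iInter]
    rfl
  rw [this]
  exact isClosed_biInter fun x _ =>
    isClosed_eq (continuous_eval_const x) continuous_const

theorem isClosed_vanishingAtInfinity (X : Type*) [TopologicalSpace X] :
    IsClosed (vanishingAtInfinity X : Set (X →ᵇ ℝ)) := by
  rw [← isSeqClosed_iff_isClosed]
  intro F f hF hf
  have h := BoundedContinuousFunction.tendsto_iff_tendstoUniformly.1 hf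
  refine (h.tendstoUniformlyOnFilter.mono_right le_top).tendsto_of_eventually_tendsto
    (Eventually.of_forall hF) tendsto_const_nhds

/-- Near a point outside the range, the closed set `j '' K` can be avoided, and off the compact set
`K` the function is smaller than `ε`. -/
theorem continuous_extend_zero {j : A → Y} [T2Space Y] (hj : IsOpenEmbedding j) {f : A → ℝ}
    (hf : Continuous f) (hf0 : Tendsto f (cocompact A) (𝓝 0)) :
    Continuous (Function.extend j f 0) := by
  rw [continuous_iff_continuousAt]
  intro y
  by_cases hy : y ∈ range j
  · obtain ⟨x, rfl⟩ := hy
    rw [← hj.continuousAt_iff, Function.extend_comp hj.injective]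
    exact hf.continuousAt
  · rw [ContinuousAt, Function.extend_apply' _ _ _ hy, Metric.tendsto_nhds]
    intro ε hε
    obtain ⟨K, hK, hKf⟩ := mem_cocompact.1 (Metric.tendsto_nhds.1 hf0 ε hε)
    have hjK : IsClosed (j '' K) := (hK.image hj.continuous).isClosed
    have hyK : y ∈ (j '' K)ᶜ := fun ⟨x, _, hx⟩ => hy ⟨x, hx⟩
    filter_upwards [hjK.isOpen_compl.mem_nhds hyK] with w hw
    by_cases hwj : w ∈ range j
    · obtain ⟨x, rfl⟩ := hwj
      rw [hj.injective.extend_apply]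
      exact hKf fun hx => hw ⟨x, hx, rfl⟩
    · rw [Function.extend_apply' _ _ _ hwj]
      simpa using hε

end Density

/-! ### The three space-time function spaces as tensor products. -/

section Spaces

variable {d : ℕ} {Ω : Set (EuclideanSpace ℝ (Fin d))}

theorem IsRegularSet.compactSpace_closure (hΩ : IsRegularSet Ω) : CompactSpace (closure Ω) :=
  isCompact_iff_compactSpace.1 hΩ.isBounded.isCompact_closure

theorem isTensor_spaceCTBdry (hΩ : IsRegularSet Ω) (T : ℝ) :
    IsTensor (ContinuousMap.id (closure Ω)) (spaceC T) (spaceCBdry Ω) (spaceCTBdry T Ω) := by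
  have := hΩ.compactSpace_closure
  refine ⟨isClosed_univ, isClosed_vanishingOn _, isClosed_vanishingOn _, ?_, ?_, ?_, ?_, ?_⟩
  · intro f _ x
    exact ⟨f.compContinuous ⟨fun t => (t, x), by fun_prop⟩, trivial, fun t => rfl⟩
  · intro f hf t
    exact ⟨f.compContinuous ⟨fun x => (t, x), by fun_prop⟩, fun x hx => hf (t, x) hx,
      fun t => rfl⟩
  · intro p _ q hq z hz
    simp [hq z.2 hz]
  · intro f hf
    refine mem_closure_productSpan _ (S₁ := spaceC T) (S₂ := spaceCBdry Ω) isOpen_univ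
      (fun _ _ _ => trivial) f.toContinuousMap
      (fun t x hx => hf (t, x) hx) (fun ε _ => ⟨univ, isCompact_univ, subset_univ _, fun t ht =>
        (ht trivial).elim⟩) fun t x => rfl
  · intro q _ y hy
    exact (hy ⟨y, rfl⟩).elim

theorem isTensor_spaceC0TBdry (hΩ : IsRegularSet Ω) (T : ℝ) :
    IsTensor (ContinuousMap.id (closure Ω)) (spaceC0 T) (spaceCBdry Ω) (spaceC0TBdry T Ω) := by
  have := hΩ.compactSpace_closure
  refine ⟨isClosed_vanishingOn _, isClosed_vanishingOn _,
    (isClosed_vanishingOn _).inter (isClosed_vanishingOn _), ?_, ?_, ?_, ?_, ?_⟩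
  · intro f hf x
    exact ⟨f.compContinuous ⟨fun t => (t, x), by fun_prop⟩, fun t ht => hf.2 (t, x) ht,
      fun t => rfl⟩
  · intro f hf t
    exact ⟨f.compContinuous ⟨fun x => (t, x), by fun_prop⟩, fun x hx => hf.1 (t, x) hx,
      fun t => rfl⟩
  · intro p hp q hq
    refine ⟨fun z hz => ?_, fun z hz => ?_⟩
    · simp [hq z.2 hz]
    · simp [hp z.1 hz]
  · intro f hf
    refine mem_closure_productSpan _ (S₁ := spaceC0 T) (S₂ := spaceCBdry Ω)
      (V := {t : Icc (0 : ℝ) T | (t : ℝ) ≠ 0})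
      (isOpen_ne_fun continuous_subtype_val continuous_const)
      (fun p _ hp t ht => by
        by_contra h
        exact hp (subset_tsupport _ h) ht) f.toContinuousMap
      (fun t x hx => hf.1 (t, x) hx) (fun ε hε => ?_) fun t x => rfl
    -- This set is closed in a compact interval, and it misses `t = 0` because the slice there is
    -- zero.
    refine ⟨{t | ε ≤ ‖slices f.toContinuousMap t‖}, ?_, ?_, ?_⟩
    · exact (isClosed_le continuous_const (continuous_slices _).norm).isCompact
    · intro t ht ht0
      have : slices f.toContinuousMap t = 0 := by
        ext x
        exact hf.2 (t, x) ht0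
      rw [mem_ofPred_eq, this, norm_zero] at ht
      exact absurd ht (not_le.2 hε)
    · intro t ht y
      rw [mem_ofPred_eq, not_le] at ht
      exact ((slices f.toContinuousMap t).norm_coe_le_norm y).trans ht.le
  · intro q _ y hy
    exact (hy ⟨y, rfl⟩).elim

/-- The inclusion of a set in its closure. -/
def closureInclusion {E : Type*} [TopologicalSpace E] (Ω : Set E) : C(Ω, closure Ω) :=
  ⟨inclusion subset_closure, continuous_inclusion subset_closure⟩

theorem range_closureInclusion {E : Type*} [TopologicalSpace E] (Ω : Set E) :
    range (closureInclusion Ω) = {y : closure Ω | (y : E) ∈ Ω} := by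
  ext y
  constructor
  · rintro ⟨x, rfl⟩
    exact x.2
  · intro hy
    exact ⟨⟨y, hy⟩, rfl⟩

theorem isOpenEmbedding_closureInclusion {E : Type*} [TopologicalSpace E] {Ω : Set E}
    (hΩ : IsOpen Ω) : IsOpenEmbedding (closureInclusion Ω) := by
  refine ⟨.inclusion subset_closure, ?_⟩
  rw [range_closureInclusion]
  exact hΩ.preimage continuous_subtype_val

theorem eq_zero_of_mem_spaceCBdry (hΩ : IsOpen Ω) {q : closure Ω →ᵇ ℝ} (hq : q ∈ spaceCBdry Ω)
    {y : closure Ω} (hy : (y : EuclideanSpace ℝ (Fin d)) ∉ Ω) : q y = 0 :=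
  hq y (by rw [mem_ofPred_eq, hΩ.frontier_eq]; exact ⟨y.2, hy⟩)

/-- Extension by zero makes an element of the space continuous on `(-∞,T]` times the compact closure
of `Ω`, where the approximation by products applies; the products are then read back on `Ω`. -/
theorem isTensor_spaceCInftyBdry (hΩ : IsRegularSet Ω) (T : ℝ) :
    IsTensor (closureInclusion Ω) (spaceCInfty T) (spaceCBdry Ω) (spaceCInftyBdry T Ω) := by
  have := hΩ.compactSpace_closure
  have : LocallyCompactSpace (Iic T) := isClosed_Iic.isClosedEmbedding_subtypeVal.locallyCompactSpace
  have hemb := isOpenEmbedding_closureInclusion hΩ.isOpen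
  have hemb2 : IsOpenEmbedding (Prod.map (id : Iic T → Iic T) (closureInclusion Ω)) :=
    IsOpenEmbedding.id.prodMap hemb
  have hext : ∀ (f : Iic T × Ω → ℝ) t x,
      Function.extend (Prod.map id (closureInclusion Ω)) f 0 (t, closureInclusion Ω x) =
        f (t, x) := fun f t x => hemb2.injective.extend_apply f 0 (t, x)
  have hext0 : ∀ (f : Iic T × Ω → ℝ) t (y : closure Ω),
      (y : EuclideanSpace ℝ (Fin d)) ∉ Ω →
      Function.extend (Prod.map id (closureInclusion Ω)) f 0 (t, y) = 0 := by
    intro f t y hy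
    refine Function.extend_apply' _ _ _ ?_
    rintro ⟨⟨t', x⟩, h⟩
    obtain ⟨-, h2⟩ := Prod.ext_iff.1 h
    have h3 : closureInclusion Ω x = y := h2
    exact hy (h3 ▸ x.2)
  have hslice : ∀ g : C(Iic T × closure Ω, ℝ),
      (∀ t, ∀ y : closure Ω, (y : EuclideanSpace ℝ (Fin d)) ∉ Ω → g (t, y) = 0) →
      ∀ t, slices g t ∈ spaceCBdry Ω := by
    intro g hg t y hy
    rw [mem_ofPred_eq, hΩ.isOpen.frontier_eq] at hy
    exact hg t y hy.2
  refine ⟨isClosed_vanishingAtInfinity _, isClosed_vanishingOn _,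
    isClosed_vanishingAtInfinity _, ?_, ?_, ?_, ?_, ?_⟩
  · intro f hf x
    refine ⟨f.compContinuous ⟨fun t => (t, x), by fun_prop⟩, ?_, fun t => rfl⟩
    have h : IsClosedEmbedding fun t : Iic T => (t, x) :=
      .of_continuous_injective_isClosedMap (by fun_prop) (fun a b h => (Prod.ext_iff.1 h).1)
        (isClosedMap_prodMk_right x)
    have hf' : Tendsto f (cocompact _) (𝓝 0) := hf
    exact hf'.comp h.tendsto_cocompact
  · intro f hf t
    exact ⟨slices ⟨_, continuous_extend_zero hemb2 f.continuous hf⟩ t,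
      hslice _ (fun t y hy => hext0 f t y hy) t, fun x => hext f t x⟩
  · intro p hp q hq
    have hqc : Tendsto (fun x => q (closureInclusion Ω x)) (cocompact Ω) (𝓝 0) := by
      rw [Metric.tendsto_nhds]
      intro ε hε
      refine mem_cocompact.2 ⟨closureInclusion Ω ⁻¹' {y | ε ≤ ‖q y‖}, ?_, fun x hx => ?_⟩
      · refine hemb.isInducing.isCompact_preimage' ?_ ?_
        · exact (isClosed_le continuous_const q.continuous.norm).isCompact
        · intro y hy
          rw [range_closureInclusion]
          by_contra h
          rw [mem_ofPred_eq, eq_zero_of_mem_spaceCBdry hΩ.isOpen hq h, norm_zero] at hy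
          exact absurd hy (not_le.2 hε)
      · rw [mem_ofPred_eq, dist_zero_right]
        exact not_le.1 hx
    change Tendsto (fun z : Iic T × Ω => p z.1 * q (closureInclusion Ω z.2)) _ _
    -- A point of the product leaves compact sets when one of its coordinates does; in either case
    -- one factor tends to `0` and the other is bounded.
    rw [← coprod_cocompact]
    refine Tendsto.sup ?_ ?_
    · refine Tendsto.zero_mul_isBoundedUnder_le (Tendsto.comp hp tendsto_comap) ?_
      exact isBoundedUnder_of ⟨‖q‖, fun z => q.norm_coe_le_norm _⟩
    · refine isBoundedUnder_le_mul_tendsto_zero ?_ (hqc.comp tendsto_comap)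
      exact isBoundedUnder_of ⟨‖p‖, fun z => p.norm_coe_le_norm _⟩
  · intro f hf
    refine mem_closure_productSpan _ (S₁ := spaceCInfty T) isOpen_univ
      (fun p hp _ => hp.is_zero_at_infty) ⟨_, continuous_extend_zero hemb2 f.continuous hf⟩
      (hslice _ fun t y hy => hext0 f t y hy) (fun ε hε => ?_) fun t x => (hext f t x).symm
    obtain ⟨K, hK, hKf⟩ := mem_cocompact.1 (Metric.tendsto_nhds.1 hf ε hε)
    refine ⟨Prod.fst '' K, hK.image continuous_fst, subset_univ _, fun t ht y => ?_⟩
    by_cases hy : (y : EuclideanSpace ℝ (Fin d)) ∈ Ω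
    · have h1 := hKf (a := (t, ⟨y, hy⟩)) fun h => ht ⟨_, h, rfl⟩
      have h2 := hext f t ⟨y, hy⟩
      rw [mem_ofPred_eq, dist_zero_right, ← h2] at h1
      exact h1.le
    · rw [ContinuousMap.coe_mk, hext0 f t y hy, abs_zero]
      exact hε.le
  · intro q hq y hy
    rw [range_closureInclusion] at hy
    exact eq_zero_of_mem_spaceCBdry hΩ.isOpen hq hy

end Spaces

/-! ### The Markov property of a Lévy process at a fixed time. -/

section Markov

theorem exists_monotone_enumeration {K : Finset ℝ≥0} (hK : K.Nonempty) :
    ∃ t : ℕ → ℝ≥0, Monotone t ∧ ∀ u ∈ K, ∃ k, t k = u := by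
  have hc : 0 < K.card := hK.card_pos
  -- Past the largest point of `K` the sequence stays constant, so it is defined and monotone on all
  -- of `ℕ`.
  refine ⟨fun i => K.orderEmbOfFin rfl ⟨min i (K.card - 1), by omega⟩, fun i j hij => ?_,
    fun u hu => ?_⟩
  · refine (K.orderEmbOfFin rfl).monotone ?_
    simp only [Fin.mk_le_mk]
    omega
  · have : u ∈ range (K.orderEmbOfFin rfl) := by
      rw [Finset.range_orderEmbOfFin]
      exact hu
    obtain ⟨⟨i, hi⟩, rfl⟩ := this
    have e : min i (K.card - 1) = i := by omega
    refine ⟨i, ?_⟩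
    simp only [e]

variable {𝓦 E : Type*} [MeasurableSpace 𝓦] [NormedAddCommGroup E] [MeasurableSpace E]
  [BorelSpace E] [SecondCountableTopology E] {X : ℝ≥0 → 𝓦 → E} {μ : Measure 𝓦}
  [IsProbabilityMeasure μ]

namespace IsLevyProcess

theorem measurable_process (hX : IsLevyProcess X μ) : Measurable fun ω q => X q ω :=
  measurable_pi_lambda _ hX.measurable

theorem measurable_past (hX : IsLevyProcess X μ) (s : ℝ≥0) :
    Measurable fun ω q => X (min q s) ω :=
  measurable_pi_lambda _ fun _ => hX.measurable _

theorem measurable_future (hX : IsLevyProcess X μ) (s : ℝ≥0) :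
    Measurable fun ω q => X (s + q) ω - X s ω :=
  measurable_pi_lambda _ fun _ => (hX.measurable _).sub (hX.measurable _)

/-- It suffices to treat finitely many past and future times. Along a common enumeration through `0`
and `s`, they are functions of two disjoint blocks of independent increments. -/
theorem indepFun_past_future (hX : IsLevyProcess X μ) (s : ℝ≥0) :
    IndepFun (fun ω q => X (min q s) ω) (fun ω q => X (s + q) ω - X s ω) μ := by
  classical
  refine Kernel.IndepFun.process_indepFun_process (fun q => hX.measurable _)
    (fun q => (hX.measurable _).sub (hX.measurable _)) fun I J => ?_
  obtain ⟨t, ht, htK⟩ := exists_monotone_enumeration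
    (K := insert 0 (insert s (I.image (min · s) ∪ J.image (s + ·)))) (Finset.insert_nonempty _ _)
  have ht0 : t 0 = 0 := by
    obtain ⟨k, hk⟩ := htK 0 (by simp)
    exact le_antisymm (hk ▸ ht (Nat.zero_le k)) zero_le
  obtain ⟨m, hm⟩ := htK s (by simp)
  -- An index beyond `m` whose time is at most `s` carries the time `s` itself, so `m` can replace
  -- it.
  have hI : ∀ i : I, ∃ k ≤ m, t k = min (i : ℝ≥0) s := by
    intro i
    obtain ⟨k, hk⟩ := htK (min (i : ℝ≥0) s) (by
      simp only [Finset.mem_insert, Finset.mem_union, Finset.mem_image]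
      exact Or.inr (Or.inr (Or.inl ⟨i, i.2, rfl⟩)))
    rcases le_total k m with h | h
    · exact ⟨k, h, hk⟩
    · refine ⟨m, le_rfl, le_antisymm ?_ ?_⟩
      · exact (ht h).trans hk.le
      · rw [hm]; exact min_le_right _ _
  have hJ : ∀ j : J, ∃ k, m ≤ k ∧ t k = s + j := by
    intro j
    obtain ⟨k, hk⟩ := htK (s + (j : ℝ≥0)) (by
      simp only [Finset.mem_insert, Finset.mem_union, Finset.mem_image]
      exact Or.inr (Or.inr (Or.inr ⟨j, j.2, rfl⟩)))
    rcases le_total m k with h | h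
    · exact ⟨k, h, hk⟩
    · refine ⟨m, le_rfl, le_antisymm ?_ ?_⟩
      · rw [hm]; exact le_self_add
      · exact hk.symm.le.trans (ht h)
  choose a ham hat using hI
  choose b hbm hbt using hJ
  obtain ⟨N, hN⟩ : ∃ N, ∀ j, b j ≤ N := ⟨Finset.univ.sup b, fun j => Finset.le_sup (Finset.mem_univ j)⟩
  have hind := (hX.indep.nat ht).indepFun_finset (Finset.range m) (Finset.Ico m N)
    (by
      rw [Finset.disjoint_left]
      intro i hi hi'
      simp only [Finset.mem_range, Finset.mem_Ico] at hi hi'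
      omega)
    (fun i => (hX.measurable _).sub (hX.measurable _))
  -- Partial sums of increments rebuild the values: from time `0`, where the process vanishes almost
  -- surely, for the past, and from index `m` for the future.
  have hcomp := hind.comp
    (φ := fun (y : Finset.range m → E) (i : I) =>
      ∑ j : Finset.range m, if (j : ℕ) < a i then y j else 0)
    (ψ := fun (y : Finset.Ico m N → E) (i : J) =>
      ∑ j : Finset.Ico m N, if (j : ℕ) < b i then y j else 0)
    (measurable_pi_lambda _ fun i => Finset.measurable_sum _ fun j _ => by
      split_ifs
      · exact measurable_pi_apply j
      · exact measurable_const)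
    (measurable_pi_lambda _ fun i => Finset.measurable_sum _ fun j _ => by
      split_ifs
      · exact measurable_pi_apply j
      · exact measurable_const)
  refine IndepFun.congr hcomp ?_ ?_
  · filter_upwards [hX.zero] with ω hω
    funext i
    simp only [Function.comp_apply]
    rw [Finset.sum_coe_sort (Finset.range m)
      (fun j => if j < a i then X (t (j + 1)) ω - X (t j) ω else 0), ← Finset.sum_filter]
    have : (Finset.range m).filter (· < a i) = Finset.range (a i) := by
      ext j
      have := ham i
      simp only [Finset.mem_filter, Finset.mem_range]
      omega
    rw [this, Finset.sum_range_sub (fun j => X (t j) ω), ht0, hω, sub_zero, hat]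
  · refine Eventually.of_forall fun ω => ?_
    funext i
    simp only [Function.comp_apply]
    rw [Finset.sum_coe_sort (Finset.Ico m N)
      (fun j => if j < b i then X (t (j + 1)) ω - X (t j) ω else 0), ← Finset.sum_filter]
    have : (Finset.Ico m N).filter (· < b i) = Finset.Ico m (b i) := by
      ext j
      have := hN i
      simp only [Finset.mem_filter, Finset.mem_Ico]
      omega
    rw [this, Finset.sum_Ico_sub (fun j => X (t j) ω) (hbm i), hbt, hm]

/-- Finite-dimensional laws determine the law. They are images of increment vectors that have
independent coordinates and, by stationarity, equal marginals. -/
theorem map_future (hX : IsLevyProcess X μ) (s : ℝ≥0) :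
    μ.map (fun ω q => X (s + q) ω - X s ω) = μ.map (fun ω q => X q ω) := by
  classical
  rw [map_eq_iff_forall_finset_map_restrict_eq (X := fun q ω => X (s + q) ω - X s ω)
    (Y := X) (hX.measurable_future s).aemeasurable hX.measurable_process.aemeasurable]
  intro J
  obtain ⟨t, ht, htK⟩ := exists_monotone_enumeration (K := insert 0 J) (Finset.insert_nonempty _ _)
  have ht0 : t 0 = 0 := by
    obtain ⟨k, hk⟩ := htK 0 (by simp)
    exact le_antisymm (hk ▸ ht (Nat.zero_le k)) zero_le
  have hJ : ∀ j : J, ∃ k, t k = j := fun j => htK j (by simp)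
  choose b hbt using hJ
  obtain ⟨N, hN⟩ : ∃ N, ∀ j, b j ≤ N := ⟨Finset.univ.sup b, fun j => Finset.le_sup (Finset.mem_univ j)⟩
  let φ : (Fin N → E) → J → E := fun y i => ∑ j : Fin N, if (j : ℕ) < b i then y j else 0
  have hφ : Measurable φ := measurable_pi_lambda _ fun i => Finset.measurable_sum _ fun j _ => by
    split_ifs
    · exact measurable_pi_apply j
    · exact measurable_const
  have hsum : ∀ (F : ℕ → E) (i : J), ∑ j : Fin N, (if (j : ℕ) < b i then F (j + 1) - F j else 0) =
      F (b i) - F 0 := by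
    intro F i
    rw [Fin.sum_univ_eq_sum_range (fun j => if j < b i then F (j + 1) - F j else 0),
      ← Finset.sum_filter]
    have : (Finset.range N).filter (· < b i) = Finset.range (b i) := by
      ext j
      have := hN i
      simp only [Finset.mem_filter, Finset.mem_range]
      omega
    rw [this, Finset.sum_range_sub]
  let U : 𝓦 → Fin N → E := fun ω i => X (t (i + 1)) ω - X (t i) ω
  let V : 𝓦 → Fin N → E := fun ω i => X (s + t (i + 1)) ω - X (s + t i) ω
  have hU : Measurable U := measurable_pi_lambda _ fun i => (hX.measurable _).sub (hX.measurable _)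
  have hV : Measurable V := measurable_pi_lambda _ fun i => (hX.measurable _).sub (hX.measurable _)
  have hUV : μ.map V = μ.map U := by
    have h1 := (hX.indep.nat ht).precomp (g := fun i : Fin N => (i : ℕ)) Fin.val_injective
    have h2 := (hX.indep.nat (t := fun i => s + t i) (fun i j hij => by
      exact add_le_add_right (ht hij) s)).precomp (g := fun i : Fin N => (i : ℕ)) Fin.val_injective
    have h1' := (iIndepFun_iff_map_fun_eq_pi_map
      (fun i => ((hX.measurable _).sub (hX.measurable _)).aemeasurable)).1 h1
    have h2' := (iIndepFun_iff_map_fun_eq_pi_map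
      (fun i => ((hX.measurable _).sub (hX.measurable _)).aemeasurable)).1 h2
    refine h2'.trans (Eq.trans ?_ h1'.symm)
    congr 1
    funext i
    obtain ⟨c, hc⟩ := le_iff_exists_add.1 (ht (Nat.le_succ (i : ℕ)))
    have e1 := hX.stationary (s + t i) c
    have e2 := hX.stationary (t i) c
    rw [add_assoc, ← hc] at e1
    rw [← hc] at e2
    exact e1.trans e2.symm
  have e1 : (fun ω => J.restrict fun q => X (s + q) ω - X s ω) = φ ∘ V := by
    funext ω i
    have := hsum (fun k => X (s + t k) ω) i
    simp only [Function.comp_apply, φ, V, Finset.restrict]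
    rw [this, hbt, ht0, add_zero]
  have e2 : (fun ω => J.restrict fun q => X q ω) =ᵐ[μ] φ ∘ U := by
    filter_upwards [hX.zero] with ω hω
    funext i
    have := hsum (fun k => X (t k) ω) i
    simp only [Function.comp_apply, φ, U, Finset.restrict]
    rw [this, hbt, ht0, hω, sub_zero]
  rw [e1, Measure.map_congr e2, ← Measure.map_map hφ hV, ← Measure.map_map hφ hU, hUV]

/-- The Markov property at a fixed time. -/
theorem integral_past_future (hX : IsLevyProcess X μ) (s : ℝ≥0)
    {Φ : (ℝ≥0 → E) → (ℝ≥0 → E) → ℝ} (hΦ : Measurable (Function.uncurry Φ)) {C : ℝ}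
    (hC : ∀ z w, |Φ z w| ≤ C) :
    ∫ ω, Φ (fun q => X (min q s) ω) (fun q => X (s + q) ω - X s ω) ∂μ =
      ∫ ω, ∫ ω', Φ (fun q => X (min q s) ω) (fun q => X q ω') ∂μ ∂μ := by
  have h1 := hX.measurable_past s
  have h2 := hX.measurable_future s
  have h3 := (indepFun_iff_map_prod_eq_prod_map_map h1.aemeasurable h2.aemeasurable).1
    (hX.indepFun_past_future s)
  rw [hX.map_future] at h3
  have := Measure.isProbabilityMeasure_map (μ := μ) hX.measurable_process.aemeasurable
  have := Measure.isProbabilityMeasure_map (μ := μ) h1.aemeasurable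
  calc _ = ∫ z, Function.uncurry Φ z ∂(μ.map fun ω =>
        ((fun q => X (min q s) ω), (fun q => X (s + q) ω - X s ω))) := by
        rw [integral_map (h1.prodMk h2).aemeasurable hΦ.aestronglyMeasurable]
        rfl
    _ = ∫ z, ∫ w, Φ z w ∂(μ.map fun ω q => X q ω) ∂(μ.map fun ω q => X (min q s) ω) := by
        rw [h3, integral_prod]
        · rfl
        · exact Integrable.of_bound hΦ.aestronglyMeasurable C (Eventually.of_forall fun z => hC _ _)
    _ = _ := by
        rw [integral_map h1.aemeasurable]
        · refine integral_congr_ae (Eventually.of_forall fun ω => ?_)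
          simp only
          rw [integral_map hX.measurable_process.aemeasurable]
          exact (hΦ.comp measurable_prodMk_left).aestronglyMeasurable
        · exact (hΦ.stronglyMeasurable.integral_prod_right').aestronglyMeasurable

omit [BorelSpace E] [SecondCountableTopology E] in
theorem tendsto_measureReal_of_eventually_notMem {ι : Type*} {A : ι → Set 𝓦} {l : Filter ι}
    [l.IsCountablyGenerated] (hA : ∀ s, MeasurableSet (A s))
    (h : ∀ᵐ ω ∂μ, ∀ᶠ s in l, ω ∉ A s) : Tendsto (fun s => μ.real (A s)) l (𝓝 0) := by
  have := tendsto_integral_filter_of_dominated_convergence (μ := μ) (l := l)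
    (F := fun s => (A s).indicator fun _ => (1 : ℝ)) (f := fun _ => 0) (fun _ => (1 : ℝ))
    (Eventually.of_forall fun s => (measurable_const.indicator (hA s)).aestronglyMeasurable)
    (Eventually.of_forall fun s => Eventually.of_forall fun ω => by
      by_cases hω : ω ∈ A s <;> simp [hω])
    (integrable_const _) (by
      filter_upwards [h] with ω hω
      refine tendsto_const_nhds.congr' ?_
      filter_upwards [hω] with s hs
      rw [indicator_of_notMem hs])
  simpa [integral_indicator_const, hA] using this

omit [IsProbabilityMeasure μ] [MeasurableSpace 𝓦] [MeasurableSpace E] [BorelSpace E]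
  [SecondCountableTopology E] in
theorem eventually_norm_lt {ω : 𝓦} (h0 : X 0 ω = 0) (hω : IsCadlagPath fun s => X s ω) {δ : ℝ}
    (hδ : 0 < δ) : ∀ᶠ s in 𝓝 (0 : ℝ≥0), ‖X s ω‖ < δ := by
  have h := (hω 0).1
  rw [Set.eq_univ_of_forall (s := Ici (0 : ℝ≥0)) fun t => mem_Ici.2 zero_le,
    continuousWithinAt_univ] at h
  have h1 : Tendsto (fun s => ‖X s ω‖) (𝓝 0) (𝓝 0) := by
    have := h.norm
    simpa [ContinuousAt, h0] using this
  exact h1.eventually_lt_const hδ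

theorem tendsto_measureReal_norm_ge (hX : IsLevyProcess X μ) {δ : ℝ} (hδ : 0 < δ) :
    Tendsto (fun s => μ.real {ω | δ ≤ ‖X s ω‖}) (𝓝[>] 0) (𝓝 0) := by
  refine tendsto_measureReal_of_eventually_notMem
    (fun s => measurableSet_le measurable_const (hX.measurable s).norm) ?_
  filter_upwards [hX.zero, hX.cadlag] with ω h0 hω
  filter_upwards [(eventually_norm_lt h0 hω hδ).filter_mono nhdsWithin_le_nhds] with s hs
  exact not_le.2 hs

end IsLevyProcess

end Markov

/-! ### The free, absorbed and killed time semigroups. -/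

section Subordinator

variable {𝓦 : Type*} [MeasurableSpace 𝓦] {X : ℝ≥0 → 𝓦 → ℝ} {μ : Measure 𝓦}
  [IsProbabilityMeasure μ]

theorem IsLevyProcess.integral_increment (hX : IsLevyProcess X μ) (s r : ℝ≥0) {Φ : ℝ → ℝ → ℝ}
    (hΦ : Measurable (Function.uncurry Φ)) {C : ℝ} (hC : ∀ z w, |Φ z w| ≤ C) :
    ∫ ω, Φ (X s ω) (X (s + r) ω - X s ω) ∂μ = ∫ ω, ∫ ω', Φ (X s ω) (X r ω') ∂μ ∂μ := by
  have hm : Measurable fun p : (ℝ≥0 → ℝ) × (ℝ≥0 → ℝ) => (p.1 s, p.2 r) := by fun_prop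
  have := hX.integral_past_future s (Φ := fun z w => Φ (z s) (w r)) (hΦ.comp hm)
    (fun z w => hC _ _)
  simpa using this

/-- Translation to the left by a subordinator, followed by a retraction `π` onto the state space. -/
theorem isSubFeller_retract (hX : IsLevyProcess X μ) (hpos : ∀ s, ∀ᵐ ω ∂μ, 0 ≤ X s ω)
    {I : Set ℝ} {S : Submodule ℝ (I →ᵇ ℝ)} {P : ℝ≥0 → (I → ℝ) → I → ℝ} {π : ℝ → I}
    (hπ : ∀ u v, |(π u : ℝ) - π v| ≤ |u - v|) (hπI : ∀ t : I, π t = t)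
    (hππ : ∀ t : I, ∀ a b : ℝ, 0 ≤ a → 0 ≤ b → π (π (t - a) - b) = π (t - a - b))
    (hP : ∀ s, ∀ f ∈ S, P s f = fun t : I => ∫ ω, f (π (t - X s ω)) ∂μ)
    (hS : ∀ f ∈ S, UniformContinuous f)
    (hmaps : ∀ s, ∀ f ∈ S, ∀ g : I →ᵇ ℝ, (∀ t : I, g t = ∫ ω, f (π (t - X s ω)) ∂μ) → g ∈ S) :
    IsSubFeller S P := by
  have hπc : Continuous π := by
    have : LipschitzWith 1 π := LipschitzWith.of_dist_le_mul fun u v => by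
      simpa [Subtype.dist_eq, Real.dist_eq] using hπ u v
    exact this.continuous
  have hmeas : ∀ (f : I →ᵇ ℝ) (t : I) s, Measurable fun ω => f (π (t - X s ω)) := fun f t s =>
    (f.continuous.comp hπc).measurable.comp (measurable_const.sub (hX.measurable s))
  have hint : ∀ (f : I →ᵇ ℝ) (t : I) s, Integrable (fun ω => f (π (t - X s ω))) μ := fun f t s =>
    Integrable.of_bound (hmeas f t s).aestronglyMeasurable ‖f‖
      (Eventually.of_forall fun ω => f.norm_coe_le_norm _)
  have hbound : ∀ (f : I →ᵇ ℝ) (t : I) s, |∫ ω, f (π (t - X s ω)) ∂μ| ≤ ‖f‖ := by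
    intro f t s
    have := norm_integral_le_of_norm_le_const (μ := μ) (f := fun ω => f (π (t - X s ω)))
      (Eventually.of_forall fun ω => f.norm_coe_le_norm _)
    simpa using this
  have hcont : ∀ (f : I →ᵇ ℝ) s, Continuous fun t : I => ∫ ω, f (π (t - X s ω)) ∂μ := by
    intro f s
    refine continuous_of_dominated (fun t => (hmeas f t s).aestronglyMeasurable)
      (fun t => Eventually.of_forall fun ω => f.norm_coe_le_norm _) (integrable_const ‖f‖)
      (Eventually.of_forall fun ω => ?_)
    exact f.continuous.comp (hπc.comp (by fun_prop))
  have hmaps' : ∀ s, ∀ f ∈ S, ∃ g ∈ S, ⇑g = P s f := by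
    intro s f hf
    refine ⟨BoundedContinuousFunction.ofNormedAddCommGroup _ (hcont f s) ‖f‖
      fun t => hbound f t s, hmaps s f hf _ fun t => rfl, ?_⟩
    rw [hP s f hf]
    rfl
  refine ⟨hmaps', ?_, ?_, ?_, ?_, ?_, ?_, ?_⟩
  · intro s f hf g hg
    rw [hP s _ (S.add_mem hf hg), hP s f hf, hP s g hg]
    funext t
    exact integral_add (hint f t s) (hint g t s)
  · intro s c f hf
    rw [hP s _ (S.smul_mem c hf), hP s f hf]
    funext t
    exact integral_const_mul c _
  · intro f hf
    rw [hP 0 f hf]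
    funext t
    have : (fun ω => f (π (t - X 0 ω))) =ᵐ[μ] fun _ => f t := by
      filter_upwards [hX.zero] with ω hω
      rw [hω, sub_zero, hπI]
    rw [integral_congr_ae this]
    simp
  · intro s r f hf
    obtain ⟨g, hg, hgP⟩ := hmaps' r f hf
    rw [← hgP, hP s g hg, hP (s + r) f hf]
    funext t
    -- The Markov property is used with both retractions in place; they merge into one afterwards,
    -- since both displacements are almost surely non-negative.
    have h1 := hX.integral_increment s r (Φ := fun x y => f (π (π (t - x) - y))) (C := ‖f‖)
      (by
        have : Continuous fun z : ℝ × ℝ => f (π (π (t - z.1) - z.2)) := by fun_prop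
        exact this.measurable) (fun z w => f.norm_coe_le_norm _)
    have h2 : ∀ ω, g (π (t - X s ω)) = ∫ ω', f (π (π (t - X s ω) - X r ω')) ∂μ := by
      intro ω
      rw [hgP, hP r f hf]
    simp_rw [h2]
    rw [← h1]
    refine integral_congr_ae ?_
    -- Positivity is known only for the values of the process; stationarity transfers it to the
    -- increment.
    have hinc : ∀ᵐ ω ∂μ, 0 ≤ X (s + r) ω - X s ω := by
      have hm1 : Measurable fun ω => X (s + r) ω - X s ω := (hX.measurable _).sub (hX.measurable _)
      have h3 : ∀ᵐ x ∂(μ.map (X r)), 0 ≤ x :=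
        (ae_map_iff (hX.measurable r).aemeasurable measurableSet_Ici).2 (hpos r)
      rw [← hX.stationary s r] at h3
      exact (ae_map_iff hm1.aemeasurable measurableSet_Ici).1 h3
    filter_upwards [hpos s, hinc] with ω hω hω'
    rw [hππ t _ _ hω hω']
    congr 2
    ring
  · intro s f hf t
    rw [hP s f hf]
    exact hbound f t s
  · intro s f hf h t
    rw [hP s f hf]
    exact integral_nonneg fun ω => h _
  · intro f hf
    rw [Metric.tendstoUniformly_iff]
    intro ε hε
    obtain ⟨δ, hδ, hfδ⟩ := Metric.uniformContinuous_iff.1 (hS f hf) (ε / 2) (by positivity)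
    have h1 := (hX.tendsto_measureReal_norm_ge hδ).const_mul (2 * ‖f‖)
    rw [mul_zero] at h1
    filter_upwards [h1.eventually_lt_const (half_pos hε)] with s hs t
    rw [dist_comm, dist_eq_norm, hP s f hf]
    have e1 : (∫ ω, f (π (t - X s ω)) ∂μ) - f t = ∫ ω, (f (π (t - X s ω)) - f t) ∂μ := by
      rw [integral_sub (hint f t s) (integrable_const _)]
      simp
    have hA : MeasurableSet {ω | δ ≤ ‖X s ω‖} :=
      measurableSet_le measurable_const (hX.measurable s).norm
    -- Uniform continuity controls small displacements independently of `t`; large ones have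
    -- probability tending to `0`.
    have e2 : ∀ ω, ‖f (π (t - X s ω)) - f t‖ ≤
        ε / 2 + {ω | δ ≤ ‖X s ω‖}.indicator (fun _ => 2 * ‖f‖) ω := by
      intro ω
      by_cases hω : δ ≤ ‖X s ω‖
      · rw [indicator_of_mem (by exact hω)]
        have := f.norm_coe_le_norm (π (t - X s ω))
        have := f.norm_coe_le_norm t
        have := norm_sub_le (f (π (t - X s ω))) (f t)
        linarith
      · rw [indicator_of_notMem (by exact hω), add_zero, ← dist_eq_norm]
        refine (hfδ ?_).le
        rw [Subtype.dist_eq, Real.dist_eq]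
        have := hπ (t - X s ω) t
        rw [hπI] at this
        rw [Real.norm_eq_abs, not_le] at hω
        refine this.trans_lt ?_
        rwa [sub_sub_cancel_left, abs_neg]
    simp only
    rw [e1]
    have h2 := norm_integral_le_of_norm_le (μ := μ)
      ((integrable_const (ε / 2)).add ((integrable_const (2 * ‖f‖)).indicator hA))
      (Eventually.of_forall e2)
    refine h2.trans_lt ?_
    simp only [Pi.add_apply]
    rw [integral_add (integrable_const _) ((integrable_const _).indicator hA),
      integral_indicator_const _ hA]
    simp only [integral_const, probReal_univ, smul_eq_mul, one_mul]
    linarith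

/-- Monotonicity rules out passage before a time at which the path is still below `t`, and
right-continuity keeps it below `t` a little longer, which makes the inequality strict. -/
theorem lt_passageTime_iff {ω : 𝓦} (hmono : Monotone fun s => X s ω)
    (hc : IsCadlagPath fun s => X s ω) (s : ℝ≥0) (t : ℝ) :
    (s : ℝ≥0∞) < passageTime X t ω ↔ X s ω < t := by
  constructor
  · intro h
    by_contra! hle
    -- Time `0` is excluded from the infimum; there monotonicity makes every positive time
    -- admissible.
    rcases eq_or_ne s 0 with rfl | hs
    · have : passageTime X t ω ≤ 0 := by
        refine ENNReal.le_of_forall_pos_le_add fun ε hε _ => ?_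
        rw [zero_add]
        refine iInf₂_le ε ⟨hε, ?_⟩
        have := hmono (zero_le (a := ε))
        simp only at this
        linarith
      simp only [ENNReal.coe_zero] at h
      exact absurd this (not_le.2 h)
    · have : passageTime X t ω ≤ s := iInf₂_le s ⟨pos_iff_ne_zero.2 hs, by linarith⟩
      exact absurd this (not_le.2 h)
  · intro h
    have h1 : ∀ᶠ r in 𝓝[≥] s, X r ω < t := (hc s).1.eventually_lt_const h
    obtain ⟨u, hu, hsub⟩ := (mem_nhdsGE_iff_exists_Ico_subset' (lt_add_one s)).1 h1
    refine lt_of_lt_of_le (ENNReal.coe_lt_coe.2 hu) ?_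
    refine le_iInf₂ fun r hr => ?_
    by_contra! hlt
    have hru : r < u := ENNReal.coe_lt_coe.1 hlt
    rcases le_total s r with hsr | hsr
    · have := hsub ⟨hsr, hru⟩
      simp only [mem_ofPred_eq] at this
      linarith [hr.2]
    · have := hmono hsr
      simp only at this
      linarith [hr.2]

variable {β : ℝ}

theorem IsStableSubordinator.nonneg (hX : IsStableSubordinator β X μ) (s : ℝ≥0) :
    ∀ᵐ ω ∂μ, 0 ≤ X s ω := by
  filter_upwards [hX.zero, hX.monotone] with ω h0 hm
  have := hm (zero_le (a := s))
  simp only [h0] at this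
  exact this

theorem zeroExt_coe {E : Type*} {A : Set E} (f : A → ℝ) (x : A) : zeroExt f (x : E) = f x :=
  Subtype.val_injective.extend_apply f 0 x

theorem zeroExt_of_notMem {E : Type*} {A : Set E} (f : A → ℝ) {x : E} (hx : x ∉ A) :
    zeroExt f x = 0 :=
  Function.extend_apply' _ _ _ fun ⟨a, ha⟩ => hx (ha ▸ a.2)

/-- Before passage `t - X_s` is positive and the projection fixes it; after passage it is at most
`0` and is sent to `0`. -/
theorem absorbedTime_eq (hX : IsStableSubordinator β X μ) {T : ℝ} (hT : 0 ≤ T) (s : ℝ≥0)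
    (f : Icc (0 : ℝ) T → ℝ) :
    absorbedTime X μ T s f = fun t : Icc (0 : ℝ) T => ∫ ω, f (projIcc 0 T hT (t - X s ω)) ∂μ := by
  funext t
  refine integral_congr_ae ?_
  filter_upwards [hX.monotone, hX.cadlag, hX.nonneg s] with ω hm hc hpos
  rw [absorbedPath]
  simp only [lt_passageTime_iff hm hc]
  rw [← zeroExt_coe f]
  congr 1
  rw [coe_projIcc, min_eq_right (by linarith [t.2.2])]
  split_ifs with h
  · rw [max_eq_right (by linarith)]
  · rw [max_eq_left (by linarith)]

/-- After passage the projected point is `0`, where `f` vanishes, so killing and absorbing give the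
same integrand. -/
theorem killedTime_eq (hX : IsStableSubordinator β X μ) {T : ℝ} (hT : 0 ≤ T) (s : ℝ≥0)
    {f : Icc (0 : ℝ) T → ℝ} (hf : ∀ t : Icc (0 : ℝ) T, (t : ℝ) = 0 → f t = 0) :
    killedTime X μ T s f = fun t : Icc (0 : ℝ) T => ∫ ω, f (projIcc 0 T hT (t - X s ω)) ∂μ := by
  funext t
  refine integral_congr_ae ?_
  filter_upwards [hX.monotone, hX.cadlag, hX.nonneg s] with ω hm hc hpos
  by_cases h : X s ω < t
  · rw [indicator_of_mem (by exact (lt_passageTime_iff hm hc s t).2 h), ← zeroExt_coe f]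
    congr 1
    rw [coe_projIcc, min_eq_right (by linarith [t.2.2]), max_eq_right (by linarith)]
  · rw [indicator_of_notMem (by
      rw [mem_ofPred_eq, lt_passageTime_iff hm hc]; exact h)]
    refine (hf _ ?_).symm
    rw [coe_projIcc, min_eq_right (by linarith [t.2.2]), max_eq_left (by linarith)]

theorem killedTime_eq_absorbedTime (hX : IsStableSubordinator β X μ) {T : ℝ} (hT : 0 ≤ T)
    (s : ℝ≥0) {f : Icc (0 : ℝ) T → ℝ} (hf : ∀ t : Icc (0 : ℝ) T, (t : ℝ) = 0 → f t = 0) :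
    killedTime X μ T s f = absorbedTime X μ T s f :=
  (killedTime_eq hX hT s hf).trans (absorbedTime_eq hX hT s f).symm

theorem freeTime_eq (hX : IsStableSubordinator β X μ) {T : ℝ} (s : ℝ≥0) (f : Iic T → ℝ) :
    freeTime X μ T s f = fun t : Iic T => ∫ ω, f (projIic T (t - X s ω)) ∂μ := by
  funext t
  refine integral_congr_ae ?_
  filter_upwards [hX.nonneg s] with ω hpos
  rw [← zeroExt_coe f]
  congr 1
  rw [coe_projIic, min_eq_right]
  have : (t : ℝ) ≤ T := t.2
  linarith

theorem abs_projIcc_sub_le {a b : ℝ} (h : a ≤ b) (u v : ℝ) :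
    |(projIcc a b h u : ℝ) - projIcc a b h v| ≤ |u - v| := by
  rw [coe_projIcc, coe_projIcc]
  exact (abs_max_sub_max_le_abs _ _ a |>.trans' (by rw [max_comm a, max_comm a])).trans
    ((abs_inf_sub_inf_le_abs u v b).trans' (by rw [min_comm b, min_comm b]))

theorem projIcc_sub_sub {T : ℝ} (hT : 0 ≤ T) (t : Icc (0 : ℝ) T) {a b : ℝ} (ha : 0 ≤ a)
    (hb : 0 ≤ b) :
    projIcc 0 T hT (projIcc 0 T hT (t - a) - b) = projIcc 0 T hT (t - a - b) := by
  have ht : (t : ℝ) ≤ T := t.2.2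
  ext
  rw [coe_projIcc, coe_projIcc, coe_projIcc, min_eq_right (by linarith : (t : ℝ) - a ≤ T),
    min_eq_right (by linarith : (t : ℝ) - a - b ≤ T)]
  rcases le_total (0 : ℝ) (t - a) with h | h
  · rw [max_eq_right h, min_eq_right (by linarith)]
  · rw [max_eq_left h, max_eq_left ((min_le_right _ _).trans (by linarith)),
      max_eq_left (by linarith)]

theorem isSubFeller_absorbedTime (hX : IsStableSubordinator β X μ) {T : ℝ} (hT : 0 ≤ T) :
    IsSubFeller (spaceC T) (absorbedTime X μ T) :=
  isSubFeller_retract hX.toIsLevyProcess hX.nonneg (π := projIcc 0 T hT) (abs_projIcc_sub_le hT)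
    (fun t => projIcc_val hT t) (fun t _ _ ha hb => projIcc_sub_sub hT t ha hb)
    (fun s f _ => absorbedTime_eq hX hT s f)
    (fun f _ => CompactSpace.uniformContinuous_of_continuous f.continuous)
    (fun _ _ _ _ _ => trivial)

theorem isSubFeller_killedTime (hX : IsStableSubordinator β X μ) {T : ℝ} (hT : 0 ≤ T) :
    IsSubFeller (spaceC0 T) (killedTime X μ T) :=
  isSubFeller_retract hX.toIsLevyProcess hX.nonneg (π := projIcc 0 T hT) (abs_projIcc_sub_le hT)
    (fun t => projIcc_val hT t) (fun t _ _ ha hb => projIcc_sub_sub hT t ha hb)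
    (fun s f hf => killedTime_eq hX hT s fun t ht => hf t ht)
    (fun f _ => CompactSpace.uniformContinuous_of_continuous f.continuous)
    (fun s f hf g hg t ht => by
      rw [mem_ofPred_eq] at ht
      rw [hg t]
      refine integral_eq_zero_of_ae ?_
      filter_upwards [hX.nonneg s] with ω hω
      refine hf _ ?_
      rw [mem_ofPred_eq, coe_projIcc, ht, max_eq_left]
      exact (min_le_right _ _).trans (by linarith))

theorem cocompact_Iic (T : ℝ) :
    cocompact (Iic T) = comap ((↑) : Iic T → ℝ) (cocompact ℝ) :=
  le_antisymm (isClosed_Iic.isClosedEmbedding_subtypeVal.tendsto_cocompact.le_comap)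
    (comap_cocompact_le continuous_subtype_val)

theorem isSubFeller_freeTime (hX : IsStableSubordinator β X μ) (T : ℝ) :
    IsSubFeller (spaceCInfty T) (freeTime X μ T) := by
  -- Dominated convergence is used below along the filter of complements of compact sets, which has
  -- to be countably generated.
  have hcg : (cocompact (Iic T)).IsCountablyGenerated := by
    rw [cocompact_Iic, cocompact_eq_atBot_atTop]
    infer_instance
  have hu : ∀ f ∈ spaceCInfty T, UniformContinuous f := fun f hf =>
    f.continuous.uniformContinuous_of_tendsto_cocompact hf
  have hc : Continuous (projIic T) := by
    have : Continuous fun x : ℝ => min T x := by fun_prop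
    exact this.subtype_mk _
  refine isSubFeller_retract hX.toIsLevyProcess hX.nonneg (π := projIic T) (fun u v => ?_)
    (fun t => ?_) (fun t a b ha hb => ?_) (fun s f _ => freeTime_eq hX s f) hu
    (fun s f hf g hg => ?_)
  · rw [coe_projIic, coe_projIic, min_comm T, min_comm T]
    exact abs_inf_sub_inf_le_abs u v T
  · ext
    rw [coe_projIic, min_eq_right t.2]
  · have ht : (t : ℝ) ≤ T := t.2
    ext
    rw [coe_projIic, coe_projIic, coe_projIic, min_eq_right (by linarith : (t : ℝ) - a ≤ T)]
  · have hf' : Tendsto f (cocompact (Iic T)) (𝓝 0) := hf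
    change Tendsto g (cocompact (Iic T)) (𝓝 0)
    have : ⇑g = fun t : Iic T => ∫ ω, f (projIic T (t - X s ω)) ∂μ := funext hg
    rw [this, ← integral_zero 𝓦 ℝ (μ := μ)]
    refine tendsto_integral_filter_of_dominated_convergence (fun _ => ‖f‖)
      (Eventually.of_forall fun t => ?_)
      (Eventually.of_forall fun t => Eventually.of_forall fun ω => f.norm_coe_le_norm _)
      (integrable_const _) ?_
    · exact ((f.continuous.comp hc).measurable.comp
        (measurable_const.sub (hX.measurable s))).aestronglyMeasurable
    · filter_upwards [hX.nonneg s] with ω hω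
      refine hf'.comp ?_
      nth_rewrite 2 [cocompact_Iic]
      rw [tendsto_comap_iff]
      have e : ((↑) : Iic T → ℝ) ∘ (fun t : Iic T => projIic T (t - X s ω)) =
          (Homeomorph.subRight (X s ω)) ∘ ((↑) : Iic T → ℝ) := by
        funext t
        have ht : (t : ℝ) ≤ T := t.2
        simp only [Function.comp_apply, coe_projIic]
        rw [min_eq_right (by linarith)]
        rfl
      rw [e]
      exact (Homeomorph.isClosedEmbedding _).tendsto_cocompact.comp
        isClosed_Iic.isClosedEmbedding_subtypeVal.tendsto_cocompact

end Subordinator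

/-! ### Integrable characteristic functions and absolute continuity. -/

section AbsolutelyContinuous

variable {V : Type*} [NormedAddCommGroup V] [InnerProductSpace ℝ V] [FiniteDimensional ℝ V]
  [MeasurableSpace V] [BorelSpace V]

theorem integrable_exp_neg_mul_norm_rpow [Nontrivial V] {r α : ℝ} (hr : 0 < r) (hα : 0 < α) :
    Integrable (fun k : V => Real.exp (-(r * ‖k‖ ^ α))) := by
  rw [integrable_fun_norm_addHaar volume (f := fun y : ℝ => Real.exp (-(r * y ^ α)))]
  have h := integrableOn_rpow_mul_exp_neg_mul_rpow
    (s := ((Module.finrank ℝ V - 1 : ℕ) : ℝ)) (by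
      have : (0 : ℝ) ≤ ((Module.finrank ℝ V - 1 : ℕ) : ℝ) := Nat.cast_nonneg _
      linarith) hα hr
  refine h.congr_fun (fun y hy => ?_) measurableSet_Ioi
  simp only [smul_eq_mul, Real.rpow_natCast, neg_mul]

/-- Write the Gaussian as the Fourier integral of a Gaussian and exchange integrals: the inner
integral becomes `charFun ν k` times a factor of modulus at most `1`. -/
theorem integral_exp_neg_norm_sub_sq_le {ν : Measure V} [IsProbabilityMeasure ν]
    (hν : Integrable (charFun ν)) (x : V) {t : ℝ} (ht : 0 < t) :
    ∫ y, Real.exp (-(‖y - x‖ ^ 2 / (4 * t))) ∂ν ≤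
      (t / Real.pi) ^ (Module.finrank ℝ V / 2 : ℝ) * ∫ k, ‖charFun ν k‖ := by
  set c : ℝ := (Real.pi / t) ^ (Module.finrank ℝ V / 2 : ℝ) with hc
  have hc0 : 0 < c := by positivity
  have hcinv : (t / Real.pi) ^ (Module.finrank ℝ V / 2 : ℝ) = c⁻¹ := by
    rw [hc, ← Real.inv_rpow (by positivity), inv_div]
  let F : V → V → ℂ := fun y k => Complex.exp (-(t : ℂ) * ‖k‖ ^ 2 + Complex.I * ⟪y - x, k⟫)
  have hF : ∀ y, ∫ k, F y k = ((c * Real.exp (-(‖y - x‖ ^ 2 / (4 * t))) : ℝ) : ℂ) := by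
    intro y
    rw [GaussianFourier.integral_cexp_neg_mul_sq_norm_add (by simpa using ht)]
    rw [hc, Complex.ofReal_mul, Complex.ofReal_cpow (by positivity), Complex.ofReal_exp]
    push_cast
    rw [Complex.I_sq]
    ring_nf
  have hnorm : ∀ y k, ‖F y k‖ = Real.exp (-t * ‖k‖ ^ 2) := by
    intro y k
    rw [Complex.norm_exp]
    simp [← Complex.ofReal_pow]
  have hg : Integrable (fun k : V => Real.exp (-t * ‖k‖ ^ 2)) := by
    have := (GaussianFourier.integrable_cexp_neg_mul_sq_norm_add (b := (t : ℂ)) (V := V)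
      (by simpa using ht) 0 0).norm
    refine this.congr (Eventually.of_forall fun k => ?_)
    simp only [Complex.norm_exp]
    simp [← Complex.ofReal_pow]
  have hFint : Integrable (Function.uncurry F) (ν.prod volume) := by
    refine (hg.comp_snd ν).mono' ?_ (Eventually.of_forall fun z => (hnorm _ _).le)
    have : Continuous (Function.uncurry F) := by
      simp only [F, Function.uncurry_def]
      fun_prop
    exact this.aestronglyMeasurable
  have hswap := integral_integral_swap hFint
  have hin : ∀ k, ‖∫ y, F y k ∂ν‖ ≤ ‖charFun ν k‖ := by
    intro k
    have : ∀ y, F y k = Complex.exp (-(t : ℂ) * ‖k‖ ^ 2 - Complex.I * ⟪x, k⟫) *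
        Complex.exp (⟪y, k⟫ * Complex.I) := by
      intro y
      rw [← Complex.exp_add]
      simp only [F, inner_sub_left]
      push_cast
      ring_nf
    simp_rw [this]
    rw [integral_const_mul, norm_mul, charFun_apply, Complex.norm_exp]
    refine mul_le_of_le_one_left (norm_nonneg _) (Real.exp_le_one_iff.2 ?_)
    simp [← Complex.ofReal_pow]
    positivity
  simp_rw [hF] at hswap
  rw [integral_complex_ofReal, integral_const_mul] at hswap
  rw [hcinv, ← div_eq_inv_mul, le_div_iff₀' hc0]
  calc _ ≤ ‖((c * ∫ y, Real.exp (-(‖y - x‖ ^ 2 / (4 * t))) ∂ν : ℝ) : ℂ)‖ := by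
        rw [Complex.norm_real]
        exact le_abs_self _
    _ ≤ ∫ k, ‖∫ y, F y k ∂ν‖ := by
        rw [hswap]
        exact norm_integral_le_integral_norm _
    _ ≤ _ := by
        refine integral_mono_of_nonneg (Eventually.of_forall fun k => norm_nonneg _) hν.norm
          (Eventually.of_forall hin)

/-- Gaussian averages bound the mass of a ball of radius `ρ` by a multiple of `ρ ^ n`, that is, of
its volume. The Besicovitch covering theorem passes this from balls to null sets. -/
theorem absolutelyContinuous_of_integrable_charFun {ν : Measure V} [IsProbabilityMeasure ν]
    (hν : Integrable (charFun ν)) : ν ≪ volume := by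
  set n := Module.finrank ℝ V
  set I := ∫ k, ‖charFun ν k‖
  have hI : 0 ≤ I := integral_nonneg fun k => norm_nonneg _
  set K : ℝ := Real.exp 1 * ((4 * Real.pi)⁻¹ ^ (n / 2 : ℝ) * I)
  have hK : 0 ≤ K := by positivity
  have h1 : ∀ x : V, ∀ ρ : ℝ, 0 < ρ → ν.real (Metric.closedBall x ρ) ≤ K * ρ ^ n := by
    intro x ρ hρ
    -- With this width the Gaussian is at least `e⁻¹` on the ball, which accounts for the factor
    -- `exp 1` in `K`.
    have h := integral_exp_neg_norm_sub_sq_le hν x (t := ρ ^ 2 / 4) (by positivity)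
    have e1 : (ρ ^ 2 / 4 / Real.pi) ^ (n / 2 : ℝ) = (4 * Real.pi)⁻¹ ^ (n / 2 : ℝ) * ρ ^ n := by
      rw [show ρ ^ 2 / 4 / Real.pi = (4 * Real.pi)⁻¹ * ρ ^ 2 by field_simp,
        Real.mul_rpow (by positivity) (by positivity), ← Real.rpow_natCast ρ 2,
        ← Real.rpow_mul hρ.le]
      congr 1
      rw [← Real.rpow_natCast]
      congr 1
      push_cast
      ring
    have h2 : Real.exp (-1) * ν.real (Metric.closedBall x ρ) ≤
        ∫ y, Real.exp (-(‖y - x‖ ^ 2 / (4 * (ρ ^ 2 / 4)))) ∂ν := by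
      have hint : Integrable (fun y => Real.exp (-(‖y - x‖ ^ 2 / (4 * (ρ ^ 2 / 4))))) ν := by
        refine Integrable.of_bound (C := 1) (by fun_prop) (Eventually.of_forall fun y => ?_)
        rw [Real.norm_eq_abs, Real.abs_exp, Real.exp_le_one_iff]
        have : 0 ≤ ‖y - x‖ ^ 2 / (4 * (ρ ^ 2 / 4)) := by positivity
        linarith
      rw [mul_comm, ← smul_eq_mul, ← integral_indicator_const _ Metric.isClosed_closedBall.measurableSet]
      refine integral_mono ((integrable_const _).indicator
        Metric.isClosed_closedBall.measurableSet) hint fun y => ?_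
      revert y
      refine indicator_le' (fun y hy => ?_) (fun y _ => (Real.exp_pos _).le)
      refine Real.exp_le_exp.2 (neg_le_neg ?_)
      rw [div_le_one (by positivity)]
      have : ‖y - x‖ ≤ ρ := by simpa [dist_eq_norm] using hy
      have := pow_le_pow_left₀ (norm_nonneg _) this 2
      linarith
    rw [e1] at h
    have h3 := h2.trans h
    rw [Real.exp_neg, ← div_eq_inv_mul, div_le_iff₀' (Real.exp_pos _)] at h3
    refine h3.trans (le_of_eq ?_)
    simp only [K, I]
    ring
  set b := volume.real (Metric.ball (0 : V) 1)
  have hb : 0 < b := by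
    refine ENNReal.toReal_pos (Metric.measure_ball_pos _ _ one_pos).ne' measure_ball_lt_top.ne
  have h2 : ∀ x : V, ∀ ρ : ℝ, 0 < ρ → ν (Metric.closedBall x ρ) ≤
      (ENNReal.ofReal (K / b) • (volume : Measure V)) (Metric.closedBall x ρ) := by
    intro x ρ hρ
    rw [Measure.smul_apply, smul_eq_mul, Measure.addHaar_closedBall volume _ hρ.le,
      ← ofReal_measureReal (μ := ν), ← ofReal_measureReal (μ := volume) measure_ball_lt_top.ne,
      ← ENNReal.ofReal_mul (by positivity), ← ENNReal.ofReal_mul (by positivity)]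
    refine ENNReal.ofReal_le_ofReal ((h1 x ρ hρ).trans (le_of_eq ?_))
    change K * ρ ^ n = K / b * (ρ ^ n * b)
    field_simp
  have : IsLocallyFiniteMeasure (ENNReal.ofReal (K / b) • (volume : Measure V)) := by
    exact (inferInstance : IsLocallyFiniteMeasure ((K / b).toNNReal • (volume : Measure V)))
  intro s hs
  have h3 := (Besicovitch.vitaliFamily ν).measure_le_of_frequently_le
    (ENNReal.ofReal (K / b) • (volume : Measure V)) Measure.AbsolutelyContinuous.rfl s
    (fun x _ => (Besicovitch.tendsto_filterAt ν x).frequently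
      (Eventually.frequently (eventually_nhdsWithin_of_forall fun ρ hρ => h2 x ρ hρ)))
  rw [Measure.smul_apply, hs, smul_zero] at h3
  exact le_antisymm h3 bot_le

/-- Translates of an absolutely continuous law depend continuously on the translation, when tested
against bounded measurable functions. -/
theorem continuous_integral_add_of_absolutelyContinuous {ν : Measure V} [IsFiniteMeasure ν]
    (hν : ν ≪ volume) {g : V → ℝ} (hg : Measurable g) {C : ℝ} (hC : ∀ z, |g z| ≤ C) :
    Continuous fun x => ∫ y, g (x + y) ∂ν := by
  have hC0 : 0 ≤ C := (abs_nonneg _).trans (hC 0)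
  set h : V → ℝ := fun y => (ν.rnDeriv volume y).toReal
  have hh : Integrable h := Measure.integrable_toReal_rnDeriv
  have hgi : ∀ (k : V → ℝ), Integrable k → ∀ x, Integrable fun y => k y * g (x + y) := by
    intro k hk x
    refine hk.mul_bdd (c := C) ?_ (Eventually.of_forall fun y => hC _)
    exact (hg.comp (measurable_const_add x)).aestronglyMeasurable
  -- For a continuous compactly supported density the integral is a convolution, hence continuous in
  -- `x`.
  have h1 : ∀ k : V → ℝ, Continuous k → HasCompactSupport k →
      Continuous fun x => ∫ y, k y * g (x + y) := by
    intro k hk hks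
    have hgl : LocallyIntegrable g := by
      refine (locallyIntegrable_const C).mono hg.aestronglyMeasurable
        (Eventually.of_forall fun z => ?_)
      rw [Real.norm_eq_abs, Real.norm_eq_abs, abs_of_nonneg hC0]
      exact hC z
    have hcont := HasCompactSupport.continuous_convolution_right (μ := (volume : Measure V))
      (ContinuousLinearMap.mul ℝ ℝ) (f := g) (g := fun u => k (-u))
      (hks.comp_homeomorph (Homeomorph.neg V)) hgl (by fun_prop)
    refine hcont.congr fun x => ?_
    rw [convolution_def]
    simp only [ContinuousLinearMap.mul_apply', neg_sub]
    rw [← integral_add_left_eq_self _ x]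
    simp [mul_comm]
  have h2 : ∀ n : ℕ, ∃ k : V → ℝ, HasCompactSupport k ∧ ∫ y, ‖h y - k y‖ ≤ 1 / ((n : ℝ) + 1) ∧
      Continuous k ∧ Integrable k := fun n =>
    hh.exists_hasCompactSupport_integral_sub_le Nat.one_div_pos_of_nat
  choose k hks hkn hkc hki using h2
  -- Approximating the density in `L¹` changes the integral by at most `C` times the `L¹` error,
  -- uniformly in `x`.
  have h3 : TendstoUniformly (fun n x => ∫ y, k n y * g (x + y)) (fun x => ∫ y, g (x + y) ∂ν)
      atTop := by
    rw [Metric.tendstoUniformly_iff]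
    intro ε hε
    have : Tendsto (fun n : ℕ => C * (1 / ((n : ℝ) + 1))) atTop (𝓝 0) := by
      simpa using tendsto_one_div_add_atTop_nhds_zero_nat.const_mul C
    filter_upwards [this.eventually_lt_const hε] with n hn x
    refine lt_of_le_of_lt ?_ hn
    rw [← integral_rnDeriv_smul hν, dist_eq_norm]
    simp only [smul_eq_mul]
    rw [← integral_sub (hgi h hh x) (hgi _ (hki n) x)]
    refine (norm_integral_le_integral_norm _).trans ?_
    refine le_trans ?_ (mul_le_mul_of_nonneg_left (hkn n) hC0)
    rw [← integral_const_mul]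
    refine integral_mono ((hgi h hh x).sub (hgi _ (hki n) x)).norm
      ((hh.sub (hki n)).norm.const_mul C) fun y => ?_
    simp only
    rw [← sub_mul, norm_mul, mul_comm]
    exact mul_le_mul_of_nonneg_right (hC _) (norm_nonneg _)
  exact h3.continuous (Eventually.of_forall fun n => h1 _ (hkc n) (hks n)).frequently

end AbsolutelyContinuous

/-! ### Density, scaling and rotation invariance of the stable law. -/

section Law

variable {𝓦 : Type*} [MeasurableSpace 𝓦] {d : ℕ} {α : ℝ}
  {Y : ℝ≥0 → 𝓦 → EuclideanSpace ℝ (Fin d)} {μ : Measure 𝓦} [IsProbabilityMeasure μ]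

namespace IsRotSymStable

theorem absolutelyContinuous (hd : 1 ≤ d) (hα : 0 < α) (hY : IsRotSymStable α Y μ) {r : ℝ≥0}
    (hr : 0 < r) : μ.map (Y r) ≪ volume := by
  have : Nonempty (Fin d) := ⟨⟨0, hd⟩⟩
  have : IsProbabilityMeasure (μ.map (Y r)) :=
    Measure.isProbabilityMeasure_map (hY.measurable r).aemeasurable
  refine absolutelyContinuous_of_integrable_charFun ?_
  rw [funext (hY.charFun_eq r)]
  exact (integrable_exp_neg_mul_norm_rpow (by exact_mod_cast hr) hα).ofReal

theorem continuous_integral_add (hd : 1 ≤ d) (hα : 0 < α) (hY : IsRotSymStable α Y μ) {r : ℝ≥0}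
    (hr : 0 < r) {g : EuclideanSpace ℝ (Fin d) → ℝ} (hg : Measurable g) {C : ℝ}
    (hC : ∀ z, |g z| ≤ C) : Continuous fun x => ∫ ω, g (x + Y r ω) ∂μ := by
  have : IsProbabilityMeasure (μ.map (Y r)) :=
    Measure.isProbabilityMeasure_map (hY.measurable r).aemeasurable
  refine (continuous_integral_add_of_absolutelyContinuous (hY.absolutelyContinuous hd hα hr) hg
    hC).congr fun x => ?_
  rw [integral_map (hY.measurable r).aemeasurable]
  exact (hg.comp (measurable_const_add x)).aestronglyMeasurable

theorem map_eq_map_smul (hα : 0 < α) (hY : IsRotSymStable α Y μ) (s : ℝ≥0) :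
    μ.map (Y s) = μ.map fun ω => ((s : ℝ) ^ α⁻¹) • Y 1 ω := by
  have hm : Measurable fun ω => ((s : ℝ) ^ α⁻¹) • Y 1 ω :=
    (hY.measurable 1).const_smul ((s : ℝ) ^ α⁻¹)
  have := Measure.isProbabilityMeasure_map (μ := μ) (hY.measurable s).aemeasurable
  have := Measure.isProbabilityMeasure_map (μ := μ) hm.aemeasurable
  refine Measure.ext_of_charFun (funext fun k => ?_)
  rw [charFun_map_smul_comp (hY.measurable 1).aemeasurable, hY.charFun_eq, hY.charFun_eq, norm_smul,
    Real.mul_rpow (norm_nonneg _) (norm_nonneg _), Real.norm_eq_abs,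
    abs_of_nonneg (by positivity), ← Real.rpow_mul (NNReal.coe_nonneg s), inv_mul_cancel₀ hα.ne',
    Real.rpow_one]
  simp

theorem map_linearIsometryEquiv (hY : IsRotSymStable α Y μ) (s : ℝ≥0)
    (R : EuclideanSpace ℝ (Fin d) ≃ₗᵢ[ℝ] EuclideanSpace ℝ (Fin d)) :
    μ.map (fun ω => R (Y s ω)) = μ.map (Y s) := by
  have hm : Measurable fun ω => R (Y s ω) := R.continuous.measurable.comp (hY.measurable s)
  have := Measure.isProbabilityMeasure_map (μ := μ) (hY.measurable s).aemeasurable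
  have := Measure.isProbabilityMeasure_map (μ := μ) hm.aemeasurable
  refine Measure.ext_of_charFun (funext fun k => ?_)
  have : charFun (μ.map fun ω => R (Y s ω)) k = charFun (μ.map (Y s)) (R.symm k) := by
    rw [charFun_apply, charFun_apply, integral_map hm.aemeasurable (by fun_prop),
      integral_map (hY.measurable s).aemeasurable (by fun_prop)]
    refine integral_congr_ae (Eventually.of_forall fun ω => ?_)
    simp only
    rw [← R.inner_map_map (Y s ω) (R.symm k), R.apply_symm_apply]
  rw [this, hY.charFun_eq, hY.charFun_eq, R.symm.norm_map]

/-- An open cone around any direction is charged by the law of the process at time `1`. -/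
theorem measure_cone_pos (hd : 1 ≤ d) (hα : 0 < α) (hY : IsRotSymStable α Y μ)
    {e : EuclideanSpace ℝ (Fin d)} (he : ‖e‖ = 1) {c : ℝ} (hc : c < 1) :
    0 < μ {ω | ‖Y 1 ω‖ * c < ⟪Y 1 ω, e⟫} := by
  rw [pos_iff_ne_zero]
  intro h0
  let G : EuclideanSpace ℝ (Fin d) → Set (EuclideanSpace ℝ (Fin d)) := fun v => {w | ‖w‖ * c < ⟪w, v⟫}
  have hG : ∀ v, MeasurableSet (G v) := fun v =>
    (isOpen_lt (by fun_prop) (by fun_prop)).measurableSet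
  -- A reflection carries `e` to `v`, so by rotation invariance all these cones are null as soon as
  -- one is.
  have h1 : ∀ v, ‖v‖ = 1 → μ {ω | Y 1 ω ∈ G v} = 0 := by
    intro v hv
    set R := (Submodule.reflection (ℝ ∙ (e - v))ᗮ)
    have hR : R e = v := Submodule.reflection_sub (he.trans hv.symm)
    have hm : Measurable fun ω => R (Y 1 ω) := R.continuous.measurable.comp (hY.measurable 1)
    have e1 := congrArg (fun m : Measure _ => m (G v)) (hY.map_linearIsometryEquiv 1 R)
    rw [Measure.map_apply hm (hG v), Measure.map_apply (hY.measurable 1) (hG v)] at e1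
    refine Eq.trans e1.symm (Eq.trans (congrArg μ ?_) h0)
    ext ω
    change ‖R (Y 1 ω)‖ * c < ⟪R (Y 1 ω), v⟫ ↔ _
    rw [← hR, R.inner_map_map, R.norm_map]
    rfl
  -- Countably many cones cover all nonzero vectors. If they were null, `Y 1` would vanish almost
  -- surely, against absolute continuity.
  obtain ⟨S, hSc, hS⟩ := TopologicalSpace.isOpen_iUnion_countable
    (fun v : Metric.sphere (0 : EuclideanSpace ℝ (Fin d)) 1 => G v)
    (fun v => isOpen_lt (by fun_prop) (by fun_prop))
  have h2 : ∀ w : EuclideanSpace ℝ (Fin d), w ≠ 0 → w ∈ ⋃ v ∈ S, G v := by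
    intro w hw
    rw [hS]
    have hw' : 0 < ‖w‖ := norm_pos_iff.2 hw
    refine mem_iUnion.2 ⟨⟨‖w‖⁻¹ • w, by simp [norm_smul, hw'.ne']⟩, ?_⟩
    change ‖w‖ * c < ⟪w, ‖w‖⁻¹ • w⟫
    rw [inner_smul_right, real_inner_self_eq_norm_sq]
    field_simp
    exact hc
  have h3 : μ {ω | Y 1 ω = 0} = 0 := by
    have : Nonempty (Fin d) := ⟨⟨0, hd⟩⟩
    have := hY.absolutelyContinuous hd hα one_pos (s := {0}) (measure_singleton _)
    rwa [Measure.map_apply (hY.measurable 1) (measurableSet_singleton _)] at this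
  have h4 : μ (⋃ v ∈ S, {ω | Y 1 ω ∈ G v}) = 0 :=
    (measure_biUnion_null_iff hSc).2 fun v _ => h1 v (by simp)
  have h5 : (univ : Set 𝓦) ⊆ {ω | Y 1 ω = 0} ∪ ⋃ v ∈ S, {ω | Y 1 ω ∈ G v} := by
    intro ω _
    by_cases h : Y 1 ω = 0
    · exact Or.inl h
    · have := h2 _ h
      simp only [mem_iUnion] at this ⊢
      exact Or.inr (by simpa using this)
  have h6 := measure_mono_null h5 (measure_union_null h3 h4)
  simp at h6

end IsRotSymStable

end Law

/-! ### Immediate visits to cones. -/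

section Cone

variable {𝓦 : Type*} [MeasurableSpace 𝓦] {d : ℕ} {α : ℝ}
  {Y : ℝ≥0 → 𝓦 → EuclideanSpace ℝ (Fin d)} {μ : Measure 𝓦} [IsProbabilityMeasure μ]

namespace IsRotSymStable

theorem measureReal_increment (hα : 0 < α) (hY : IsRotSymStable α Y μ) (s : ℝ≥0) {h : ℝ≥0}
    (hh : 0 < h) {A : Set (EuclideanSpace ℝ (Fin d))} (hA : MeasurableSet A) :
    μ.real {ω | ((h : ℝ) ^ α⁻¹)⁻¹ • (Y (s + h) ω - Y s ω) ∈ A} = μ.real {ω | Y 1 ω ∈ A} := by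
  set c := (h : ℝ) ^ α⁻¹
  have hc : 0 < c := Real.rpow_pos_of_pos (by exact_mod_cast hh) _
  have hB : MeasurableSet {w : EuclideanSpace ℝ (Fin d) | c⁻¹ • w ∈ A} := measurable_const_smul c⁻¹ hA
  have e := congrArg (fun m : Measure _ => m.real {w : EuclideanSpace ℝ (Fin d) | c⁻¹ • w ∈ A})
    ((hY.stationary s h).trans (hY.map_eq_map_smul hα h))
  have hm : Measurable fun ω => c • Y 1 ω := (hY.measurable 1).const_smul c
  have hm' : Measurable fun ω => Y (s + h) ω - Y s ω :=
    (hY.measurable (s + h)).sub (hY.measurable s)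
  rw [map_measureReal_apply hm' hB, map_measureReal_apply hm hB] at e
  refine e.trans (congrArg μ.real ?_)
  ext ω
  simp [smul_smul, hc.ne']

theorem measureReal_scaled (hα : 0 < α) (hY : IsRotSymStable α Y μ) {h : ℝ≥0}
    (hh : 0 < h) {A : Set (EuclideanSpace ℝ (Fin d))} (hA : MeasurableSet A) :
    μ.real {ω | ((h : ℝ) ^ α⁻¹)⁻¹ • Y h ω ∈ A} = μ.real {ω | Y 1 ω ∈ A} := by
  rw [← hY.measureReal_increment hα 0 hh hA]
  refine measureReal_congr ?_
  filter_upwards [hY.zero] with ω hω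
  change (_ • _ ∈ A) = (_ • _ ∈ A)
  simp [hω]

/-- Sample at times `t_k = τ (1 + b)^k`. By scaling, the increment after `t_k` has size of order
`s_k = m t_k^{1/α}`, which for large `m` dominates `Y_{t_k}`. If `|Y_{t_k}| < ε s_k` and the
normalized increment lies in the truncated cone `K`, then `Y_{t_{k+1}}` lies in the cone. The first
event fails for some `k` with probability at most `N P(|Y_1| ≥ ε m)`; the second fails for all `k`
with probability `(1 - P(Y_1 ∈ K))^N` by independence. A small `τ` keeps the times below `δ` and the
positions below height `h`. -/
theorem measureReal_avoid_cone_le (hα : 0 < α) (hY : IsRotSymStable α Y μ)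
    {e : EuclideanSpace ℝ (Fin d)} (he : ‖e‖ = 1) {c : ℝ} (hc0 : 0 ≤ c) (hc : c ≤ 1) {h : ℝ}
    (hh : 0 < h) {δ : ℝ≥0} (hδ : 0 < δ) {ε R : ℝ} (hε : 0 < ε) (N : ℕ) {m : ℝ} (hm : 0 < m) :
    μ.real {ω | ∀ u, 0 < u → u < δ → ¬(‖Y u ω‖ * c < ⟪Y u ω, e⟫ ∧ ⟪Y u ω, e⟫ < h)} ≤
      N * μ.real {ω | ε * m ≤ ‖Y 1 ω‖} +
        (1 - μ.real {ω | ‖Y 1 ω‖ < R ∧ ‖Y 1 ω‖ * c + 2 * ε < ⟪Y 1 ω, e⟫}) ^ N := by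
  set K : Set (EuclideanSpace ℝ (Fin d)) := {w | ‖w‖ < R ∧ ‖w‖ * c + 2 * ε < ⟪w, e⟫}
  have hK : MeasurableSet K := by
    have h1 : IsOpen {w : EuclideanSpace ℝ (Fin d) | ‖w‖ < R} := isOpen_lt (by fun_prop) (by fun_prop)
    have h2 : IsOpen {w : EuclideanSpace ℝ (Fin d) | ‖w‖ * c + 2 * ε < ⟪w, e⟫} :=
      isOpen_lt (by fun_prop) (by fun_prop)
    exact (h1.inter h2).measurableSet
  -- Chosen so that `b ^ (1/α) = m`: the increment over a time `t_k b` is `m` times as large as the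
  -- process at time `t_k`.
  set b : ℝ≥0 := ⟨m ^ α, by positivity⟩
  have hb : 0 < b := by
    have : 0 < m ^ α := by positivity
    exact this
  have hbm : (b : ℝ) ^ α⁻¹ = m := Real.rpow_rpow_inv hm.le hα.ne'
  -- the times grow geometrically
  obtain ⟨τ, hτ, hτδ, hτh⟩ : ∃ τ : ℝ≥0, 0 < τ ∧ τ * (1 + b) ^ N < δ ∧
      ((τ * (1 + b) ^ N : ℝ≥0) : ℝ) ^ α⁻¹ * (R + ε) < h := by
    have h1 : Tendsto (fun τ : ℝ≥0 => τ * (1 + b) ^ N) (𝓝[>] 0) (𝓝 0) := by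
      have : Continuous fun τ : ℝ≥0 => τ * (1 + b) ^ N := by fun_prop
      simpa using (this.tendsto 0).mono_left nhdsWithin_le_nhds
    have h2 : Tendsto (fun τ : ℝ≥0 => ((τ * (1 + b) ^ N : ℝ≥0) : ℝ) ^ α⁻¹ * (R + ε)) (𝓝[>] 0)
        (𝓝 0) := by
      have h3 : Continuous fun x : ℝ≥0 => (x : ℝ) ^ α⁻¹ * (R + ε) :=
        ((Real.continuous_rpow_const (inv_nonneg.2 hα.le)).comp
          NNReal.continuous_coe).mul continuous_const
      have h4 := (h3.tendsto 0).comp h1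
      simpa [Real.zero_rpow (inv_ne_zero hα.ne'), Function.comp_def] using h4
    obtain ⟨τ, h5, h6, h7⟩ := ((h1.eventually_lt_const hδ).and
      ((h2.eventually_lt_const hh).and self_mem_nhdsWithin)).exists
    exact ⟨τ, h7, h5, h6⟩
  set t : ℕ → ℝ≥0 := fun k => τ * (1 + b) ^ k
  have hb1 : (1 : ℝ≥0) ≤ 1 + b := le_self_add
  have ht : Monotone t := fun i j hij => mul_le_mul_right (pow_le_pow_right₀ hb1 hij) τ
  have ht0 : ∀ k, 0 < t k := fun k => mul_pos hτ (pow_pos (lt_of_lt_of_le one_pos hb1) k)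
  have hts : ∀ k, t (k + 1) = t k + t k * b := fun k => by simp only [t]; ring
  set s : ℕ → ℝ := fun k => ((t k * b : ℝ≥0) : ℝ) ^ α⁻¹
  have hs : ∀ k, s k = ((t k : ℝ≥0) : ℝ) ^ α⁻¹ * m := fun k => by
    simp only [s, NNReal.coe_mul]
    rw [Real.mul_rpow (NNReal.coe_nonneg _) (NNReal.coe_nonneg _), hbm]
  have hs0 : ∀ k, 0 < s k := fun k => by
    rw [hs]
    have : (0 : ℝ) < t k := ht0 k
    positivity
  set D : ℕ → Set 𝓦 := fun k => {ω | (s k)⁻¹ • (Y (t (k + 1)) ω - Y (t k) ω) ∈ K}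
  set B : ℕ → Set 𝓦 := fun k => {ω | ε * s k ≤ ‖Y (t k) ω‖}
  have hsub : {ω | ∀ u, 0 < u → u < δ → ¬(‖Y u ω‖ * c < ⟪Y u ω, e⟫ ∧ ⟪Y u ω, e⟫ < h)} ⊆
      (⋃ k ∈ Finset.range N, B k) ∪ ⋂ k ∈ Finset.range N, (D k)ᶜ := by
    intro ω hω
    by_contra hcon
    simp only [mem_union, mem_iUnion, mem_iInter, not_or, not_exists, not_forall,
      Finset.mem_range] at hcon
    obtain ⟨hB, k, hk, hD⟩ := hcon
    rw [notMem_compl_iff] at hD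
    have hBk : ‖Y (t k) ω‖ < ε * s k := not_le.1 (hB k hk)
    have htk : t (k + 1) ≤ t N := ht hk
    refine hω (t (k + 1)) (ht0 _) (htk.trans_lt hτδ) ?_
    set a := Y (t k) ω
    set v := (s k)⁻¹ • (Y (t (k + 1)) ω - a)
    have hv : Y (t (k + 1)) ω = a + s k • v := by
      simp only [v]
      rw [smul_inv_smul₀ (hs0 k).ne']
      abel
    have h1 : ‖v‖ < R := hD.1
    have h2 : ‖v‖ * c + 2 * ε < ⟪v, e⟫ := hD.2
    have h3 : -‖a‖ ≤ ⟪a, e⟫ := by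
      have := abs_real_inner_le_norm a e
      rw [he, mul_one] at this
      exact (abs_le.1 this).1
    have h4 : ‖a + s k • v‖ ≤ ‖a‖ + s k * ‖v‖ := by
      refine (norm_add_le _ _).trans ?_
      rw [norm_smul, Real.norm_eq_abs, abs_of_pos (hs0 k)]
    have h5 : ⟪a + s k • v, e⟫ ≤ ‖a + s k • v‖ := by
      have := real_inner_le_norm (a + s k • v) e
      rwa [he, mul_one] at this
    rw [hv]
    refine ⟨?_, ?_⟩
    -- The margin `2 * ε` pays for `a` twice: once in the inner product and once in the norm.
    · rw [inner_add_left, real_inner_smul_left]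
      have h6 := mul_lt_mul_of_pos_left h2 (hs0 k)
      have h7 := mul_le_mul_of_nonneg_right h4 hc0
      have h8 : ‖a‖ * c ≤ ‖a‖ := mul_le_of_le_one_right (norm_nonneg _) hc
      nlinarith
    · refine h5.trans_lt (h4.trans_lt (lt_of_le_of_lt ?_ hτh))
      have h6 : s k ≤ ((t N : ℝ≥0) : ℝ) ^ α⁻¹ := by
        refine Real.rpow_le_rpow (NNReal.coe_nonneg _) (NNReal.coe_le_coe.2 ?_)
          (inv_nonneg.2 hα.le)
        rw [hts] at htk
        exact le_add_self.trans htk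
      have h7 : s k * ‖v‖ ≤ s k * R := mul_le_mul_of_nonneg_left h1.le (hs0 k).le
      have hR : 0 < R := (norm_nonneg _).trans_lt h1
      have h8 : s k * (R + ε) ≤ ((t N : ℝ≥0) : ℝ) ^ α⁻¹ * (R + ε) :=
        mul_le_mul_of_nonneg_right h6 (by positivity)
      linarith
  refine (measureReal_mono hsub).trans ((measureReal_union_le _ _).trans (add_le_add ?_ ?_))
  · refine (measureReal_biUnion_finset_le _ _).trans (le_of_eq ?_)
    have : ∀ k ∈ Finset.range N, μ.real (B k) = μ.real {ω | ε * m ≤ ‖Y 1 ω‖} := by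
      intro k _
      have := hY.measureReal_scaled hα (ht0 k) (A := {w | ε * m ≤ ‖w‖})
        (isClosed_le (by fun_prop) (by fun_prop)).measurableSet
      refine Eq.trans (congrArg μ.real ?_) this
      ext ω
      have h1 : 0 < ((t k : ℝ≥0) : ℝ) ^ α⁻¹ := Real.rpow_pos_of_pos (ht0 k) _
      change ε * s k ≤ ‖Y (t k) ω‖ ↔ ε * m ≤ ‖(((t k : ℝ≥0) : ℝ) ^ α⁻¹)⁻¹ • Y (t k) ω‖
      rw [norm_smul, norm_inv, Real.norm_eq_abs, abs_of_pos h1, ← div_eq_inv_mul, le_div_iff₀ h1, hs,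
        mul_assoc, mul_comm m]
    rw [Finset.sum_congr rfl this]
    simp
  · have hind := (hY.indep.nat ht).meas_biInter (S := Finset.range N)
      (s := fun k => (D k)ᶜ) (fun k _ => ⟨{w | (s k)⁻¹ • w ∈ Kᶜ},
        measurable_const_smul (s k)⁻¹ hK.compl, rfl⟩)
    have hDm : ∀ k, MeasurableSet (D k) := fun k =>
      (((hY.measurable (t (k + 1))).sub (hY.measurable (t k))).const_smul (s k)⁻¹) hK
    rw [measureReal_def, hind, ENNReal.toReal_prod]
    have : ∀ k ∈ Finset.range N, (μ (D k)ᶜ).toReal = 1 - μ.real {ω | Y 1 ω ∈ K} := by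
      intro k _
      rw [← measureReal_def, probReal_compl_eq_one_sub (hDm k)]
      have := hY.measureReal_increment hα (t k) (mul_pos (ht0 k) hb) hK
      rw [← hts] at this
      rw [← this]
    rw [Finset.prod_congr rfl this]
    simp
    rfl

/-- The process immediately visits every finite open cone with vertex at its starting point. -/
theorem measure_avoid_cone_eq_zero (hd : 1 ≤ d) (hα : 0 < α) (hY : IsRotSymStable α Y μ)
    {e : EuclideanSpace ℝ (Fin d)} (he : ‖e‖ = 1) {c : ℝ} (hc0 : 0 ≤ c) (hc : c < 1) {h : ℝ}
    (hh : 0 < h) {δ : ℝ≥0} (hδ : 0 < δ) :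
    μ {ω | ∀ u, 0 < u → u < δ → ¬(‖Y u ω‖ * c < ⟪Y u ω, e⟫ ∧ ⟪Y u ω, e⟫ < h)} = 0 := by
  -- These truncated cones exhaust the open cone, which has positive probability, so one of them has
  -- positive probability too.
  let K : ℕ → Set 𝓦 := fun n => {ω | ‖Y 1 ω‖ < n ∧ ‖Y 1 ω‖ * c + 2 * (1 / ((n : ℝ) + 1)) < ⟪Y 1 ω, e⟫}
  obtain ⟨n, hn⟩ : ∃ n, 0 < μ (K n) := by
    by_contra hcon
    have h0 : μ (⋃ n, K n) = 0 := measure_iUnion_null fun n => by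
      simpa using not_exists.1 hcon n
    refine (hY.measure_cone_pos hd hα he hc).ne' (measure_mono_null (fun ω hω => ?_) h0)
    have h1 : Tendsto (fun n : ℕ => ‖Y 1 ω‖ * c + 2 * (1 / ((n : ℝ) + 1))) atTop
        (𝓝 (‖Y 1 ω‖ * c + 2 * 0)) :=
      tendsto_const_nhds.add (tendsto_one_div_add_atTop_nhds_zero_nat.const_mul 2)
    rw [mul_zero, add_zero] at h1
    obtain ⟨n, h2, h3⟩ := ((tendsto_natCast_atTop_atTop.eventually_gt_atTop ‖Y 1 ω‖).and
      (h1.eventually_lt_const hω)).exists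
    exact mem_iUnion.2 ⟨n, h2, h3⟩
  have hp : 0 < μ.real (K n) := ENNReal.toReal_pos hn.ne' (measure_ne_top _ _)
  have hp1 : μ.real (K n) ≤ 1 := measureReal_le_one
  set S := {ω | ∀ u, 0 < u → u < δ → ¬(‖Y u ω‖ * c < ⟪Y u ω, e⟫ ∧ ⟪Y u ω, e⟫ < h)}
  have h1 : ∀ N : ℕ, μ.real S ≤ (1 - μ.real (K n)) ^ N := by
    intro N
    -- The number `N` of samples is held fixed while the ratio `m = j + 1` tends to infinity; `N`
    -- goes to infinity only afterwards.
    have h2 : Tendsto (fun j : ℕ => μ.real {ω | 1 / ((n : ℝ) + 1) * (j + 1 : ℝ) ≤ ‖Y 1 ω‖}) atTop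
        (𝓝 0) := by
      refine IsLevyProcess.tendsto_measureReal_of_eventually_notMem
        (fun j => measurableSet_le measurable_const (hY.measurable 1).norm)
        (Eventually.of_forall fun ω => ?_)
      have h3 : Tendsto (fun j : ℕ => 1 / ((n : ℝ) + 1) * (j + 1 : ℝ)) atTop atTop :=
        (tendsto_atTop_add_const_right _ _ tendsto_natCast_atTop_atTop).const_mul_atTop
          Nat.one_div_pos_of_nat
      filter_upwards [h3.eventually_gt_atTop ‖Y 1 ω‖] with j hj
      exact not_le.2 hj
    have h4 := (h2.const_mul (N : ℝ)).add_const ((1 - μ.real (K n)) ^ N)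
    rw [mul_zero, zero_add] at h4
    refine ge_of_tendsto' h4 fun j => ?_
    exact hY.measureReal_avoid_cone_le hα he hc0 hc.le hh hδ Nat.one_div_pos_of_nat N
      (by positivity)
  have h2 : μ.real S ≤ 0 := by
    refine ge_of_tendsto' (tendsto_pow_atTop_nhds_zero_of_lt_one (by linarith) (by linarith)) h1
  rw [← measureReal_eq_zero_iff]
  exact le_antisymm h2 measureReal_nonneg

end IsRotSymStable

end Cone

/-! ### Processes constrained at countably many times. -/

section Stay

variable {𝓦 E : Type*} [MeasurableSpace 𝓦] [NormedAddCommGroup E] [MeasurableSpace E]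
  [BorelSpace E] [SecondCountableTopology E] {X : ℝ≥0 → 𝓦 → E} {μ : Measure 𝓦}
  [IsProbabilityMeasure μ]

/-- The event that the process started at `x` lies in `F u` at all times `u ∈ D`. -/
def stay (X : ℝ≥0 → 𝓦 → E) (D : Set ℝ≥0) (F : ℝ≥0 → Set E) (x : E) : Set 𝓦 :=
  {ω | ∀ u ∈ D, x + X u ω ∈ F u}

/-- `E[f(x + X_s); x + X_u ∈ F u for all u ∈ D]`. -/
noncomputable def stayExp (X : ℝ≥0 → 𝓦 → E) (μ : Measure 𝓦) (D : Set ℝ≥0) (F : ℝ≥0 → Set E)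
    (s : ℝ≥0) (f : E → ℝ) (x : E) : ℝ :=
  ∫ ω, (stay X D F x).indicator (fun ω => f (x + X s ω)) ω ∂μ

theorem measurableSet_stay_prod {S : Type*} [MeasurableSpace S] {p : S → E} {Z : ℝ≥0 → S → E}
    (hp : Measurable p) (hZ : ∀ u, Measurable (Z u)) {D : Set ℝ≥0} (hD : D.Countable)
    {F : ℝ≥0 → Set E} (hF : ∀ u, MeasurableSet (F u)) :
    MeasurableSet {z | ∀ u ∈ D, p z + Z u z ∈ F u} := by
  have : {z | ∀ u ∈ D, p z + Z u z ∈ F u} = ⋂ u ∈ D, {z | p z + Z u z ∈ F u} := by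
    ext z
    simp
  rw [this]
  exact MeasurableSet.biInter hD fun u _ => (hp.add (hZ u)) (hF u)

namespace IsLevyProcess

theorem measurableSet_stay (hX : IsLevyProcess X μ) {D : Set ℝ≥0} (hD : D.Countable)
    {F : ℝ≥0 → Set E} (hF : ∀ u, MeasurableSet (F u)) (x : E) : MeasurableSet (stay X D F x) :=
  measurableSet_stay_prod measurable_const hX.measurable hD hF

theorem measurable_stayExp (hX : IsLevyProcess X μ) {D : Set ℝ≥0} (hD : D.Countable)
    {F : ℝ≥0 → Set E} (hF : ∀ u, MeasurableSet (F u)) (s : ℝ≥0) {f : E → ℝ} (hf : Measurable f) :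
    Measurable (stayExp X μ D F s f) := by
  have hS : MeasurableSet {z : E × 𝓦 | ∀ u ∈ D, z.1 + X u z.2 ∈ F u} :=
    measurableSet_stay_prod measurable_fst (fun u => (hX.measurable u).comp measurable_snd) hD hF
  have h1 : Measurable fun z : E × 𝓦 => f (z.1 + X s z.2) :=
    hf.comp (measurable_fst.add ((hX.measurable s).comp measurable_snd))
  exact ((h1.indicator hS).stronglyMeasurable.integral_prod_right' (ν := μ)).measurable

omit [BorelSpace E] [SecondCountableTopology E] [MeasurableSpace E] in
theorem abs_indicator_le {S : Set 𝓦} {f : E → ℝ} {C : ℝ} (hC : ∀ z, |f z| ≤ C) (g : 𝓦 → E)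
    (ω : 𝓦) : |S.indicator (fun ω => f (g ω)) ω| ≤ C := by
  by_cases h : ω ∈ S
  · rw [indicator_of_mem h]
    exact hC _
  · rw [indicator_of_notMem h, abs_zero]
    exact (abs_nonneg _).trans (hC (g ω))

theorem integrable_stay (hX : IsLevyProcess X μ) {D : Set ℝ≥0} (hD : D.Countable)
    {F : ℝ≥0 → Set E} (hF : ∀ u, MeasurableSet (F u)) (s : ℝ≥0) {f : E → ℝ} (hf : Measurable f)
    {C : ℝ} (hC : ∀ z, |f z| ≤ C) (x : E) :
    Integrable ((stay X D F x).indicator fun ω => f (x + X s ω)) μ :=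
  Integrable.of_bound ((hf.comp ((hX.measurable s).const_add x)).indicator
    (hX.measurableSet_stay hD hF x)).aestronglyMeasurable C
    (Eventually.of_forall fun ω => abs_indicator_le hC _ ω)

theorem abs_stayExp_le (hX : IsLevyProcess X μ) {D : Set ℝ≥0} (hD : D.Countable)
    {F : ℝ≥0 → Set E} (hF : ∀ u, MeasurableSet (F u)) (s : ℝ≥0) {f : E → ℝ}
    {C : ℝ} (hC : ∀ z, |f z| ≤ C) (x : E) :
    |stayExp X μ D F s f x| ≤ C * μ.real (stay X D F x) := by
  have h := hX.measurableSet_stay hD hF x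
  rw [stayExp, integral_indicator h]
  have := norm_setIntegral_le_of_norm_le_const (μ := μ) (s := stay X D F x)
    (f := fun ω => f (x + X s ω)) (C := C) (measure_lt_top _ _) fun ω _ => hC _
  exact this

theorem stayExp_one (hX : IsLevyProcess X μ) {D : Set ℝ≥0} (hD : D.Countable)
    {F : ℝ≥0 → Set E} (hF : ∀ u, MeasurableSet (F u)) (s : ℝ≥0) (x : E) :
    stayExp X μ D F s (fun _ => 1) x = μ.real (stay X D F x) := by
  rw [stayExp, integral_indicator_const _ (hX.measurableSet_stay hD hF x), smul_eq_mul, mul_one]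

/-- The Markov property at time `r` for the process restricted to stay in prescribed sets. -/
theorem integral_stay_add (hX : IsLevyProcess X μ) (r s : ℝ≥0) {D₁ D₂ : Set ℝ≥0}
    (hD₁ : D₁.Countable) (hr : D₁ ⊆ Iic r) (hD₂ : D₂.Countable) {F₁ F₂ : ℝ≥0 → Set E}
    (hF₁ : ∀ u, MeasurableSet (F₁ u)) (hF₂ : ∀ u, MeasurableSet (F₂ u)) {f : E → ℝ}
    (hf : Measurable f) {C : ℝ} (hC : ∀ z, |f z| ≤ C) (x : E) :
    ∫ ω, (stay X D₁ F₁ x ∩ {ω | ∀ u ∈ D₂, x + X (r + u) ω ∈ F₂ u}).indicator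
        (fun ω => f (x + X (r + s) ω)) ω ∂μ =
      stayExp X μ D₁ F₁ r (stayExp X μ D₂ F₂ s f) x := by
  let P₁ : Set ((ℝ≥0 → E) × (ℝ≥0 → E)) := {z | ∀ u ∈ D₁, x + z.1 u ∈ F₁ u}
  let P₂ : Set ((ℝ≥0 → E) × (ℝ≥0 → E)) := {z | ∀ u ∈ D₂, (x + z.1 r) + z.2 u ∈ F₂ u}
  have hP₁ : MeasurableSet P₁ := measurableSet_stay_prod (p := fun _ => x)
    (Z := fun u (z : (ℝ≥0 → E) × (ℝ≥0 → E)) => z.1 u) measurable_const (fun u => by fun_prop) hD₁ hF₁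
  have hP₂ : MeasurableSet P₂ := measurableSet_stay_prod
    (p := fun z : (ℝ≥0 → E) × (ℝ≥0 → E) => x + z.1 r)
    (Z := fun u (z : (ℝ≥0 → E) × (ℝ≥0 → E)) => z.2 u) (by fun_prop) (fun u => by fun_prop) hD₂ hF₂
  -- The first argument is the path stopped at `r`, the second the path of increments after `r`; the
  -- position at time `r + u` is `x + z r + w u`.
  let Φ : (ℝ≥0 → E) → (ℝ≥0 → E) → ℝ := fun z w =>
    (P₁ ∩ P₂).indicator (fun z => f ((x + z.1 r) + z.2 s)) (z, w)
  have hΦ : Measurable (Function.uncurry Φ) := by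
    refine Measurable.indicator (hf.comp ?_) (hP₁.inter hP₂)
    fun_prop
  have hΦC : ∀ z w, |Φ z w| ≤ C := by
    intro z w
    simp only [Φ]
    by_cases h : (z, w) ∈ P₁ ∩ P₂
    · rw [indicator_of_mem h]
      exact hC _
    · rw [indicator_of_notMem h, abs_zero]
      exact (abs_nonneg _).trans (hC 0)
  have h := hX.integral_past_future r hΦ hΦC
  have hmem₁ : ∀ ω (w : ℝ≥0 → E), ((fun q => X (min q r) ω), w) ∈ P₁ ↔ ω ∈ stay X D₁ F₁ x := by
    intro ω w
    refine forall₂_congr fun u hu => ?_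
    have : u ≤ r := hr hu
    simp only [min_eq_left this]
  refine Eq.trans (integral_congr_ae (Eventually.of_forall fun ω => ?_)) (h.trans
    (integral_congr_ae (Eventually.of_forall fun ω => ?_)))
  · simp only [Φ]
    refine (indicator_eq_indicator (s := P₁ ∩ P₂) ?_ ?_).symm
    · refine and_congr (hmem₁ ω _) (forall₂_congr fun u _ => ?_)
      simp only [min_self]
      rw [add_assoc, add_sub_cancel]
    · simp only [min_self]
      rw [add_assoc, add_sub_cancel]
  · simp only
    by_cases hω : ω ∈ stay X D₁ F₁ x
    · rw [indicator_of_mem hω, stayExp]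
      refine integral_congr_ae (Eventually.of_forall fun ω' => ?_)
      refine indicator_eq_indicator (s := P₁ ∩ P₂)
        (a := ((fun q => X (min q r) ω), fun q => X q ω')) ?_ ?_
      · refine (and_iff_right ((hmem₁ ω _).2 hω)).trans (forall₂_congr fun u _ => ?_)
        simp only [min_self]
      · simp only [min_self]
    · rw [indicator_of_notMem hω]
      refine (integral_congr_ae (g := fun _ => (0 : ℝ)) (Eventually.of_forall fun ω' => ?_)).trans
        (integral_zero _ _)
      refine indicator_of_notMem (fun hm => hω ((hmem₁ ω _).1 hm.1)) _

theorem stayExp_union (hX : IsLevyProcess X μ) (r s : ℝ≥0) {D₁ D₂ : Set ℝ≥0}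
    (hD₁ : D₁.Countable) (hr : D₁ ⊆ Iic r) (hD₂ : D₂.Countable) {F : Set E}
    (hF : MeasurableSet F) {f : E → ℝ} (hf : Measurable f) {C : ℝ} (hC : ∀ z, |f z| ≤ C) (x : E) :
    stayExp X μ (D₁ ∪ (r + ·) '' D₂) (fun _ => F) (r + s) f x =
      stayExp X μ D₁ (fun _ => F) r (stayExp X μ D₂ (fun _ => F) s f) x := by
  rw [← hX.integral_stay_add r s hD₁ hr hD₂ (fun _ => hF) (fun _ => hF) hf hC x, stayExp]
  have : stay X (D₁ ∪ (r + ·) '' D₂) (fun _ => F) x =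
      stay X D₁ (fun _ => F) x ∩ {ω | ∀ u ∈ D₂, x + X (r + u) ω ∈ F} := by
    ext ω
    simp [stay, or_imp, forall_and]
  rw [this]

end IsLevyProcess

end Stay

/-! ### Countable time grids and exit times. -/

section Times

/-- A fixed countable dense set of times in `(0, t)`. -/
def denseTimes (t : ℝ≥0) : Set ℝ≥0 := range (TopologicalSpace.denseSeq ℝ≥0) ∩ Ioo 0 t

theorem countable_denseTimes (t : ℝ≥0) : (denseTimes t).Countable :=
  (countable_range _).mono inter_subset_left

theorem exists_mem_denseTimes {t u v : ℝ≥0} (huv : u < v) (hv : v ≤ t) :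
    ∃ q ∈ denseTimes t, q ∈ Ioo u v := by
  obtain ⟨q, hq, hqr⟩ := (TopologicalSpace.denseRange_denseSeq ℝ≥0).exists_between huv
  exact ⟨q, ⟨hq, zero_le.trans_lt hqr.1, hqr.2.trans_le hv⟩, hqr⟩

/-- Countable sets of times in `(0, t]` that are dense and contain `t`. -/
structure IsTimeGrid (D : Set ℝ≥0) (t : ℝ≥0) : Prop where
  countable : D.Countable
  subset : D ⊆ Ioc 0 t
  mem : t ∈ D
  dense : ∀ u v, u < v → v ≤ t → ∃ q ∈ D, q ∈ Ioo u v

theorem isTimeGrid_insert_denseTimes {t : ℝ≥0} (ht : 0 < t) :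
    IsTimeGrid (insert t (denseTimes t)) t where
  countable := (countable_denseTimes t).insert t
  subset := by
    rintro q (rfl | hq)
    · exact ⟨ht, le_rfl⟩
    · exact ⟨hq.2.1, hq.2.2.le⟩
  mem := mem_insert _ _
  dense u v huv hv := by
    obtain ⟨q, hq, h⟩ := exists_mem_denseTimes huv hv
    exact ⟨q, Or.inr hq, h⟩

/-- The Markov property at time `r` produces a grid followed by a shifted grid, which need not be
the standard grid for `r + s`. -/
theorem IsTimeGrid.union {D₁ D₂ : Set ℝ≥0} {r s : ℝ≥0} (h₁ : IsTimeGrid D₁ r)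
    (h₂ : IsTimeGrid D₂ s) : IsTimeGrid (D₁ ∪ (r + ·) '' D₂) (r + s) where
  countable := h₁.countable.union (h₂.countable.image _)
  subset := by
    rintro q (hq | ⟨q, hq, rfl⟩)
    · exact ⟨(h₁.subset hq).1, (h₁.subset hq).2.trans le_self_add⟩
    · exact ⟨(h₂.subset hq).1.trans_le le_add_self, add_le_add_right (h₂.subset hq).2 r⟩
  mem := Or.inr ⟨s, h₂.mem, rfl⟩
  dense u v huv hv := by
    rcases lt_or_ge u r with hu | hu
    · obtain ⟨q, hq, h⟩ := h₁.dense u (min v r) (lt_min huv hu) (min_le_right _ _)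
      exact ⟨q, Or.inl hq, h.1, h.2.trans_le (min_le_left _ _)⟩
    · obtain ⟨u, rfl⟩ := le_iff_exists_add.1 hu
      obtain ⟨v, rfl⟩ := le_iff_exists_add.1 (hu.trans huv.le)
      obtain ⟨q, hq, h⟩ := h₂.dense u v (lt_of_add_lt_add_left huv) (le_of_add_le_add_left hv)
      exact ⟨r + q, Or.inr ⟨q, hq, rfl⟩, add_lt_add_right h.1 r, add_lt_add_right h.2 r⟩

variable {𝓦 E : Type*} [NormedAddCommGroup E] {X : ℝ≥0 → 𝓦 → E} {ω : 𝓦}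

/-- By right-continuity the position at `u` is a limit of positions at grid times just after `u`;
this is why `u < t` is needed. -/
theorem mem_of_isClosed_of_dense (hω : IsCadlagPath fun s => X s ω) {F : Set E} (hF : IsClosed F)
    {D : Set ℝ≥0} {t : ℝ≥0} (hD : ∀ u v, u < v → v ≤ t → ∃ q ∈ D, q ∈ Ioo u v) {x : E}
    (h : ∀ q ∈ D, x + X q ω ∈ F) {u : ℝ≥0} (hu : u < t) : x + X u ω ∈ F := by
  have h1 : Tendsto (fun s => x + X s ω) (𝓝[>] u) (𝓝 (x + X u ω)) :=
    tendsto_const_nhds.add ((hω u).1.mono_left (nhdsWithin_mono _ Ioi_subset_Ici_self))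
  refine hF.mem_of_frequently_of_tendsto ?_ h1
  rw [frequently_iff]
  intro U hU
  obtain ⟨v, hv, hvU⟩ := (mem_nhdsGT_iff_exists_Ioo_subset' hu).1 hU
  obtain ⟨q, hq, hqu, hqv⟩ := hD u (min v t) (lt_min hv hu) (min_le_right _ _)
  exact ⟨q, hvU ⟨hqu, hqv.trans_le (min_le_left _ _)⟩, h q hq⟩

theorem mem_of_lt_exitTime {U : Set E} {x : E} {s : ℝ≥0} (h : (s : ℝ≥0∞) < exitTime X U x ω)
    {u : ℝ≥0} (hu : u ∈ Ioc 0 s) : x + X u ω ∈ U := by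
  by_contra hcon
  have : exitTime X U x ω ≤ u := iInf₂_le u ⟨hu.1, hcon⟩
  exact absurd (h.trans_le this) (not_lt.2 (ENNReal.coe_le_coe.2 hu.2))

/-- If the path is in the open set at time `s`, right-continuity keeps it there for a short while,
so the infimum lies strictly beyond `s`. -/
theorem lt_exitTime_iff (hω : IsCadlagPath fun s => X s ω) {U : Set E} (hU : IsOpen U) {x : E}
    {s : ℝ≥0} (hs : x + X s ω ∈ U) :
    (s : ℝ≥0∞) < exitTime X U x ω ↔ ∀ u ∈ Ioc 0 s, x + X u ω ∈ U := by
  constructor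
  · exact fun h u hu => mem_of_lt_exitTime h hu
  · intro h
    have h1 : Tendsto (fun r => x + X r ω) (𝓝[≥] s) (𝓝 (x + X s ω)) :=
      tendsto_const_nhds.add (hω s).1
    obtain ⟨v, hv, hvU⟩ := (mem_nhdsGE_iff_exists_Ico_subset' (lt_add_one s)).1
      (h1 (hU.mem_nhds hs))
    have hsv : (s : ℝ≥0∞) < v := ENNReal.coe_lt_coe.2 hv
    refine hsv.trans_le (le_iInf₂ fun u hu => ENNReal.coe_le_coe.2 ?_)
    by_contra hcon
    rcases le_or_gt u s with hus | hus
    · exact hu.2 (h u ⟨hu.1, hus⟩)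
    · exact hu.2 (hvU ⟨hus.le, not_le.1 hcon⟩)

end Times

/-! ### Regular boundary points and the first entrance bound. -/

section BoundaryRegularity

variable {𝓦 E : Type*} [MeasurableSpace 𝓦] [NormedAddCommGroup E] [MeasurableSpace E]
  [BorelSpace E] [SecondCountableTopology E] {X : ℝ≥0 → 𝓦 → E} {μ : Measure 𝓦}
  [IsProbabilityMeasure μ]

/-- The strong Feller property of a process with independent stationary increments. -/
def IsStrongFeller (X : ℝ≥0 → 𝓦 → E) (μ : Measure 𝓦) : Prop :=
  ∀ r, 0 < r → ∀ g : E → ℝ, Measurable g → ∀ C : ℝ, (∀ z, |g z| ≤ C) →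
    Continuous fun x => ∫ ω, g (x + X r ω) ∂μ

/-- Started at a boundary point of `U`, the process leaves the closure of `U` immediately. -/
def IsRegularBoundary (X : ℝ≥0 → 𝓦 → E) (μ : Measure 𝓦) (U : Set E) : Prop :=
  ∀ z ∈ frontier U, ∀ δ, 0 < δ → μ (stay X (denseTimes δ) (fun _ => closure U) z) = 0

namespace IsLevyProcess

theorem stayExp_empty (D : Set ℝ≥0) (hD : D = ∅) (F : ℝ≥0 → Set E) (s : ℝ≥0) (f : E → ℝ) (x : E) :
    stayExp X μ D F s f x = ∫ ω, f (x + X s ω) ∂μ := by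
  subst hD
  simp [stayExp, stay]

theorem abs_measureReal_le_one (A : Set 𝓦) : |μ.real A| ≤ 1 := by
  rw [abs_of_nonneg measureReal_nonneg]
  exact measureReal_le_one

/-- With no constraint before time `r`, the Markov property turns the probability into the mean of a
bounded measurable function of the position at time `r`, and the strong Feller property applies. -/
theorem continuous_measureReal_stay (hX : IsLevyProcess X μ) (hSF : IsStrongFeller X μ)
    {F : Set E} (hF : MeasurableSet F) {D : Set ℝ≥0} (hD : D.Countable) {r : ℝ≥0} (hr : 0 < r)
    (hDr : D ⊆ Ici r) : Continuous fun x => μ.real (stay X D (fun _ => F) x) := by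
  have hD' : ∅ ∪ (r + ·) '' ((· - r) '' D) = D := by
    rw [empty_union, image_image]
    refine (image_congr fun q hq => ?_).trans (image_id D)
    exact add_tsub_cancel_of_le (hDr hq)
  have hD₂ : ((· - r) '' D).Countable := hD.image _
  have h := fun x => hX.stayExp_union r 0 (D₁ := ∅) countable_empty (empty_subset _) hD₂ hF
    (f := fun _ => (1 : ℝ)) measurable_const (C := 1) (fun _ => by simp) x
  rw [hD'] at h
  refine (hSF r hr (stayExp X μ ((· - r) '' D) (fun _ => F) 0 fun _ => 1)
    (hX.measurable_stayExp hD₂ (fun _ => hF) 0 measurable_const) 1 (fun z => ?_)).congr fun x => ?_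
  · rw [hX.stayExp_one hD₂ fun _ => hF]
    exact abs_measureReal_le_one _
  · rw [← hX.stayExp_one hD (fun _ => hF) (r + 0), h, stayExp_empty _ rfl]

/-- Upper semicontinuity at `z`: dropping the times before `r` enlarges the event, makes its
probability continuous in the starting point and, for small `r`, still leaves it below `η` at `z`.
-/
theorem eventually_measureReal_stay_lt (hX : IsLevyProcess X μ) (hSF : IsStrongFeller X μ)
    {F : Set E} (hF : MeasurableSet F) {δ : ℝ≥0} {z : E}
    (hz : μ (stay X (denseTimes δ) (fun _ => F) z) = 0) {η : ℝ} (hη : 0 < η) :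
    ∀ᶠ y in 𝓝 z, μ.real (stay X (denseTimes δ) (fun _ => F) y) < η := by
  have hc : ∀ r : ℝ≥0, (denseTimes δ ∩ Ici r).Countable := fun r =>
    (countable_denseTimes δ).mono inter_subset_left
  have h1 : Tendsto (fun r : ℝ≥0 => μ.real (stay X (denseTimes δ ∩ Ici r) (fun _ => F) z)) (𝓝[>] 0)
      (𝓝 0) := by
    refine tendsto_measureReal_of_eventually_notMem
      (fun r => hX.measurableSet_stay (hc r) (fun _ => hF) z) ?_
    filter_upwards [measure_eq_zero_iff_ae_notMem.1 hz] with ω hω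
    simp only [stay, mem_ofPred_eq, not_forall] at hω
    obtain ⟨q, hq, hqF⟩ := hω
    have : Iio q ∈ 𝓝[>] (0 : ℝ≥0) := mem_nhdsWithin_of_mem_nhds (Iio_mem_nhds hq.2.1)
    filter_upwards [this] with r hr hmem
    have hr' : r < q := hr
    exact hqF (hmem q ⟨hq, mem_Ici.2 hr'.le⟩)
  obtain ⟨r, hrη, hr⟩ := ((h1.eventually_lt_const hη).and self_mem_nhdsWithin).exists
  filter_upwards [(hX.continuous_measureReal_stay hSF hF (hc r) hr
    inter_subset_right).continuousAt.eventually_lt_const hrη] with y hy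
  refine lt_of_le_of_lt (measureReal_mono ?_) hy
  intro ω hω q hq
  exact hω q hq.1

/-- First entrance decomposition along a finite set of times. -/
theorem measureReal_exists_mem_and_stay_le (hX : IsLevyProcess X μ) {V F : Set E}
    (hV : MeasurableSet V) (hF : MeasurableSet F) {D : Set ℝ≥0} (hD : D.Countable) {η : ℝ}
    (hη0 : 0 ≤ η) (hη : ∀ y ∈ V, μ.real (stay X D (fun _ => F) y) ≤ η) (J : Finset ℝ≥0) (x : E) :
    μ.real {ω | ∃ q ∈ J, x + X q ω ∈ V ∧ (∀ p ∈ J, ∀ u ∈ D, x + X (p + u) ω ∈ F)} ≤ η := by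
  classical
  -- With these constraints `B q` is the event that `q` is the first time of `J` at which the path
  -- is in `V`. Such events are disjoint, and the Markov property at `q` costs a factor `η` on each.
  let G : ℝ≥0 → ℝ≥0 → Set E := fun q u => if u < q then Vᶜ else V
  have hG : ∀ q u, MeasurableSet (G q u) := fun q u => by
    simp only [G]
    split_ifs
    exacts [hV.compl, hV]
  let J' : ℝ≥0 → Set ℝ≥0 := fun q => (J : Set ℝ≥0) ∩ Iic q
  have hJ' : ∀ q, (J' q).Countable := fun q => J.countable_toSet.mono inter_subset_left
  let B : ℝ≥0 → Set 𝓦 := fun q => stay X (J' q) (G q) x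
  have hB : ∀ q, MeasurableSet (B q) := fun q => hX.measurableSet_stay (hJ' q) (hG q) x
  have hBV : ∀ q ∈ J, ∀ ω ∈ B q, x + X q ω ∈ V := by
    intro q hq ω hω
    have := hω q ⟨hq, mem_Iic.2 le_rfl⟩
    simpa [G] using this
  have hBnV : ∀ q, ∀ p ∈ J, p < q → ∀ ω ∈ B q, x + X p ω ∉ V := by
    intro q p hp hpq ω hω
    have := hω p ⟨hp, mem_Iic.2 hpq.le⟩
    simpa [G, hpq] using this
  have hdisj : (J : Set ℝ≥0).PairwiseDisjoint B := by
    intro p hp q hq hpq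
    refine disjoint_left.2 fun ω hωp hωq => ?_
    rcases lt_or_gt_of_ne hpq with h | h
    · exact hBnV q p hp h ω hωq (hBV p hp ω hωp)
    · exact hBnV p q hq h ω hωp (hBV q hq ω hωq)
  let R : ℝ≥0 → Set 𝓦 := fun q => {ω | ∀ u ∈ D, x + X (q + u) ω ∈ F}
  have hR : ∀ q, MeasurableSet (R q) := fun q =>
    measurableSet_stay_prod measurable_const (fun u => hX.measurable (q + u)) hD fun _ => hF
  have hBR : ∀ q ∈ J, μ.real (B q ∩ R q) ≤ η * μ.real (B q) := by
    intro q hq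
    have h := hX.integral_stay_add q 0 (hJ' q) inter_subset_right hD (hG q) (fun _ => hF)
      (f := fun _ => 1) measurable_const (C := 1) (fun _ => by simp) x
    rw [integral_indicator_const _ ((hB q).inter (hR q)), smul_eq_mul, mul_one] at h
    rw [h, stayExp, mul_comm, ← smul_eq_mul, ← integral_indicator_const _ (hB q)]
    have hm := hX.measurable_stayExp (μ := μ) hD (fun _ => hF) 0 (f := fun _ => (1 : ℝ)) measurable_const
    refine integral_mono ?_ ((integrable_const _).indicator (hB q)) fun ω => ?_
    · exact hX.integrable_stay (hJ' q) (hG q) q hm (C := 1) (fun z => by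
        rw [hX.stayExp_one hD fun _ => hF]
        exact abs_measureReal_le_one _) x
    · refine indicator_le_indicator' fun hω => ?_
      rw [hX.stayExp_one hD fun _ => hF]
      exact hη _ (hBV q hq ω hω)
  have hsub : {ω | ∃ q ∈ J, x + X q ω ∈ V ∧ (∀ p ∈ J, ∀ u ∈ D, x + X (p + u) ω ∈ F)} ⊆
      ⋃ q ∈ J, B q ∩ R q := by
    rintro ω ⟨q, hq, hqV, hω⟩
    obtain ⟨p, hp, hmin⟩ := (J.filter fun q => x + X q ω ∈ V).exists_minimal
      ⟨q, Finset.mem_filter.2 ⟨hq, hqV⟩⟩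
    rw [Finset.mem_filter] at hp
    refine mem_iUnion₂.2 ⟨p, hp.1, fun u hu => ?_, hω p hp.1⟩
    simp only [G]
    split_ifs with hup
    · intro huV
      exact absurd (hmin (Finset.mem_filter.2 ⟨hu.1, huV⟩) hup.le) (not_le.2 hup)
    · rw [le_antisymm hu.2 (not_lt.1 hup)]
      exact hp.2
  calc _ ≤ μ.real (⋃ q ∈ J, B q ∩ R q) := measureReal_mono hsub (measure_ne_top _ _)
    _ ≤ ∑ q ∈ J, μ.real (B q ∩ R q) := measureReal_biUnion_finset_le _ _
    _ ≤ ∑ q ∈ J, η * μ.real (B q) := Finset.sum_le_sum hBR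
    _ = η * μ.real (⋃ q ∈ J, B q) := by
        rw [measureReal_biUnion_finset hdisj fun q _ => hB q, Finset.mul_sum]
    _ ≤ η := mul_le_of_le_one_right hη0 measureReal_le_one

end IsLevyProcess

end BoundaryRegularity

/-! ### The killed semigroup along time grids. -/

section Killed

variable {𝓦 E : Type*} [MeasurableSpace 𝓦] [NormedAddCommGroup E] [MeasurableSpace E]
  [BorelSpace E] [SecondCountableTopology E] {X : ℝ≥0 → 𝓦 → E} {μ : Measure 𝓦}
  [IsProbabilityMeasure μ] {U : Set E}

/-- The semigroup of the process killed on leaving `U`, computed along a countable set of times. -/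
noncomputable def killedExp (X : ℝ≥0 → 𝓦 → E) (μ : Measure 𝓦) (U : Set E) (s : ℝ≥0) (f : E → ℝ)
    (x : E) : ℝ :=
  stayExp X μ (insert s (denseTimes s)) (fun _ => U) s f x

theorem countable_insert_denseTimes (s : ℝ≥0) : (insert s (denseTimes s)).Countable :=
  (countable_denseTimes s).insert s

namespace IsLevyProcess

/-- Continuity from below over finite subsets of `Q`. The closing condition is kept over all of `Q`,
so that the events increase, and is relaxed only when the finite bound is applied. -/
theorem measure_exists_mem_and_stay_le (hX : IsLevyProcess X μ) {V F : Set E}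
    (hV : MeasurableSet V) (hF : MeasurableSet F) {D : Set ℝ≥0} (hD : D.Countable) {η : ℝ}
    (hη0 : 0 ≤ η) (hη : ∀ y ∈ V, μ.real (stay X D (fun _ => F) y) ≤ η) {Q : Set ℝ≥0}
    (hQ : Q.Countable) (x : E) :
    μ {ω | ∃ q ∈ Q, x + X q ω ∈ V ∧ (∀ p ∈ Q, ∀ u ∈ D, x + X (p + u) ω ∈ F)} ≤
      ENNReal.ofReal η := by
  classical
  have := hQ.to_subtype
  let A : Finset Q → Set 𝓦 := fun J =>
    {ω | ∃ q ∈ J, x + X q ω ∈ V ∧ (∀ p ∈ Q, ∀ u ∈ D, x + X (p + u) ω ∈ F)}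
  have hA : {ω | ∃ q ∈ Q, x + X q ω ∈ V ∧ (∀ p ∈ Q, ∀ u ∈ D, x + X (p + u) ω ∈ F)} = ⋃ J, A J := by
    ext ω
    simp only [mem_iUnion]
    constructor
    · rintro ⟨q, hq, h⟩
      exact ⟨{⟨q, hq⟩}, ⟨q, hq⟩, by simp, h⟩
    · rintro ⟨J, q, _, h⟩
      exact ⟨q, q.2, h⟩
  have hdir : Directed (· ⊆ ·) A := by
    refine Monotone.directed_le (f := A) fun J J' hJ ω hω => ?_
    obtain ⟨q, hq, h⟩ := hω
    exact ⟨q, hJ hq, h⟩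
  rw [hA, hdir.measure_iUnion]
  refine iSup_le fun J => ?_
  have h := hX.measureReal_exists_mem_and_stay_le hV hF hD hη0 hη (J.image Subtype.val) x
  rw [← ofReal_measureReal (measure_ne_top _ _)]
  refine ENNReal.ofReal_le_ofReal (le_trans (measureReal_mono ?_ (measure_ne_top _ _)) h)
  rintro ω ⟨q, hq, hqV, hω⟩
  refine ⟨q, Finset.mem_image_of_mem _ hq, hqV, fun p hp => hω p ?_⟩
  obtain ⟨p, _, rfl⟩ := Finset.mem_image.1 hp
  exact p.2

/-- A path that stays in the open set `U` along a dense set of times almost surely stays in `U` at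
all times, since it would leave the closure of `U` immediately after touching the boundary. -/
theorem ae_forall_mem_of_mem_stay (hX : IsLevyProcess X μ) (hSF : IsStrongFeller X μ)
    (hU : IsOpen U) (hreg : IsRegularBoundary X μ U) {D : Set ℝ≥0} {t : ℝ≥0} (hD : IsTimeGrid D t)
    (x : E) : ∀ᵐ ω ∂μ, ω ∈ stay X D (fun _ => U) x → ∀ u ∈ Ioc 0 t, x + X u ω ∈ U := by
  have key : ∀ δ ∈ denseTimes t, ∀ᵐ ω ∂μ, ω ∈ stay X D (fun _ => U) x →
      ∀ u, u + δ < t → x + X u ω ∈ U := by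
    intro δ hδ
    have hc : IsClosed (closure U) := isClosed_closure
    rw [ae_iff]
    have h0 : ∀ η : ℝ≥0, 0 < η → μ {ω | ¬(ω ∈ stay X D (fun _ => U) x →
        ∀ u, u + δ < t → x + X u ω ∈ U)} ≤ 0 + η := by
      intro η hη
      -- An open neighbourhood of the boundary from which remaining in the closure for a further
      -- time `δ` has probability below `η`. A bad path enters it and then does remain.
      let V : Set E := {y | ∀ᶠ y' in 𝓝 y, μ.real (stay X (denseTimes δ) (fun _ => closure U) y') < η}
      have hV : IsOpen V := isOpen_setOfPred_eventually_nhds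
      have hfV : frontier U ⊆ V := fun z hz =>
        hX.eventually_measureReal_stay_lt hSF hc.measurableSet (hreg z hz δ hδ.2.1) hη
      have h1 := hX.measure_exists_mem_and_stay_le (Q := D ∩ {q | q + δ ≤ t}) (η := (η : ℝ))
        hV.measurableSet hc.measurableSet (countable_denseTimes δ) η.coe_nonneg
        (fun y hy => (Eventually.self_of_nhds hy).le)
        (hD.countable.mono inter_subset_left) x
      rw [ENNReal.ofReal_coe_nnreal] at h1
      rw [zero_add]
      refine (measure_mono_ae ?_).trans h1
      filter_upwards [hX.cadlag] with ω hω hbad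
      have hbad' : ¬(ω ∈ stay X D (fun _ => U) x → ∀ u, u + δ < t → x + X u ω ∈ U) := hbad
      simp only [Classical.not_imp, not_forall] at hbad'
      obtain ⟨hst, u, hut, huU⟩ := hbad'
      have hcl : ∀ v < t, x + X v ω ∈ closure U := fun v hv =>
        mem_of_isClosed_of_dense hω hc hD.dense (fun q hq => subset_closure (hst q hq)) hv
      have hu : u < t := lt_of_le_of_lt le_self_add hut
      have huV : x + X u ω ∈ V := hfV (by
        rw [hU.frontier_eq]
        exact ⟨hcl u hu, huU⟩)
      have h2 : Tendsto (fun s => x + X s ω) (𝓝[>] u) (𝓝 (x + X u ω)) :=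
        tendsto_const_nhds.add ((hω u).1.mono_left (nhdsWithin_mono _ Ioi_subset_Ici_self))
      obtain ⟨v, hv, hvV⟩ := (mem_nhdsGT_iff_exists_Ioo_subset' hu).1 (h2 (hV.mem_nhds huV))
      -- The grid time `q` is close enough to `u` for the path to be in `V`, and early enough for a
      -- further time `δ` to fit before `t`.
      obtain ⟨q, hq, hqu, hqv⟩ := hD.dense u (min v (t - δ))
        (lt_min hv (lt_tsub_iff_right.2 hut)) ((min_le_right _ _).trans tsub_le_self)
      have hqδ : q + δ < t := lt_tsub_iff_right.1 (hqv.trans_le (min_le_right _ _))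
      refine ⟨q, ⟨hq, hqδ.le⟩, hvV ⟨hqu, hqv.trans_le (min_le_left _ _)⟩, fun p hp w hw => ?_⟩
      exact hcl _ ((add_lt_add_right hw.2.2 p).trans_le hp.2)
    exact le_antisymm (ENNReal.le_of_forall_pos_le_add fun η hη _ => h0 η hη) bot_le
  -- Countably many `δ` suffice: each `u < t` leaves room for one of them, and `u = t` is itself a
  -- grid time.
  filter_upwards [(ae_ball_iff (countable_denseTimes t)).2 key] with ω hω hst u hu
  rcases hu.2.eq_or_lt with rfl | hut
  · exact hst u hD.mem
  · obtain ⟨δ, hδ, hδ'⟩ := exists_mem_denseTimes (tsub_pos_of_lt hut) (tsub_le_self (a := t) (b := u))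
    exact hω δ hδ hst u (lt_tsub_iff_left.1 hδ'.2)

theorem stayExp_eq_of_isTimeGrid (hX : IsLevyProcess X μ) (hSF : IsStrongFeller X μ)
    (hU : IsOpen U) (hreg : IsRegularBoundary X μ U) {D₁ D₂ : Set ℝ≥0} {t : ℝ≥0}
    (h₁ : IsTimeGrid D₁ t) (h₂ : IsTimeGrid D₂ t) (s : ℝ≥0) (f : E → ℝ) (x : E) :
    stayExp X μ D₁ (fun _ => U) s f x = stayExp X μ D₂ (fun _ => U) s f x := by
  refine integral_congr_ae ?_
  filter_upwards [hX.ae_forall_mem_of_mem_stay hSF hU hreg h₁ x,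
    hX.ae_forall_mem_of_mem_stay hSF hU hreg h₂ x] with ω ha hb
  refine indicator_eq_indicator ⟨fun h q hq => ha h q (h₂.subset hq),
    fun h q hq => hb h q (h₁.subset hq)⟩ rfl

/-- Grids for the same time give the same expectation, so the standard grid for `r + s` may be
exchanged for the union produced by the Markov property at `r`. -/
theorem killedExp_add (hX : IsLevyProcess X μ) (hSF : IsStrongFeller X μ)
    (hU : IsOpen U) (hreg : IsRegularBoundary X μ U) {r s : ℝ≥0} (hr : 0 < r) (hs : 0 < s)
    {f : E → ℝ} (hf : Measurable f) {C : ℝ} (hC : ∀ z, |f z| ≤ C) (x : E) :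
    killedExp X μ U (r + s) f x = killedExp X μ U r (killedExp X μ U s f) x := by
  have h₁ := isTimeGrid_insert_denseTimes hr
  have h₂ := isTimeGrid_insert_denseTimes hs
  refine (hX.stayExp_eq_of_isTimeGrid hSF hU hreg
    (isTimeGrid_insert_denseTimes (add_pos hr hs)) (h₁.union h₂) _ f x).trans ?_
  exact hX.stayExp_union r s h₁.countable (fun q hq => (h₁.subset hq).2) h₂.countable
    hU.measurableSet hf hC x

theorem killedExp_eq_integral_lt_exitTime (hX : IsLevyProcess X μ) (hSF : IsStrongFeller X μ)
    (hU : IsOpen U) (hreg : IsRegularBoundary X μ U) {s : ℝ≥0} (hs : 0 < s) (f : E → ℝ) (x : E) :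
    ∫ ω, {ω | (s : ℝ≥0∞) < exitTime X U x ω}.indicator (fun ω => f (x + X s ω)) ω ∂μ =
      killedExp X μ U s f x := by
  have hD := isTimeGrid_insert_denseTimes hs
  refine integral_congr_ae ?_
  filter_upwards [hX.cadlag, hX.ae_forall_mem_of_mem_stay hSF hU hreg hD x] with ω hω h
  refine indicator_eq_indicator ⟨fun hlt q hq => ?_, fun hst => ?_⟩ rfl
  · exact mem_of_lt_exitTime hlt (hD.subset hq)
  · exact (lt_exitTime_iff hω hU (hst s hD.mem)).2 (h hst)

theorem measurable_killedExp (hX : IsLevyProcess X μ) (hU : IsOpen U) (s : ℝ≥0) {f : E → ℝ}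
    (hf : Measurable f) : Measurable (killedExp X μ U s f) :=
  hX.measurable_stayExp (countable_insert_denseTimes s) (fun _ => hU.measurableSet) s hf

theorem abs_killedExp_le (hX : IsLevyProcess X μ) (hU : IsOpen U) (s : ℝ≥0) {f : E → ℝ}
    {C : ℝ} (hC : ∀ z, |f z| ≤ C) (x : E) : |killedExp X μ U s f x| ≤ C := by
  refine (hX.abs_stayExp_le (countable_insert_denseTimes s) (fun _ => hU.measurableSet) s hC
    x).trans (mul_le_of_le_one_right ((abs_nonneg _).trans (hC 0)) measureReal_le_one)

/-- The killed semigroup is small near the boundary. -/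
theorem tendsto_killedExp_frontier (hX : IsLevyProcess X μ) (hSF : IsStrongFeller X μ)
    (hU : IsOpen U) (hreg : IsRegularBoundary X μ U) {s : ℝ≥0} (hs : 0 < s) {f : E → ℝ} {C : ℝ}
    (hC : ∀ z, |f z| ≤ C) {z : E} (hz : z ∈ frontier U) :
    Tendsto (killedExp X μ U s f) (𝓝 z) (𝓝 0) := by
  have hC0 : 0 ≤ C := (abs_nonneg _).trans (hC 0)
  have h1 : Tendsto (fun y => μ.real (stay X (denseTimes s) (fun _ => closure U) y)) (𝓝 z)
      (𝓝 0) := by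
    rw [Metric.tendsto_nhds]
    intro η hη
    filter_upwards [hX.eventually_measureReal_stay_lt hSF isClosed_closure.measurableSet
      (hreg z hz s hs) hη] with y hy
    rwa [dist_zero_right, Real.norm_eq_abs, abs_of_nonneg measureReal_nonneg]
  have h2 := h1.const_mul C
  rw [mul_zero] at h2
  refine squeeze_zero_norm (fun y => ?_) h2
  refine (hX.abs_stayExp_le (countable_insert_denseTimes s) (fun _ => hU.measurableSet) s hC
    y).trans (mul_le_mul_of_nonneg_left (measureReal_mono ?_ (measure_ne_top _ _)) hC0)
  intro ω hω q hq
  exact subset_closure (hω q (Or.inr hq))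

/-- The probability of a large displacement before time `r` is small for small `r`. -/
theorem tendsto_measureReal_compl_stay_ball (hX : IsLevyProcess X μ) {ρ : ℝ} (hρ : 0 < ρ) :
    Tendsto (fun r => μ.real (stay X (insert r (denseTimes r)) (fun _ => Metric.ball 0 ρ) 0)ᶜ)
      (𝓝[>] 0) (𝓝 0) := by
  refine tendsto_measureReal_of_eventually_notMem (fun r => (hX.measurableSet_stay
    (countable_insert_denseTimes r) (fun _ => Metric.isOpen_ball.measurableSet) 0).compl) ?_
  filter_upwards [hX.zero, hX.cadlag] with ω h0 hω
  obtain ⟨v, hv, hvX⟩ := (mem_nhdsGE_iff_exists_Ico_subset' (zero_lt_one (α := ℝ≥0))).1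
    (mem_nhdsWithin_of_mem_nhds (eventually_norm_lt h0 hω hρ))
  have : Iio v ∈ 𝓝[>] (0 : ℝ≥0) := mem_nhdsWithin_of_mem_nhds (Iio_mem_nhds hv)
  filter_upwards [this] with r hr
  rw [notMem_compl_iff]
  intro q hq
  have hqr : q ≤ r := by
    rcases hq with rfl | hq
    exacts [le_rfl, hq.2.2.le]
  have : ‖X q ω‖ < ρ := hvX ⟨zero_le, hqr.trans_lt hr⟩
  simpa using this

theorem abs_stayExp_sub_integral_le (hX : IsLevyProcess X μ) {D : Set ℝ≥0} (hD : D.Countable)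
    {F : ℝ≥0 → Set E} (hF : ∀ u, MeasurableSet (F u)) (s : ℝ≥0) {f : E → ℝ} (hf : Measurable f)
    {C : ℝ} (hC : ∀ z, |f z| ≤ C) (x : E) :
    |stayExp X μ D F s f x - ∫ ω, f (x + X s ω) ∂μ| ≤ C * μ.real (stay X D F x)ᶜ := by
  have h := hX.measurableSet_stay hD hF x
  have hi : Integrable (fun ω => f (x + X s ω)) μ :=
    Integrable.of_bound (hf.comp ((hX.measurable s).const_add x)).aestronglyMeasurable C
      (Eventually.of_forall fun ω => hC _)
  rw [stayExp, integral_indicator h, ← integral_add_compl h hi, sub_add_cancel_left, abs_neg]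
  exact norm_setIntegral_le_of_norm_le_const (μ := μ) (s := (stay X D F x)ᶜ)
    (f := fun ω => f (x + X s ω)) (C := C) (measure_lt_top _ _) fun ω _ => hC _

/-- Split `s = r + q` with `r` small and ignore killing before `r`. What remains is continuous by
the strong Feller property, and the error is at most `C` times the probability of a displacement of
`ρ / 2` by time `r`, uniformly for starting points within `ρ / 2` of `x`. -/
theorem continuousAt_killedExp (hX : IsLevyProcess X μ) (hSF : IsStrongFeller X μ)
    (hU : IsOpen U) (hreg : IsRegularBoundary X μ U) {s : ℝ≥0} (hs : 0 < s) {f : E → ℝ}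
    (hf : Measurable f) {C : ℝ} (hC : ∀ z, |f z| ≤ C) {x : E} (hx : x ∈ U) :
    ContinuousAt (killedExp X μ U s f) x := by
  have hC0 : 0 ≤ C := (abs_nonneg _).trans (hC 0)
  obtain ⟨ρ, hρ, hρU⟩ := Metric.isOpen_iff.1 hU x hx
  refine continuousAt_of_locally_uniform_approx_of_continuousAt fun V hV => ?_
  obtain ⟨ε, hε, hεV⟩ := Metric.mem_uniformity_dist.1 hV
  have h1 := (hX.tendsto_measureReal_compl_stay_ball (half_pos hρ)).const_mul C
  rw [mul_zero] at h1
  have : Iio s ∈ 𝓝[>] (0 : ℝ≥0) := mem_nhdsWithin_of_mem_nhds (Iio_mem_nhds hs)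
  obtain ⟨r, hrε, hrs, hr⟩ := ((h1.eventually_lt_const hε).and
    ((show ∀ᶠ r in 𝓝[>] (0 : ℝ≥0), r < s from this).and self_mem_nhdsWithin)).exists
  have hr : 0 < r := hr
  obtain ⟨q, rfl⟩ := le_iff_exists_add.1 hrs.le
  have hq : 0 < q := pos_of_lt_add_right hrs
  set g := killedExp X μ U q f
  have hg : Measurable g := hX.measurable_killedExp hU q hf
  have hgC : ∀ z, |g z| ≤ C := hX.abs_killedExp_le hU q hC
  refine ⟨Metric.ball x (ρ / 2), Metric.ball_mem_nhds x (half_pos hρ),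
    fun y => ∫ ω, g (y + X r ω) ∂μ, (hSF r hr g hg C hgC).continuousAt, fun y hy => hεV ?_⟩
  rw [hX.killedExp_add hSF hU hreg hr hq hf hC, Real.dist_eq]
  refine lt_of_le_of_lt (hX.abs_stayExp_sub_integral_le (countable_insert_denseTimes r)
    (fun _ => hU.measurableSet) r hg hgC y) (lt_of_le_of_lt ?_ hrε)
  refine mul_le_mul_of_nonneg_left (measureReal_mono (compl_subset_compl.2 ?_)
    (measure_ne_top _ _)) hC0
  intro ω hω u hu
  have h2 := hω u hu
  simp only [zero_add, mem_ball_zero_iff] at h2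
  refine hρU ?_
  rw [Metric.mem_ball, dist_eq_norm] at hy ⊢
  calc ‖y + X u ω - x‖ = ‖(y - x) + X u ω‖ := by congr 1; abel
    _ ≤ ‖y - x‖ + ‖X u ω‖ := norm_add_le _ _
    _ < ρ := by linarith

/-- Off an event of small probability the path stays within `δ` of `x`. If it is killed there, `x`
is within `δ` of a zero of `f`, so `f x` is itself small and killing costs little. -/
theorem tendstoUniformly_killedExp (hX : IsLevyProcess X μ) (hU : IsOpen U) {f : E → ℝ}
    (hf : UniformContinuous f) (hfU : ∀ z ∉ U, f z = 0) {C : ℝ} (hC : ∀ z, |f z| ≤ C) :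
    TendstoUniformly (fun s => killedExp X μ U s f) f (𝓝[>] 0) := by
  have hC0 : 0 ≤ C := (abs_nonneg _).trans (hC 0)
  rw [Metric.tendstoUniformly_iff]
  intro ε hε
  obtain ⟨δ, hδ, hfδ⟩ := Metric.uniformContinuous_iff.1 hf (ε / 2) (half_pos hε)
  have h1 := (hX.tendsto_measureReal_compl_stay_ball hδ).const_mul (2 * C)
  rw [mul_zero] at h1
  filter_upwards [h1.eventually_lt_const (half_pos hε)] with s hs x
  set M := (stay X (insert s (denseTimes s)) (fun _ => Metric.ball 0 δ) 0)ᶜ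
  have hM : MeasurableSet M := (hX.measurableSet_stay (countable_insert_denseTimes s)
    (fun _ => Metric.isOpen_ball.measurableSet) 0).compl
  set S := stay X (insert s (denseTimes s)) (fun _ => U) x
  have hint := hX.integrable_stay (countable_insert_denseTimes s) (fun _ => hU.measurableSet) s
    hf.continuous.measurable hC x
  have hclose : ∀ ω ∉ M, ∀ u ∈ insert s (denseTimes s), |f (x + X u ω) - f x| < ε / 2 := by
    intro ω hω u hu
    rw [notMem_compl_iff] at hω
    have h2 := hω u hu
    simp only [zero_add, mem_ball_zero_iff] at h2
    rw [← Real.dist_eq]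
    exact hfδ (by rwa [dist_eq_norm, add_sub_cancel_left])
  have hpt : ∀ ω, ‖S.indicator (fun ω => f (x + X s ω)) ω - f x‖ ≤
      ε / 2 + M.indicator (fun _ => 2 * C) ω := by
    intro ω
    rw [Real.norm_eq_abs]
    by_cases hω : ω ∈ M
    · rw [indicator_of_mem hω]
      have h2 := abs_sub (S.indicator (fun ω => f (x + X s ω)) ω) (f x)
      have h3 := abs_indicator_le (S := S) hC (fun ω => x + X s ω) ω
      have h4 := hC x
      linarith
    · rw [indicator_of_notMem hω, add_zero]
      by_cases hS : ω ∈ S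
      · rw [indicator_of_mem hS]
        exact (hclose ω hω s (mem_insert _ _)).le
      · rw [indicator_of_notMem hS]
        simp only [S, stay, mem_ofPred_eq, not_forall] at hS
        obtain ⟨u, hu, huU⟩ := hS
        have := hclose ω hω u hu
        rw [hfU _ huU] at this
        exact this.le
  rw [dist_comm, Real.dist_eq]
  have h5 : killedExp X μ U s f x - f x =
      ∫ ω, (S.indicator (fun ω => f (x + X s ω)) ω - f x) ∂μ := by
    rw [integral_sub hint (integrable_const _)]
    simp [killedExp, stayExp]
  rw [h5]
  have hi2 : Integrable (fun ω => ε / 2 + M.indicator (fun _ => 2 * C) ω) μ :=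
    (integrable_const _).add ((integrable_const _).indicator hM)
  have h6 := norm_integral_le_of_norm_le hi2 (Eventually.of_forall hpt)
  rw [integral_add (integrable_const _) ((integrable_const _).indicator hM),
    integral_indicator_const _ hM] at h6
  simp only [integral_const, probReal_univ, smul_eq_mul] at h6
  rw [Real.norm_eq_abs] at h6
  linarith

end IsLevyProcess

end Killed

/-! ### The killed stable semigroup on a regular set. -/

section KilledSpace

variable {𝓦 : Type*} [MeasurableSpace 𝓦] {d : ℕ} {α : ℝ}
  {Y : ℝ≥0 → 𝓦 → EuclideanSpace ℝ (Fin d)} {μ : Measure 𝓦} [IsProbabilityMeasure μ]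
  {Ω : Set (EuclideanSpace ℝ (Fin d))}

theorem IsRotSymStable.isStrongFeller (hd : 1 ≤ d) (hα : 0 < α) (hY : IsRotSymStable α Y μ) :
    IsStrongFeller Y μ :=
  fun _ hr _ hg _ hC => hY.continuous_integral_add hd hα hr hg hC

theorem isOpen_finiteCone (x e : EuclideanSpace ℝ (Fin d)) (θ h : ℝ) :
    IsOpen (finiteCone x e θ h) :=
  (isOpen_lt (f := fun y => ‖y - x‖ * Real.cos θ) (g := fun y => ⟪y - x, e⟫) (by fun_prop)
    (by fun_prop)).inter (isOpen_lt (f := fun y => ⟪y - x, e⟫) (by fun_prop) (by fun_prop))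

/-- The exterior cone is open, hence disjoint from the closure of `Ω` as well. A path that stays in
this closure at a dense set of times avoids the cone up to time `δ`, an event of probability `0`. -/
theorem IsRotSymStable.isRegularBoundary (hd : 1 ≤ d) (hα : 0 < α) (hY : IsRotSymStable α Y μ)
    (hΩ : IsRegularSet Ω) : IsRegularBoundary Y μ Ω := by
  intro z hz δ hδ
  obtain ⟨e, he, θ, hθ, h, hh, hcone⟩ := hΩ.exteriorCone z hz
  have hdisj : Disjoint (finiteCone z e θ h) (closure Ω) :=
    (disjoint_left.2 fun y hy hyΩ => hcone hy hyΩ).closure_right (isOpen_finiteCone z e θ h)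
  have hc0 : 0 ≤ Real.cos θ :=
    (Real.cos_pos_of_mem_Ioo ⟨by linarith [hθ.1, Real.pi_pos], hθ.2⟩).le
  have hc1 : Real.cos θ < 1 := by
    rw [← Real.cos_zero]
    exact Real.cos_lt_cos_of_nonneg_of_le_pi le_rfl (by linarith [hθ.2, Real.pi_pos]) hθ.1
  refine le_antisymm ((measure_mono_ae ?_).trans
    (hY.measure_avoid_cone_eq_zero hd hα he hc0 hc1 hh hδ).le) bot_le
  filter_upwards [hY.cadlag] with ω hω hst u _ huδ hcon
  have h1 : z + Y u ω ∈ finiteCone z e θ h := by simpa [finiteCone] using hcon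
  exact disjoint_left.1 hdisj h1 (mem_of_isClosed_of_dense hω isClosed_closure
    (fun _ _ => exists_mem_denseTimes) hst huδ)

theorem zeroExt_coe_mk {E : Type*} {A : Set E} (f : A → ℝ) {z : E} (hz : z ∈ A) :
    zeroExt f z = f ⟨z, hz⟩ :=
  zeroExt_coe f ⟨z, hz⟩

theorem abs_zeroExt_le {E : Type*} {A : Set E} {f : A → ℝ} {C : ℝ} (hC0 : 0 ≤ C)
    (hC : ∀ x, |f x| ≤ C) (z : E) : |zeroExt f z| ≤ C := by
  by_cases hz : z ∈ A
  · rw [zeroExt_coe_mk f hz]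
    exact hC _
  · rwa [zeroExt_of_notMem f hz, abs_zero]

theorem zeroExt_eq_zero (hΩ : IsOpen Ω) {f : closure Ω →ᵇ ℝ} (hf : f ∈ spaceCBdry Ω)
    {z : EuclideanSpace ℝ (Fin d)} (hz : z ∉ Ω) : zeroExt f z = 0 := by
  by_cases hz' : z ∈ closure Ω
  · rw [zeroExt_coe_mk _ hz']
    exact eq_zero_of_mem_spaceCBdry hΩ hf hz
  · exact zeroExt_of_notMem f hz'

theorem continuous_zeroExt (hΩ : IsOpen Ω) {f : closure Ω →ᵇ ℝ} (hf : f ∈ spaceCBdry Ω) :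
    Continuous (zeroExt f) := by
  have h1 : ContinuousOn (zeroExt f) (closure Ω) := by
    rw [continuousOn_iff_continuous_domRestrict]
    exact f.continuous.congr fun x => (zeroExt_coe f x).symm
  have h2 : ContinuousOn (zeroExt f) Ωᶜ :=
    continuousOn_const.congr fun z hz => zeroExt_eq_zero hΩ hf hz
  have h3 := h1.union_of_isClosed h2 isClosed_closure hΩ.isClosed_compl
  rwa [univ_subset_iff.1 ((union_compl_self Ω).symm.subset.trans
    (union_subset_union_left _ subset_closure)), continuousOn_univ] at h3

theorem uniformContinuous_zeroExt (hΩ : IsRegularSet Ω) {f : closure Ω →ᵇ ℝ}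
    (hf : f ∈ spaceCBdry Ω) : UniformContinuous (zeroExt f) :=
  (HasCompactSupport.intro hΩ.isBounded.isCompact_closure fun _ hz =>
    zeroExt_of_notMem f hz).uniformContinuous_of_continuous (continuous_zeroExt hΩ.isOpen hf)

theorem killedSpace_eq (hY : IsLevyProcess Y μ) (hSF : IsStrongFeller Y μ) (hΩ : IsOpen Ω)
    (hreg : IsRegularBoundary Y μ Ω) {A : Set (EuclideanSpace ℝ (Fin d))} {s : ℝ≥0} (hs : 0 < s)
    (f : A → ℝ) : killedSpace Y μ Ω A s f = fun x : A => killedExp Y μ Ω s (zeroExt f) x :=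
  funext fun x => hY.killedExp_eq_integral_lt_exitTime hSF hΩ hreg hs (zeroExt f) x

/-- Time `0` is separate from the grid description. From a point of `Ω` right-continuity makes the
exit time positive; at a boundary point both sides vanish. -/
theorem killedSpace_zero (hY : IsLevyProcess Y μ) (hΩ : IsOpen Ω) {f : closure Ω →ᵇ ℝ}
    (hf : f ∈ spaceCBdry Ω) : killedSpace Y μ Ω (closure Ω) 0 f = f := by
  funext x
  have : ∀ᵐ ω ∂μ, {ω | ((0 : ℝ≥0) : ℝ≥0∞) < exitTime Y Ω x ω}.indicator
      (fun ω => zeroExt f (x + Y 0 ω)) ω = f x := by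
    filter_upwards [hY.zero, hY.cadlag] with ω h0 hω
    by_cases hx : (x : EuclideanSpace ℝ (Fin d)) ∈ Ω
    · rw [indicator_of_mem, h0, add_zero, zeroExt_coe]
      rw [mem_ofPred_eq, lt_exitTime_iff hω hΩ (by rwa [h0, add_zero])]
      simp
    · rw [eq_zero_of_mem_spaceCBdry hΩ hf hx]
      refine indicator_apply_eq_zero.2 fun _ => ?_
      rw [h0, add_zero]
      exact zeroExt_eq_zero hΩ hf hx
  rw [killedSpace, integral_congr_ae this]
  simp

theorem isSubFeller_killedSpace (hY : IsLevyProcess Y μ) (hSF : IsStrongFeller Y μ)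
    (hΩ : IsRegularSet Ω) (hreg : IsRegularBoundary Y μ Ω) :
    IsSubFeller (spaceCBdry Ω) (killedSpace Y μ Ω (closure Ω)) := by
  have hU := hΩ.isOpen
  have hC : ∀ (f : closure Ω →ᵇ ℝ) z, |zeroExt f z| ≤ ‖f‖ := fun f =>
    abs_zeroExt_le (norm_nonneg _) f.norm_coe_le_norm
  have hm : ∀ f ∈ spaceCBdry Ω, Measurable (zeroExt (f : closure Ω → ℝ)) := fun f hf =>
    (continuous_zeroExt hU hf).measurable
  have hP : ∀ {s : ℝ≥0}, 0 < s → ∀ f : closure Ω → ℝ, killedSpace Y μ Ω (closure Ω) s f =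
      fun x : closure Ω => killedExp Y μ Ω s (zeroExt f) x :=
    fun hs f => killedSpace_eq hY hSF hU hreg hs f
  have hint : ∀ s, ∀ f ∈ spaceCBdry Ω, ∀ x, Integrable
      ((stay Y (insert s (denseTimes s)) (fun _ => Ω) x).indicator fun ω => zeroExt f (x + Y s ω)) μ :=
    fun s f hf x => hY.integrable_stay (countable_insert_denseTimes s) (fun _ => hU.measurableSet) s
      (hm f hf) (hC f) x
  have hmaps : ∀ s, ∀ f ∈ spaceCBdry Ω, ∃ g ∈ spaceCBdry Ω,
      ⇑g = killedSpace Y μ Ω (closure Ω) s f := by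
    intro s f hf
    rcases eq_zero_or_pos s with rfl | hs
    · exact ⟨f, hf, (killedSpace_zero hY hU hf).symm⟩
    rw [hP hs]
    have hbd : ∀ x : closure Ω, (x : EuclideanSpace ℝ (Fin d)) ∈ frontier Ω →
        killedExp Y μ Ω s (zeroExt f) x = 0 := by
      intro x hx
      have h0 := hY.abs_stayExp_le (countable_insert_denseTimes s) (fun _ => hU.measurableSet) s
        (hC f) (x : EuclideanSpace ℝ (Fin d))
      have h1 : μ (stay Y (insert s (denseTimes s)) (fun _ => Ω) (x : EuclideanSpace ℝ (Fin d))) = 0 :=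
        measure_mono_null (fun ω hω q hq => subset_closure (hω q (Or.inr hq))) (hreg x hx s hs)
      rw [measureReal_def, h1, ENNReal.toReal_zero, mul_zero] at h0
      exact abs_nonpos_iff.1 h0
    have hcont : Continuous fun x : closure Ω => killedExp Y μ Ω s (zeroExt f) x := by
      rw [continuous_iff_continuousAt]
      intro x
      by_cases hx : (x : EuclideanSpace ℝ (Fin d)) ∈ Ω
      · exact (hY.continuousAt_killedExp hSF hU hreg hs (hm f hf) (hC f) hx).comp
          continuous_subtype_val.continuousAt
      · have hx' : (x : EuclideanSpace ℝ (Fin d)) ∈ frontier Ω := by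
          rw [hU.frontier_eq]
          exact ⟨x.2, hx⟩
        rw [ContinuousAt, hbd x hx']
        exact (hY.tendsto_killedExp_frontier hSF hU hreg hs (hC f) hx').comp
          continuous_subtype_val.continuousAt
    exact ⟨BoundedContinuousFunction.ofNormedAddCommGroup _ hcont ‖f‖ fun x =>
      hY.abs_killedExp_le hU s (hC f) x, fun x hx => hbd x hx, rfl⟩
  have hzero : ∀ f ∈ spaceCBdry Ω, killedSpace Y μ Ω (closure Ω) 0 f = f := fun f hf =>
    killedSpace_zero hY hU hf
  refine ⟨hmaps, ?_, ?_, hzero, ?_, ?_, ?_, ?_⟩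
  · intro s f hf g hg
    rcases eq_zero_or_pos s with rfl | hs
    · rw [hzero _ (Submodule.add_mem _ hf hg), hzero f hf, hzero g hg]
      rfl
    rw [hP hs, hP hs, hP hs]
    funext x
    refine Eq.trans (integral_congr_ae (Eventually.of_forall fun ω => ?_))
      (integral_add (hint s f hf x) (hint s g hg x))
    have : ∀ z, zeroExt (⇑(f + g)) z = zeroExt f z + zeroExt g z := fun z => by
      by_cases hz : z ∈ closure Ω
      · simp only [zeroExt_coe_mk _ hz]
        rfl
      · simp only [zeroExt_of_notMem _ hz, add_zero]
    by_cases hω : ω ∈ stay Y (insert s (denseTimes s)) (fun _ => Ω) (x : EuclideanSpace ℝ (Fin d))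
    · simp only [indicator_of_mem hω, this]
    · simp only [indicator_of_notMem hω, add_zero]
  · intro s c f hf
    rcases eq_zero_or_pos s with rfl | hs
    · rw [hzero _ (Submodule.smul_mem _ c hf), hzero f hf]
      rfl
    rw [hP hs, hP hs]
    funext x
    refine Eq.trans (integral_congr_ae (Eventually.of_forall fun ω => ?_))
      (integral_const_mul c _)
    have : ∀ z, zeroExt (⇑(c • f)) z = c * zeroExt f z := fun z => by
      by_cases hz : z ∈ closure Ω
      · simp only [zeroExt_coe_mk _ hz]
        rfl
      · simp only [zeroExt_of_notMem _ hz, mul_zero]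
    by_cases hω : ω ∈ stay Y (insert s (denseTimes s)) (fun _ => Ω) (x : EuclideanSpace ℝ (Fin d))
    · simp only [indicator_of_mem hω, this]
    · simp only [indicator_of_notMem hω, mul_zero]
  · intro s r f hf
    obtain ⟨g, hg, hgr⟩ := hmaps r f hf
    rcases eq_zero_or_pos s with rfl | hs
    · rw [zero_add, ← hgr, hzero g hg]
    rcases eq_zero_or_pos r with rfl | hr
    · rw [add_zero, hzero f hf]
    rw [hP (add_pos hs hr), hP hs]
    funext x
    rw [hY.killedExp_add hSF hU hreg hs hr (hm f hf) (hC f)]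
    refine integral_congr_ae (Eventually.of_forall fun ω => ?_)
    by_cases hω : ω ∈ stay Y (insert s (denseTimes s)) (fun _ => Ω) (x : EuclideanSpace ℝ (Fin d))
    · have hmem : (x : EuclideanSpace ℝ (Fin d)) + Y s ω ∈ closure Ω :=
        subset_closure (hω s (mem_insert _ _))
      simp only [indicator_of_mem hω]
      rw [zeroExt_coe_mk _ hmem, hP hr]
    · simp only [indicator_of_notMem hω]
  · intro s f hf x
    rcases eq_zero_or_pos s with rfl | hs
    · rw [hzero f hf]
      exact f.norm_coe_le_norm x
    rw [hP hs]
    exact hY.abs_killedExp_le hU s (hC f) x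
  · intro s f hf hpos x
    refine integral_nonneg fun ω => indicator_nonneg (fun ω _ => ?_) ω
    by_cases hz : (x : EuclideanSpace ℝ (Fin d)) + Y s ω ∈ closure Ω
    · rw [zeroExt_coe_mk _ hz]
      exact hpos _
    · rw [zeroExt_of_notMem _ hz]
  · intro f hf
    have h := hY.tendstoUniformly_killedExp hU (uniformContinuous_zeroExt hΩ hf)
      (fun z hz => zeroExt_eq_zero hU hf hz) (hC f)
    have h2 := h.comp (Subtype.val : closure Ω → EuclideanSpace ℝ (Fin d))
    have e : zeroExt (f : closure Ω → ℝ) ∘ Subtype.val = f := funext fun x => zeroExt_coe f x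
    rw [e] at h2
    intro V hV
    filter_upwards [h2 V hV, self_mem_nhdsWithin] with s hs hs0 x
    rw [hP hs0]
    exact hs x

theorem killedSpace_fun_zero {A : Set (EuclideanSpace ℝ (Fin d))} (s : ℝ≥0) (x : A) :
    killedSpace Y μ Ω A s (fun _ => 0) x = 0 := by
  have : zeroExt (fun _ : A => (0 : ℝ)) = 0 := by
    funext z
    by_cases hz : z ∈ A
    · exact zeroExt_coe_mk _ hz
    · exact zeroExt_of_notMem _ hz
  simp [killedSpace, this]

/-- The killed semigroup does not distinguish functions on `Ω` from their extensions to the closure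
that vanish on the boundary. -/
theorem killedSpace_comp_closureInclusion (hΩ : IsOpen Ω) (s : ℝ≥0) {g : closure Ω →ᵇ ℝ}
    (hg : g ∈ spaceCBdry Ω) : killedSpace Y μ Ω Ω s (g ∘ closureInclusion Ω) =
      killedSpace Y μ Ω (closure Ω) s g ∘ closureInclusion Ω := by
  have : zeroExt ((g : closure Ω → ℝ) ∘ closureInclusion Ω) = zeroExt g := by
    funext z
    by_cases hz : z ∈ Ω
    · rw [zeroExt_coe_mk _ hz, zeroExt_coe_mk _ (subset_closure hz)]
      rfl
    · rw [zeroExt_eq_zero hΩ hg hz, zeroExt_of_notMem _ hz]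
  funext x
  simp only [killedSpace, this, Function.comp_apply]
  rfl

end KilledSpace

end SpaceTimeStable

/-! ### Assembly of the four statements. -/

open SpaceTimeStable in
theorem mainTheorem4
    {d : ℕ} (hd : 1 ≤ d) (α β T : ℝ) (hα : α ∈ Set.Ioo (0 : ℝ) 2) (hβ : β ∈ Set.Ioo (0 : ℝ) 1)
    (hT : 0 < T) (Ω : Set (EuclideanSpace ℝ (Fin d))) (hΩ : IsRegularSet Ω)
    -- the standard `β`-stable subordinator
    {𝓦₁ : Type*} [MeasurableSpace 𝓦₁] (μ₁ : Measure 𝓦₁) [IsProbabilityMeasure μ₁]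
    (X : ℝ≥0 → 𝓦₁ → ℝ) (hX : IsStableSubordinator β X μ₁)
    -- the rotationally symmetric `α`-stable Lévy process
    {𝓦₂ : Type*} [MeasurableSpace 𝓦₂] (μ₂ : Measure 𝓦₂) [IsProbabilityMeasure μ₂]
    (Y : ℝ≥0 → 𝓦₂ → EuclideanSpace ℝ (Fin d)) (hY : IsRotSymStable α Y μ₂) :
    -- (i) absorbed
    (IsSubFeller (spaceCTBdry T Ω)
        (productSemigroup (absorbedTime X μ₁ T) (killedSpace Y μ₂ Ω (closure Ω))) ∧
      ∀ (Cβ : Set (Set.Icc (0 : ℝ) T →ᵇ ℝ)) (CΩ : Set (closure Ω →ᵇ ℝ)),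
        IsInvariantCore (spaceC T) (absorbedTime X μ₁ T) Cβ →
        IsInvariantCore (spaceCBdry Ω) (killedSpace Y μ₂ Ω (closure Ω)) CΩ →
        generator (spaceCTBdry T Ω)
            (productSemigroup (absorbedTime X μ₁ T) (killedSpace Y μ₂ Ω (closure Ω))) =
          closure (sumOperator id (generator (spaceC T) (absorbedTime X μ₁ T))
            (generator (spaceCBdry Ω) (killedSpace Y μ₂ Ω (closure Ω)))
            (productSpan id Cβ CΩ))) ∧
    -- (ii) killed
    (IsSubFeller (spaceC0TBdry T Ω)
        (productSemigroup (killedTime X μ₁ T) (killedSpace Y μ₂ Ω (closure Ω))) ∧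
      ∀ (Cβ : Set (Set.Icc (0 : ℝ) T →ᵇ ℝ)) (CΩ : Set (closure Ω →ᵇ ℝ)),
        IsInvariantCore (spaceC0 T) (killedTime X μ₁ T) Cβ →
        IsInvariantCore (spaceCBdry Ω) (killedSpace Y μ₂ Ω (closure Ω)) CΩ →
        generator (spaceC0TBdry T Ω)
            (productSemigroup (killedTime X μ₁ T) (killedSpace Y μ₂ Ω (closure Ω))) =
          closure (sumOperator id (generator (spaceC0 T) (killedTime X μ₁ T))
            (generator (spaceCBdry Ω) (killedSpace Y μ₂ Ω (closure Ω)))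
            (productSpan id Cβ CΩ))) ∧
    -- (iii) on `(-∞,T]`
    (IsSubFeller (spaceCInftyBdry T Ω)
        (productSemigroup (freeTime X μ₁ T) (killedSpace Y μ₂ Ω Ω)) ∧
      ∀ (Cβ : Set (Set.Iic T →ᵇ ℝ)) (CΩ : Set (closure Ω →ᵇ ℝ)),
        IsInvariantCore (spaceCInfty T) (freeTime X μ₁ T) Cβ →
        IsInvariantCore (spaceCBdry Ω) (killedSpace Y μ₂ Ω (closure Ω)) CΩ →
        generator (spaceCInftyBdry T Ω)
            (productSemigroup (freeTime X μ₁ T) (killedSpace Y μ₂ Ω Ω)) =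
          closure (sumOperator (Set.inclusion subset_closure)
            (generator (spaceCInfty T) (freeTime X μ₁ T))
            (generator (spaceCBdry Ω) (killedSpace Y μ₂ Ω (closure Ω)))
            (productSpan (Set.inclusion subset_closure) Cβ CΩ))) ∧
    -- (iv) comparison of the absorbed and the killed versions
    ((∀ s, ∀ f ∈ spaceC0TBdry T Ω,
        productSemigroup (absorbedTime X μ₁ T) (killedSpace Y μ₂ Ω (closure Ω)) s f =
          productSemigroup (killedTime X μ₁ T) (killedSpace Y μ₂ Ω (closure Ω)) s f) ∧
      (∀ f g, (f, g) ∈ generator (spaceC0TBdry T Ω)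
          (productSemigroup (killedTime X μ₁ T) (killedSpace Y μ₂ Ω (closure Ω))) →
        (f, g) ∈ generator (spaceCTBdry T Ω)
          (productSemigroup (absorbedTime X μ₁ T) (killedSpace Y μ₂ Ω (closure Ω)))) ∧
      domain (generator (spaceC0TBdry T Ω)
          (productSemigroup (killedTime X μ₁ T) (killedSpace Y μ₂ Ω (closure Ω)))) =
        domain (generator (spaceCTBdry T Ω)
          (productSemigroup (absorbedTime X μ₁ T) (killedSpace Y μ₂ Ω (closure Ω)))) ∩
        {f | ∀ z, (z.1 : ℝ) = 0 → f z = 0}) := by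
  have hSF := hY.isStrongFeller hd hα.1
  have hreg := hY.isRegularBoundary hd hα.1 hΩ
  have hQ := isSubFeller_killedSpace hY.toIsLevyProcess hSF hΩ hreg
  have hA := isSubFeller_absorbedTime hX hT.le
  have hK := isSubFeller_killedTime hX hT.le
  have hF := isSubFeller_freeTime hX T
  have hQ' : ∀ s, ∀ g ∈ spaceCBdry Ω,
      killedSpace Y μ₂ Ω Ω s (g ∘ closureInclusion Ω) =
        killedSpace Y μ₂ Ω (closure Ω) s g ∘ closureInclusion Ω :=
    fun s _ hg => killedSpace_comp_closureInclusion hΩ.isOpen s hg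
  have hid : ∀ s, ∀ g ∈ spaceCBdry Ω,
      killedSpace Y μ₂ Ω (closure Ω) s (g ∘ ContinuousMap.id (closure Ω)) =
        killedSpace Y μ₂ Ω (closure Ω) s g ∘ ContinuousMap.id (closure Ω) := fun _ _ _ => rfl
  have hKF := (isTensor_spaceC0TBdry hΩ T).isSubFeller_product hK hQ hid
  refine ⟨⟨(isTensor_spaceCTBdry hΩ T).isSubFeller_product hA hQ hid, fun Cβ CΩ h₁ h₂ =>
      (isTensor_spaceCTBdry hΩ T).generator_product hA hQ hid h₁ h₂⟩,
    ⟨hKF, fun Cβ CΩ h₁ h₂ => (isTensor_spaceC0TBdry hΩ T).generator_product hK hQ hid h₁ h₂⟩,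
    ⟨(isTensor_spaceCInftyBdry hΩ T).isSubFeller_product hF hQ hQ', fun Cβ CΩ h₁ h₂ =>
      (isTensor_spaceCInftyBdry hΩ T).generator_product hF hQ hQ' h₁ h₂⟩, ?_⟩
  -- The space operator acts at fixed `t`, so it preserves vanishing at `t = 0`, and on such
  -- functions killing and absorbing in time coincide.
  have hagree : ∀ s, ∀ f ∈ spaceC0TBdry T Ω,
      productSemigroup (absorbedTime X μ₁ T) (killedSpace Y μ₂ Ω (closure Ω)) s f =
        productSemigroup (killedTime X μ₁ T) (killedSpace Y μ₂ Ω (closure Ω)) s f := by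
    intro s f hf
    funext z
    refine (congrFun (killedTime_eq_absorbedTime hX hT.le s fun t ht => ?_) z.1).symm
    have : (fun x => f (t, x)) = fun _ => 0 := funext fun x => hf.2 (t, x) ht
    rw [this, killedSpace_fun_zero]
  have hincl : ∀ f g, (f, g) ∈ generator (spaceC0TBdry T Ω)
      (productSemigroup (killedTime X μ₁ T) (killedSpace Y μ₂ Ω (closure Ω))) →
      (f, g) ∈ generator (spaceCTBdry T Ω)
        (productSemigroup (absorbedTime X μ₁ T) (killedSpace Y μ₂ Ω (closure Ω))) := by
    rintro f g ⟨hf, hg, h⟩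
    refine ⟨hf.1, hg.1, ?_⟩
    simp only [hagree _ f hf]
    exact h
  refine ⟨hagree, hincl, Set.ext fun f => ⟨?_, ?_⟩⟩
  · rintro ⟨g, hg⟩
    exact ⟨⟨g, hincl f g hg⟩, fun z hz => hg.1.2 z hz⟩
  -- The killed semigroup preserves vanishing at `t = 0`, so the difference quotients are zero there
  -- and so is their limit `g`.
  · rintro ⟨⟨g, hfS, hgS, h⟩, hf0⟩
    have hf : f ∈ spaceC0TBdry T Ω := ⟨hfS, fun z hz => hf0 z hz⟩
    simp only [hagree _ f hf] at h
    refine ⟨g, hf, ⟨hgS, fun z hz => ?_⟩, h⟩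
    refine tendsto_nhds_unique (h.tendsto_at z) (tendsto_const_nhds.congr fun s => ?_)
    obtain ⟨k, hk, hks⟩ := hKF.mapsTo s f hf
    rw [← hks, hk.2 z hz, hf0 z hz, sub_zero, mul_zero]
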